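/- Let $(M,g)$ be a smooth Riemannian manifold without boundary (Hausdorff and $\sigma$-compact; for instance a closed Riemannian manifold), let $\mu_g$ be its Riemannian measure, given by $\sqrt{|g|}\,dx^1\cdots dx^n$ in charts, and let $$\Delta=\operatorname{div}\operatorname{grad}=\frac1{\sqrt{|g|}}\sum_{i,j}\frac{\partial}{\partial x^i}\Big(\sqrt{|g|}\,g^{ij}\frac{\partial}{\partial x^j}\Big)$$ be its Laplace–Beltrami operator (with the sign for which $\Delta\le 0$ as an operator). For $z\in\mathbb C$ put $\operatorname{sgn}(z)=\bar z/|z|$ if $z\ne0$ and $\operatorname{sgn}(0)=0$. Let $\psi\in L^2(M,\mu_g)$ be complex-valued and suppose that its distributional Laplacian $\Delta\psi$ belongs to $L^2(M,\mu_g)$. Then Kato's inequality $$\Delta|\psi|\ \ge\ \operatorname{Re}\big(\operatorname{sgn}(\psi)\,\Delta\psi\big)$$ holds in the sense of distributions: both $|\psi|$ and $\operatorname{Re}(\operatorname{sgn}(\psi)\,\Delta\psi)$ are locally integrable, and for every $\varphi\in C_c^\infty(M)$ with $\varphi\ge0$, $$\int_M|\psi|\,\Delta\varphi\,d\mu_g\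 \ge\ \int_M\operatorname{Re}\big(\operatorname{sgn}(\psi)\,\Delta\psi\big)\,\varphi\,d\mu_g .$$ -/

import Mathlib

open Set MeasureTheory
open scoped Manifold ContDiff ComplexConjugate

noncomputable section

namespace KatoManifold

variable {n : ℕ} {M : Type*} [TopologicalSpace M] [ChartedSpace (EuclideanSpace ℝ (Fin n)) M]
  [IsManifold (𝓡 n) ∞ M]

/-- A smooth Riemannian metric on the smooth `n`-manifold `M` (without boundary). -/
abbrev SmoothMetric (n : ℕ) (M : Type*) [TopologicalSpace M]
    [ChartedSpace (EuclideanSpace ℝ (Fin n)) M] [IsManifold (𝓡 n) ∞ M] :=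
  Bundle.ContMDiffRiemannianMetric (𝓡 n) ∞ (EuclideanSpace ℝ (Fin n))
    (fun x : M => TangentSpace (𝓡 n) x)

/-- The `i`-th standard basis vector of `ℝⁿ`. -/
def stdVec (i : Fin n) : EuclideanSpace ℝ (Fin n) := EuclideanSpace.single i 1

/-- The coordinate vector field `∂/∂xⁱ` of the chart `e`, at the point of `M` with
coordinates `y`. -/
def coordVec (e : OpenPartialHomeomorph M (EuclideanSpace ℝ (Fin n))) (i : Fin n)
    (y : EuclideanSpace ℝ (Fin n)) : TangentSpace (𝓡 n) (e.symm y) :=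
  mfderiv (𝓡 n) (𝓡 n) e.symm y (stdVec i : EuclideanSpace ℝ (Fin n))

/-- The matrix `g_ij = g (∂/∂xⁱ, ∂/∂xʲ)` of the metric in the chart `e`, as a function of the
coordinates `y`. Its inverse is the matrix `g^ij` of the dual metric. -/
def gram (g : SmoothMetric n M) (e : OpenPartialHomeomorph M (EuclideanSpace ℝ (Fin n)))
    (y : EuclideanSpace ℝ (Fin n)) : Matrix (Fin n) (Fin n) ℝ :=
  Matrix.of fun i j => g.inner (e.symm y) (coordVec e i y) (coordVec e j y)

/-- The density `√|g|`, with `|g| = det (g_ij)`, in the chart `e`. -/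
def sqrtDet (g : SmoothMetric n M) (e : OpenPartialHomeomorph M (EuclideanSpace ℝ (Fin n)))
    (y : EuclideanSpace ℝ (Fin n)) : ℝ :=
  √(gram g e y).det

/-- The coordinate expression `|g|^(-1/2) ∑ ∂_i (|g|^(1/2) g^ij ∂_j f)` of the Laplacian of `f`
in the chart `e`, at the point `x` of the domain of `e`. -/
def laplacianInChart (g : SmoothMetric n M)
    (e : OpenPartialHomeomorph M (EuclideanSpace ℝ (Fin n))) (f : M → ℝ) (x : M) : ℝ :=
  (sqrtDet g e (e x))⁻¹ *
    ∑ i : Fin n, fderiv ℝ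
      (fun y => sqrtDet g e y *
        ∑ j : Fin n, (gram g e y)⁻¹ i j * fderiv ℝ (fun z => f (e.symm z)) y (stdVec j))
      (e x) (stdVec i)

/-- The Laplace–Beltrami operator `Δ = div grad` (so `Δ ≤ 0` as an operator) on smooth
functions, computed at each point in the preferred chart around that point. -/
def laplaceBeltrami (g : SmoothMetric n M) (f : M → ℝ) (x : M) : ℝ :=
  laplacianInChart g (chartAt (EuclideanSpace ℝ (Fin n)) x) f x

/-- The Riemannian measure `√|g| dx¹ ⋯ dxⁿ` of the domain of the chart `e`, as a measure on `M`
carried by that domain. -/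
def chartVolume [MeasurableSpace M] (g : SmoothMetric n M)
    (e : OpenPartialHomeomorph M (EuclideanSpace ℝ (Fin n))) : Measure M :=
  ((volume.restrict e.target).withDensity fun y => ENNReal.ofReal (sqrtDet g e y)).map e.symm

/-- The Riemannian measure of `(M, g)`: the least measure that dominates `√|g| dx¹ ⋯ dxⁿ` on the
domain of every chart of the atlas. As these local measures agree on overlaps of charts, it is the
measure that restricts to `√|g| dx¹ ⋯ dxⁿ` on the domain of each chart. -/
def riemannianMeasure [MeasurableSpace M] (g : SmoothMetric n M) : Measure M :=
  ⨆ e ∈ atlas (EuclideanSpace ℝ (Fin n)) M, chartVolume g e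

/-- Real-valued test functions: smooth functions with compact support. -/
def IsTestFunction (n : ℕ) {M : Type*} [TopologicalSpace M]
    [ChartedSpace (EuclideanSpace ℝ (Fin n)) M] (φ : M → ℝ) : Prop :=
  ContMDiff (𝓡 n) 𝓘(ℝ, ℝ) ∞ φ ∧ HasCompactSupport φ

/-- `f = Δψ` in the sense of distributions, for locally integrable complex functions `ψ`, `f`.
(By linearity it is enough to test with real-valued test functions.) -/
def IsDistribLaplacian [MeasurableSpace M] (g : SmoothMetric n M) (ψ f : M → ℂ) : Prop :=
  LocallyIntegrable ψ (riemannianMeasure g) ∧ LocallyIntegrable f (riemannianMeasure g) ∧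
    ∀ φ : M → ℝ, IsTestFunction n φ →
      ∫ x, ψ x * (laplaceBeltrami g φ x : ℂ) ∂(riemannianMeasure g) =
        ∫ x, f x * (φ x : ℂ) ∂(riemannianMeasure g)

/-- `Δu ≥ v` in the sense of distributions, for locally integrable real functions `u`, `v`. -/
def DistribLaplacianGE [MeasurableSpace M] (g : SmoothMetric n M) (u v : M → ℝ) : Prop :=
  LocallyIntegrable u (riemannianMeasure g) ∧ LocallyIntegrable v (riemannianMeasure g) ∧
    ∀ φ : M → ℝ, IsTestFunction n φ → (∀ x, 0 ≤ φ x) →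
      ∫ x, v x * φ x ∂(riemannianMeasure g) ≤
        ∫ x, u x * laplaceBeltrami g φ x ∂(riemannianMeasure g)

/-- `sgn z = z̄ / |z|` for `z ≠ 0` and `sgn 0 = 0`. -/
def sgn (z : ℂ) : ℂ := if z = 0 then 0 else conj z / (‖z‖ : ℂ)

end KatoManifold

end

noncomputable section

namespace KatoManifold

open Filter Topology

/-! In a chart with density `w = √|g|`, the equation `Δψ = f` reads `∑ ∂_i (a_ij ∂_j ψ) = w f` with
`a = w g⁻¹`. So the theorem reduces to a statement about weak solutions of elliptic divergence form
equations on open subsets of `ℝⁿ`.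

For smooth real `P`, `Q` put `s = √(P² + Q² + δ²)`. Then `∇s = (P∇P + Q∇Q)/s`, where the
coefficients `P/s`, `Q/s` have squares summing to at most 1, so `a(∇s,∇s) ≤ a(∇P,∇P) + a(∇Q,∇Q)`
(`kato_pointwise`). Applying the weak forms of the operator on `P` and `Q` to the test functions
`φP/s` and `φQ/s` turns this into `kato_smooth`, an inequality free of `1/δ` blow-up.

The real and imaginary parts of `ψ` are only in `L²`, so they are mollified. The commutator of
mollification with the operator is kept in divergence form. Its kernel has mean zero and, at unit
scale, a profile independent of `ε`. By Friedrichs' argument it tends to zero in `L²` even though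
`v` has no known derivatives (`commOp_tendsto`). Hence the mollifications solve equations with
`L²`-convergent data (`WeakEq.exists_approx`), and testing with the solution bounds their gradients
in `L²` (`WeakEq.energy`). Boundedness suffices to pass to the limit: null sequences of flux data
are paired with bounded gradients of the test functions, and no convergence of gradients is needed
(`kato_regularized`). Then `δ → 0` by dominated convergence (`kato_euclidean`).

A cutoff `χ` equal to 1 near the support of `φ` makes a local solution global. The error terms
contain derivatives of `χ` and vanish on the support of `φ` (`kato_local`).

On the manifold, the chart volumes agree on overlaps, and so do the coordinate Laplacians. The
latter follows from invariance of the Dirichlet form rather than from second derivatives of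
transition maps (`divForm_lapCoeff_change`). A partition of unity splits `φ` into pieces supported
in charts, and the chartwise inequalities are summed. -/

/-- Euclidean space of dimension `n`. -/
abbrev Eucl (n : ℕ) : Type := EuclideanSpace ℝ (Fin n)

/-- The `i`-th partial derivative of `f`. -/
def pd {n : ℕ} (i : Fin n) (f : Eucl n → ℝ) (x : Eucl n) : ℝ := fderiv ℝ f x (stdVec i)

/-- The divergence form operator `f ↦ ∑ ∂_i (a_ij ∂_j f)`. -/
def divForm {n : ℕ} (a : Eucl n → Matrix (Fin n) (Fin n) ℝ) (f : Eucl n → ℝ) (x : Eucl n) : ℝ :=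
  ∑ i, pd i (fun y => ∑ j, a y i j * pd j f y) x

/-! ### Calculus of divergence form operators: smoothness, locality, integration by parts -/

section PartialDerivatives

variable {n : ℕ} {i : Fin n} {f g : Eucl n → ℝ} {x : Eucl n} {U : Set (Eucl n)}

lemma pd_add (hf : DifferentiableAt ℝ f x) (hg : DifferentiableAt ℝ g x) :
    pd i (fun y => f y + g y) x = pd i f x + pd i g x := by
  simp [pd, fderiv_fun_add hf hg]

lemma pd_sub (hf : DifferentiableAt ℝ f x) (hg : DifferentiableAt ℝ g x) :
    pd i (fun y => f y - g y) x = pd i f x - pd i g x := by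
  simp [pd, fderiv_fun_sub hf hg]

lemma pd_mul (hf : DifferentiableAt ℝ f x) (hg : DifferentiableAt ℝ g x) :
    pd i (fun y => f y * g y) x = f x * pd i g x + pd i f x * g x := by
  simp [pd, fderiv_fun_mul hf hg]; ring

lemma pd_sum {ι : Type*} {s : Finset ι} {F : ι → Eucl n → ℝ}
    (hF : ∀ j ∈ s, DifferentiableAt ℝ (F j) x) :
    pd i (fun y => ∑ j ∈ s, F j y) x = ∑ j ∈ s, pd i (F j) x := by
  simp [pd, fderiv_fun_sum hF]

lemma pd_congr (h : f =ᶠ[𝓝 x] g) : pd i f x = pd i g x := by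
  simp [pd, h.fderiv_eq]

lemma eventuallyEq_pd (h : f =ᶠ[𝓝 x] g) : pd i f =ᶠ[𝓝 x] pd i g := by
  filter_upwards [h.eventually_nhds] with y hy using pd_congr hy

lemma pd_eq_zero_of_notMem_tsupport (h : x ∉ tsupport f) : pd i f x = 0 := by
  have : f =ᶠ[𝓝 x] fun _ => 0 := notMem_tsupport_iff_eventuallyEq.1 h
  rw [pd_congr this]; simp [pd]

lemma tsupport_pd_subset : tsupport (pd i f) ⊆ tsupport f := by
  refine closure_minimal (fun x hx => ?_) (isClosed_tsupport f)
  by_contra h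
  exact hx (pd_eq_zero_of_notMem_tsupport h)

lemma HasCompactSupport.pd (h : HasCompactSupport f) : HasCompactSupport (pd i f) :=
  h.of_isClosed_subset (isClosed_tsupport _) tsupport_pd_subset

lemma contDiffOn_pd (hU : IsOpen U) (hf : ContDiffOn ℝ ∞ f U) : ContDiffOn ℝ ∞ (pd i f) U :=
  (hf.fderiv_of_isOpen hU (m := ∞) (by simp)).clm_apply contDiffOn_const

lemma contDiff_pd (hf : ContDiff ℝ ∞ f) : ContDiff ℝ ∞ (pd i f) :=
  (hf.fderiv_right (m := ∞) (by simp)).clm_apply contDiff_const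

lemma ContDiff.diffAt (hf : ContDiff ℝ ∞ f) : DifferentiableAt ℝ f x :=
  (hf.differentiable (by simp)).differentiableAt

lemma ContDiffOn.diffAt (hf : ContDiffOn ℝ ∞ f U) (hU : IsOpen U) (hx : x ∈ U) :
    DifferentiableAt ℝ f x :=
  (hf.differentiableOn (by simp)).differentiableAt (hU.mem_nhds hx)

lemma contDiffOn_flux {a : Eucl n → Matrix (Fin n) (Fin n) ℝ}
    (ha : ∀ i j, ContDiffOn ℝ ∞ (fun y => a y i j) U) (hU : IsOpen U) (hf : ContDiffOn ℝ ∞ f U) :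
    ContDiffOn ℝ ∞ (fun y => ∑ j, a y i j * pd j f y) U :=
  ContDiffOn.sum fun j _ => (ha i j).mul (contDiffOn_pd hU hf)

lemma contDiffOn_divForm {a : Eucl n → Matrix (Fin n) (Fin n) ℝ}
    (ha : ∀ i j, ContDiffOn ℝ ∞ (fun y => a y i j) U) (hU : IsOpen U) (hf : ContDiffOn ℝ ∞ f U) :
    ContDiffOn ℝ ∞ (divForm a f) U :=
  ContDiffOn.sum fun _ _ => contDiffOn_pd hU (contDiffOn_flux ha hU hf)

lemma contDiff_flux {a : Eucl n → Matrix (Fin n) (Fin n) ℝ}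
    (ha : ∀ i j, ContDiff ℝ ∞ (fun y => a y i j)) (hf : ContDiff ℝ ∞ f) :
    ContDiff ℝ ∞ (fun y => ∑ j, a y i j * pd j f y) :=
  ContDiff.sum fun j _ => (ha i j).mul (contDiff_pd hf)

lemma contDiff_divForm {a : Eucl n → Matrix (Fin n) (Fin n) ℝ}
    (ha : ∀ i j, ContDiff ℝ ∞ (fun y => a y i j)) (hf : ContDiff ℝ ∞ f) :
    ContDiff ℝ ∞ (divForm a f) :=
  ContDiff.sum fun _ _ => contDiff_pd (contDiff_flux ha hf)

/-- Locality in the coefficients as well as in the function is what later allows a locally defined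
`a` to be replaced by a global elliptic extension. -/
lemma divForm_congr {a b : Eucl n → Matrix (Fin n) (Fin n) ℝ} (hab : a =ᶠ[𝓝 x] b)
    (h : f =ᶠ[𝓝 x] g) : divForm a f x = divForm b g x := by
  refine Finset.sum_congr rfl fun i _ => pd_congr ?_
  have : ∀ j, pd j f =ᶠ[𝓝 x] pd j g := fun j => eventuallyEq_pd h
  filter_upwards [hab, eventually_all.2 this] with y hy hy'
  simp [hy, hy']

lemma tsupport_divForm_subset {a : Eucl n → Matrix (Fin n) (Fin n) ℝ} :
    tsupport (divForm a f) ⊆ tsupport f := by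
  refine closure_minimal (fun x hx => ?_) (isClosed_tsupport f)
  by_contra h
  have : f =ᶠ[𝓝 x] fun _ => 0 := notMem_tsupport_iff_eventuallyEq.1 h
  apply hx
  rw [divForm_congr (EventuallyEq.refl _ a) this]
  simp [divForm, pd]

lemma HasCompactSupport.divForm {a : Eucl n → Matrix (Fin n) (Fin n) ℝ}
    (h : HasCompactSupport f) : HasCompactSupport (divForm a f) :=
  h.of_isClosed_subset (isClosed_tsupport _) tsupport_divForm_subset

/-- A product of a compactly supported continuous function with a function continuous near its
support is continuous. -/
lemma continuous_mul_of_tsupport_subset (hU : IsOpen U) (hf : Continuous f) (hfU : tsupport f ⊆ U)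
    (hg : ContinuousOn g U) : Continuous fun y => f y * g y := by
  refine continuous_iff_continuousAt.2 fun y => ?_
  by_cases hy : y ∈ tsupport f
  · exact hf.continuousAt.mul (hg.continuousAt (hU.mem_nhds (hfU hy)))
  · have : (fun y => f y * g y) =ᶠ[𝓝 y] fun _ => 0 := by
      filter_upwards [notMem_tsupport_iff_eventuallyEq.1 hy] with z hz
      simp [hz]
    exact continuousAt_const.congr this.symm

lemma contDiff_mul_of_tsupport_subset (hU : IsOpen U) (hf : ContDiff ℝ ∞ f)
    (hfU : tsupport f ⊆ U) (hg : ContDiffOn ℝ ∞ g U) : ContDiff ℝ ∞ fun y => f y * g y := by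
  refine contDiff_iff_contDiffAt.2 fun y => ?_
  by_cases hy : y ∈ tsupport f
  · exact hf.contDiffAt.mul (hg.contDiffAt (hU.mem_nhds (hfU hy)))
  · have : (fun y => f y * g y) =ᶠ[𝓝 y] fun _ => 0 := by
      filter_upwards [notMem_tsupport_iff_eventuallyEq.1 hy] with z hz
      simp [hz]
    exact contDiffAt_const.congr_of_eventuallyEq this

/-- Integration by parts against a test function supported in an open set. -/
lemma integral_mul_pd (hU : IsOpen U) (hf : ContDiff ℝ ∞ f) (hfc : HasCompactSupport f)
    (hfU : tsupport f ⊆ U) (hg : ContDiffOn ℝ ∞ g U) :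
    ∫ y, f y * pd i g y = - ∫ y, pd i f y * g y := by
  have hc : Continuous fun y => pd i f y * g y :=
    continuous_mul_of_tsupport_subset hU (contDiff_pd hf).continuous
      (tsupport_pd_subset.trans hfU) hg.continuousOn
  have hc' : Continuous fun y => f y * pd i g y :=
    continuous_mul_of_tsupport_subset hU hf.continuous hfU (contDiffOn_pd hU hg).continuousOn
  have hc'' : Continuous fun y => f y * g y :=
    continuous_mul_of_tsupport_subset hU hf.continuous hfU hg.continuousOn
  exact integral_mul_fderiv_eq_neg_fderiv_mul_of_integrable
    (hc.integrable_of_hasCompactSupport (HasCompactSupport.pd hfc).mul_right)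
    (hc'.integrable_of_hasCompactSupport hfc.mul_right)
    (hc''.integrable_of_hasCompactSupport hfc.mul_right)
    (fun x _ => ContDiff.diffAt hf) (fun x hx => ContDiffOn.diffAt hg hU (hfU hx))

/-- The weak form of the divergence form operator. -/
lemma integral_mul_divForm {a : Eucl n → Matrix (Fin n) (Fin n) ℝ}
    (ha : ∀ i j, ContDiffOn ℝ ∞ (fun y => a y i j) U)
    (hU : IsOpen U) (hf : ContDiff ℝ ∞ f) (hfc : HasCompactSupport f)
    (hfU : tsupport f ⊆ U) (hg : ContDiffOn ℝ ∞ g U) :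
    ∫ y, f y * divForm a g y = - ∫ y, ∑ i, pd i f y * ∑ j, a y i j * pd j g y := by
  have h1 : ∀ i, Integrable fun y => f y * pd i (fun y => ∑ j, a y i j * pd j g y) y := fun i =>
    (continuous_mul_of_tsupport_subset hU hf.continuous hfU
      (contDiffOn_pd hU (contDiffOn_flux ha hU hg)).continuousOn).integrable_of_hasCompactSupport
      hfc.mul_right
  have h2 : ∀ i, Integrable fun y => pd i f y * ∑ j, a y i j * pd j g y := fun i =>
    (continuous_mul_of_tsupport_subset hU (contDiff_pd hf).continuous
      (tsupport_pd_subset.trans hfU)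
      (contDiffOn_flux ha hU hg).continuousOn).integrable_of_hasCompactSupport
      (HasCompactSupport.pd hfc).mul_right
  simp only [divForm, Finset.mul_sum (Finset.univ) _ (f _)]
  rw [integral_finsetSum _ fun i _ => h1 i, integral_finsetSum _ fun i _ => h2 i,
    ← Finset.sum_neg_distrib]
  exact Finset.sum_congr rfl fun i _ => integral_mul_pd hU hf hfc hfU (contDiffOn_flux ha hU hg)

end PartialDerivatives

/-! ### Cauchy–Schwarz and limits of `L²` pairings -/

section SquareIntegrable

variable {α : Type*} [MeasurableSpace α] {μ : Measure α}

lemma integrable_mul_of_memLp_two {f g : α → ℝ} (hf : MemLp f 2 μ) (hg : MemLp g 2 μ) :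
    Integrable (fun x => f x * g x) μ := hf.integrable_mul hg

/-- The Cauchy-Schwarz inequality. -/
lemma sq_integral_mul_le {f g : α → ℝ} (hf : MemLp f 2 μ) (hg : MemLp g 2 μ) :
    (∫ x, f x * g x ∂μ) ^ 2 ≤ (∫ x, f x ^ 2 ∂μ) * ∫ x, g x ^ 2 ∂μ := by
  have hff := hf.integrable_sq
  have hgg := hg.integrable_sq
  have hfg := integrable_mul_of_memLp_two hf hg
  -- `∫ (t f + g)² ≥ 0` for every `t`, so this quadratic in `t` has nonpositive discriminant.
  have key : ∀ t : ℝ, 0 ≤ (∫ x, f x ^ 2 ∂μ) * (t * t) + (2 * ∫ x, f x * g x ∂μ) * t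
      + ∫ x, g x ^ 2 ∂μ := by
    intro t
    have h : 0 ≤ ∫ x, (t * f x + g x) ^ 2 ∂μ := integral_nonneg fun x => sq_nonneg _
    have e : ∀ x, (t * f x + g x) ^ 2 = t ^ 2 * f x ^ 2 + (2 * t) * (f x * g x) + g x ^ 2 :=
      fun x => by ring
    simp only [e] at h
    have hs : Integrable (fun x => t ^ 2 * f x ^ 2 + (2 * t) * (f x * g x)) μ :=
      (hff.const_mul _).add (hfg.const_mul _)
    rw [integral_add hs hgg,
      integral_add (hff.const_mul _) (hfg.const_mul _), integral_const_mul,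
      integral_const_mul] at h
    linarith
  have := discrim_le_zero key
  rw [discrim] at this
  linarith

/-- The pairing of an `L²`-null sequence with an `L²`-bounded sequence tends to zero. -/
lemma tendsto_integral_mul_zero {f g : ℕ → α → ℝ} (hf : ∀ k, MemLp (f k) 2 μ)
    (hg : ∀ k, MemLp (g k) 2 μ) (hf0 : Tendsto (fun k => ∫ x, f k x ^ 2 ∂μ) atTop (𝓝 0))
    {C : ℝ} (hC : ∀ k, ∫ x, g k x ^ 2 ∂μ ≤ C) :
    Tendsto (fun k => ∫ x, f k x * g k x ∂μ) atTop (𝓝 0) := by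
  have h : Tendsto (fun k => (∫ x, f k x * g k x ∂μ) ^ 2) atTop (𝓝 0) := by
    refine squeeze_zero (fun k => sq_nonneg _) (fun k => ?_) (by simpa using hf0.mul_const C)
    exact (sq_integral_mul_le (hf k) (hg k)).trans
      (mul_le_mul_of_nonneg_left (hC k) (integral_nonneg fun x => sq_nonneg _))
  have h' := h.sqrt
  simp only [Real.sqrt_sq_eq_abs, Real.sqrt_zero] at h'
  exact (tendsto_zero_iff_abs_tendsto_zero _).2 h'

/-- An `L²`-convergent sequence is bounded. -/
lemma exists_integral_sq_le {f : ℕ → α → ℝ} {f₀ : α → ℝ} (hf : ∀ k, MemLp (f k) 2 μ)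
    (hf₀ : MemLp f₀ 2 μ) (h : Tendsto (fun k => ∫ x, (f k x - f₀ x) ^ 2 ∂μ) atTop (𝓝 0)) :
    ∃ C, ∀ k, ∫ x, f k x ^ 2 ∂μ ≤ C := by
  obtain ⟨B, hB⟩ := h.bddAbove_range
  refine ⟨2 * B + 2 * ∫ x, f₀ x ^ 2 ∂μ, fun k => ?_⟩
  have h1 : Integrable (fun x => (f k x - f₀ x) ^ 2) μ := ((hf k).sub hf₀).integrable_sq
  have h2 := hf₀.integrable_sq
  have h3 : ∫ x, f k x ^ 2 ∂μ ≤ ∫ x, (2 * (f k x - f₀ x) ^ 2 + 2 * f₀ x ^ 2) ∂μ := by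
    refine integral_mono (hf k).integrable_sq ((h1.const_mul 2).add (h2.const_mul 2)) fun x => ?_
    -- The gap between the two sides is exactly this square.
    have := sq_nonneg (f k x - 2 * f₀ x)
    simp only
    nlinarith
  rw [integral_add (h1.const_mul 2) (h2.const_mul 2), integral_const_mul,
    integral_const_mul] at h3
  have h4 : ∫ x, (f k x - f₀ x) ^ 2 ∂μ ≤ B := hB ⟨k, rfl⟩
  linarith

end SquareIntegrable

/-! ### Translations and averages of increments in `L²` -/

section Translation

variable {n : ℕ}

lemma enorm_sq_eq_ofReal (a : ℝ) : ‖a‖ₑ ^ 2 = ENNReal.ofReal (a ^ 2) := by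
  rw [Real.enorm_eq_ofReal_abs, ← ENNReal.ofReal_pow (abs_nonneg _), sq_abs]

lemma enorm_sub_sq_le (a b : ℝ) : ‖a - b‖ₑ ^ 2 ≤ 2 * ‖a‖ₑ ^ 2 + 2 * ‖b‖ₑ ^ 2 := by
  simp only [enorm_sq_eq_ofReal]
  rw [← ENNReal.ofReal_ofNat 2, ← ENNReal.ofReal_mul (by norm_num),
    ← ENNReal.ofReal_mul (by norm_num), ← ENNReal.ofReal_add (by positivity) (by positivity)]
  exact ENNReal.ofReal_le_ofReal (by nlinarith [sq_nonneg (a + b)])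

/-- Translations act continuously on `L²`. -/
lemma tendsto_lintegral_translate {v : Eucl n → ℝ} (hv : MemLp v 2 volume) :
    Tendsto (fun z : Eucl n => ∫⁻ x, ‖v (x + z) - v x‖ₑ ^ 2) (𝓝 0) (𝓝 0) := by
  -- Translations form a continuous family of measure preserving maps for the compact-open topology,
  -- so their action on a fixed `L²` class is continuous in the parameter.
  let T : Eucl n → C(Eucl n, Eucl n) := fun z => ⟨fun x => x + z, by fun_prop⟩
  have hTc : Continuous T := by
    let g : C(Eucl n × Eucl n, Eucl n) := ⟨fun p => p.2 + p.1, by fun_prop⟩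
    exact g.curry.continuous
  have hm : ∀ z, MeasurePreserving (T z) volume volume := fun z =>
    measurePreserving_add_right volume z
  have hc : Continuous fun z => Lp.compMeasurePreserving (T z) (hm z) (hv.toLp v) :=
    continuous_const.compMeasurePreservingLp hTc hm (by simp)
  have h0 : Tendsto (fun z => edist (Lp.compMeasurePreserving (T z) (hm z) (hv.toLp v))
      (hv.toLp v)) (𝓝 0) (𝓝 0) := by
    have h := (hc.tendsto 0).edist (tendsto_const_nhds (x := hv.toLp v))
    have e : Lp.compMeasurePreserving (T 0) (hm 0) (hv.toLp v) = hv.toLp v := by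
      rw [Lp.toLp_compMeasurePreserving]
      congr 1
      ext x
      simp [T]
    rwa [e, edist_self] at h
  have h1 : ∀ z, ∫⁻ x, ‖v (x + z) - v x‖ₑ ^ 2 =
      (edist (Lp.compMeasurePreserving (T z) (hm z) (hv.toLp v)) (hv.toLp v)) ^ 2 := by
    intro z
    rw [Lp.toLp_compMeasurePreserving, Lp.edist_toLp_toLp,
      eLpNorm_eq_lintegral_rpow_enorm_toReal (by simp) (by simp)]
    simp only [ENNReal.toReal_ofNat, ENNReal.rpow_ofNat, Pi.sub_apply, Function.comp]
    rw [← ENNReal.rpow_natCast, ← ENNReal.rpow_mul]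
    simp [T]
  simp only [h1]
  simpa using ENNReal.Tendsto.pow (n := 2) h0

/-- An approximate identity built from a finite measure converges in `L²`. -/
lemma tendsto_lintegral_sq_average {v : Eucl n → ℝ} (hv : MemLp v 2 volume) (hvm : Measurable v)
    (ν : Measure (Eucl n)) [IsFiniteMeasure ν] {ε : ℕ → ℝ} (hε : Tendsto ε atTop (𝓝 0)) :
    (∀ k, ∫⁻ x, (∫⁻ w, ‖v (x + ε k • w) - v x‖ₑ ∂ν) ^ 2 < ⊤) ∧
    Tendsto (fun k => ∫⁻ x, (∫⁻ w, ‖v (x + ε k • w) - v x‖ₑ ∂ν) ^ 2) atTop (𝓝 0) := by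
  have hmeas : ∀ k, Measurable fun p : Eucl n × Eucl n => ‖v (p.1 + ε k • p.2) - v p.1‖ₑ :=
    fun k => by fun_prop
  have hCS : ∀ k x, (∫⁻ w, ‖v (x + ε k • w) - v x‖ₑ ∂ν) ^ 2 ≤
      ν univ * ∫⁻ w, ‖v (x + ε k • w) - v x‖ₑ ^ 2 ∂ν := by
    intro k x
    have hm : Measurable fun w => ‖v (x + ε k • w) - v x‖ₑ := by fun_prop
    -- Cauchy–Schwarz against the constant 1; the price is the total mass of `ν`.
    have h := ENNReal.lintegral_mul_le_Lp_mul_Lq ν Real.HolderConjugate.two_two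
      (f := fun w => ‖v (x + ε k • w) - v x‖ₑ) (g := fun _ => 1) hm.aemeasurable
      aemeasurable_const
    simp only [Pi.mul_apply, mul_one, ENNReal.one_rpow, lintegral_const, one_mul] at h
    calc _ ≤ _ := pow_le_pow_left₀ zero_le h 2
      _ = _ := by
        rw [mul_pow, ← ENNReal.rpow_natCast, ← ENNReal.rpow_natCast, ← ENNReal.rpow_mul,
          ← ENNReal.rpow_mul]
        simp [mul_comm]
  have hbound : ∀ k, ∫⁻ x, (∫⁻ w, ‖v (x + ε k • w) - v x‖ₑ ∂ν) ^ 2 ≤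
      ν univ * ∫⁻ w, (∫⁻ x, ‖v (x + ε k • w) - v x‖ₑ ^ 2) ∂ν := by
    intro k
    refine (lintegral_mono fun x => hCS k x).trans (le_of_eq ?_)
    rw [lintegral_const_mul' _ _ (measure_ne_top _ _), lintegral_lintegral_swap]
    exact ((hmeas k).pow_const 2).aemeasurable
  have hnorm : ∫⁻ x, ‖v x‖ₑ ^ 2 < ⊤ := by
    have := hv.2
    rw [eLpNorm_lt_top_iff_lintegral_rpow_enorm_lt_top (by simp) (by simp)] at this
    simpa using this
  -- Translation invariance gives a majorant uniform in `z`, a constant that is integrable for the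
  -- finite measure `ν`; this permits dominated convergence in `w`.
  have hdom : ∀ z, ∫⁻ x, ‖v (x + z) - v x‖ₑ ^ 2 ≤ 4 * ∫⁻ x, ‖v x‖ₑ ^ 2 := by
    intro z
    have e : ∫⁻ x, ‖v (x + z)‖ₑ ^ 2 = ∫⁻ x, ‖v x‖ₑ ^ 2 :=
      lintegral_add_right_eq_self (fun x => ‖v x‖ₑ ^ 2) z
    calc ∫⁻ x, ‖v (x + z) - v x‖ₑ ^ 2
        ≤ ∫⁻ x, (2 * ‖v (x + z)‖ₑ ^ 2 + 2 * ‖v x‖ₑ ^ 2) := lintegral_mono fun _ =>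
          enorm_sub_sq_le _ _
      _ = 4 * ∫⁻ x, ‖v x‖ₑ ^ 2 := by
          rw [lintegral_add_left (by fun_prop), lintegral_const_mul _ (by fun_prop),
            lintegral_const_mul _ (by fun_prop), e, ← add_mul]
          norm_num
  have hfin : ∫⁻ _ : Eucl n, 4 * ∫⁻ x, ‖v x‖ₑ ^ 2 ∂volume ∂ν < ⊤ := by
    rw [lintegral_const]
    exact ENNReal.mul_lt_top (ENNReal.mul_lt_top (by simp) hnorm) (measure_lt_top _ _)
  have hlim : Tendsto (fun k => ∫⁻ w, (∫⁻ x, ‖v (x + ε k • w) - v x‖ₑ ^ 2) ∂ν) atTop (𝓝 0) := by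
    have h := tendsto_lintegral_of_dominated_convergence (μ := ν)
      (F := fun k w => ∫⁻ x, ‖v (x + ε k • w) - v x‖ₑ ^ 2) (f := fun _ => 0)
      (fun _ => 4 * ∫⁻ x, ‖v x‖ₑ ^ 2)
      (fun k => Measurable.lintegral_prod_left ((hmeas k).pow_const 2))
      (fun k => Eventually.of_forall fun w => hdom _)
      hfin.ne
      (Eventually.of_forall fun w => (tendsto_lintegral_translate hv).comp (by
        simpa using hε.smul_const w))
    simpa using h
  refine ⟨fun k => (hbound k).trans_lt (ENNReal.mul_lt_top (measure_lt_top _ _)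
    ((lintegral_mono fun w => hdom _).trans_lt hfin)), ?_⟩
  refine tendsto_of_tendsto_of_tendsto_of_le_of_le tendsto_const_nhds ?_
    (fun k => zero_le) hbound
  simpa using ENNReal.Tendsto.const_mul hlim (Or.inr (measure_ne_top ν univ))

/-- A sequence dominated by averages of translation differences is an `L²`-null sequence. -/
lemma tendsto_integral_sq_of_average_bound {v : Eucl n → ℝ} (hv : MemLp v 2 volume)
    (hvm : Measurable v) (ν : Measure (Eucl n)) [IsFiniteMeasure ν] {ε : ℕ → ℝ}
    (hε : Tendsto ε atTop (𝓝 0)) {R : ℕ → Eucl n → ℝ} (hR : ∀ k, AEStronglyMeasurable (R k) volume)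
    (hb : ∀ k x, ‖R k x‖ₑ ≤ ∫⁻ w, ‖v (x + ε k • w) - v x‖ₑ ∂ν) :
    (∀ k, MemLp (R k) 2 volume) ∧ Tendsto (fun k => ∫ x, R k x ^ 2) atTop (𝓝 0) := by
  have hle : ∀ k, ∫⁻ x, ‖R k x‖ₑ ^ 2 ≤ ∫⁻ x, (∫⁻ w, ‖v (x + ε k • w) - v x‖ₑ ∂ν) ^ 2 :=
    fun k => lintegral_mono fun x => pow_le_pow_left₀ zero_le (hb k x) 2
  obtain ⟨hfin, hlim⟩ := tendsto_lintegral_sq_average hv hvm ν hε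
  refine ⟨fun k => ⟨hR k, ?_⟩, ?_⟩
  · rw [eLpNorm_lt_top_iff_lintegral_rpow_enorm_lt_top (by simp) (by simp)]
    simpa using (hle k).trans_lt (hfin k)
  have h : Tendsto (fun k => ∫⁻ x, ‖R k x‖ₑ ^ 2) atTop (𝓝 0) :=
    tendsto_of_tendsto_of_tendsto_of_le_of_le tendsto_const_nhds
      hlim (fun k => zero_le) hle
  have h2 := (ENNReal.tendsto_toReal ENNReal.zero_ne_top).comp h
  refine Tendsto.congr (fun k => ?_) h2
  rw [integral_eq_lintegral_of_nonneg_ae (Eventually.of_forall fun x => sq_nonneg _)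
    ((hR k).pow 2)]
  simp only [Function.comp]
  congr 2
  ext x
  exact enorm_sq_eq_ofReal _

end Translation

/-! ### Mollification by a rescaled even bump -/

section Mollifier

variable {n : ℕ}

/-- A fixed smooth even probability density supported in the unit ball. -/
def stdBump (n : ℕ) : Eucl n → ℝ :=
  (⟨1 / 2, 1, by norm_num, by norm_num⟩ : ContDiffBump (0 : Eucl n)).normed volume

lemma contDiff_stdBump : ContDiff ℝ ∞ (stdBump n) := ContDiffBump.contDiff_normed _

lemma hasCompactSupport_stdBump : HasCompactSupport (stdBump n) :=
  ContDiffBump.hasCompactSupport_normed _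

lemma stdBump_nonneg (x : Eucl n) : 0 ≤ stdBump n x := ContDiffBump.nonneg_normed _ x

lemma stdBump_neg (x : Eucl n) : stdBump n (-x) = stdBump n x := ContDiffBump.normed_neg _ x

lemma integral_stdBump : ∫ x, stdBump n x = 1 := ContDiffBump.integral_normed _

/-- The rescaled bump `ε⁻ⁿ ρ(x/ε)`. -/
def bump (ε : ℝ) (x : Eucl n) : ℝ := (ε ^ n)⁻¹ * stdBump n (ε⁻¹ • x)

variable {ε : ℝ} {i : Fin n}

lemma contDiff_bump : ContDiff ℝ ∞ (bump (n := n) ε) :=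
  contDiff_const.mul (contDiff_stdBump.comp (contDiff_const_smul _))

lemma hasCompactSupport_bump (hε : 0 < ε) : HasCompactSupport (bump (n := n) ε) :=
  (hasCompactSupport_stdBump.comp_smul (inv_ne_zero hε.ne')).mul_left

lemma bump_neg (x : Eucl n) : bump ε (-x) = bump ε x := by
  simp [bump, stdBump_neg]

lemma bump_smul (hε : 0 < ε) (w : Eucl n) : ε ^ n * bump ε (ε • w) = stdBump n w := by
  simp [bump, smul_smul, hε.ne']

/-- Differentiating the bump costs one factor `ε⁻¹`, made explicit here so that the Lipschitz bound
on the coefficients can cancel it in the commutator. -/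
lemma pd_bump_smul (hε : 0 < ε) (w : Eucl n) :
    ε ^ n * (ε * pd i (bump ε) (ε • w)) = pd i (stdBump n) w := by
  have h : HasFDerivAt (bump (n := n) ε)
      ((ε ^ n)⁻¹ • (fderiv ℝ (stdBump n) w).comp (ε⁻¹ • ContinuousLinearMap.id ℝ (Eucl n)))
      (ε • w) := by
    have h1 : HasFDerivAt (stdBump n) (fderiv ℝ (stdBump n) w) (ε⁻¹ • (ε • w)) := by
      rw [smul_smul, inv_mul_cancel₀ hε.ne', one_smul]
      exact (ContDiff.diffAt contDiff_stdBump).hasFDerivAt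
    exact (h1.comp (ε • w) ((hasFDerivAt_id _).const_smul ε⁻¹)).const_mul _
  have hn : ε ^ n ≠ 0 := (pow_pos hε n).ne'
  simp only [pd, h.fderiv, smul_apply, ContinuousLinearMap.comp_apply,
    ContinuousLinearMap.id_apply, map_smul, smul_eq_mul]
  field_simp

/-- The substitution `y = x + εw` brings integrals against kernels concentrated at scale `ε` around
`x` to unit scale. -/
lemma integral_shift_scale (hε : 0 < ε) (x : Eucl n) (F : Eucl n → ℝ) :
    ∫ y, F y = ∫ w, ε ^ n * F (x + ε • w) := by
  rw [integral_const_mul, Measure.integral_comp_smul_of_nonneg volume (fun w => F (x + w)) ε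
    (hR := hε.le), integral_add_left_eq_self]
  simp [(pow_pos hε n).ne']

lemma integral_bump (hε : 0 < ε) : ∫ x : Eucl n, bump ε x = 1 := by
  rw [integral_shift_scale hε 0]
  simp [bump_smul hε, integral_stdBump]

/-- A kernel operator applied to increments is dominated by an average of increments. -/
lemma enorm_integral_kernel_le (hε : 0 < ε) {k : Eucl n → Eucl n → ℝ} {Φ : Eucl n → ℝ}
    (hΦ : Continuous Φ) (hk : ∀ x w, |ε ^ n * k (x + ε • w) x| ≤ Φ w) (v : Eucl n → ℝ)
    (hv : Measurable v) (x : Eucl n) :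
    ‖∫ y, k y x * (v y - v x)‖ₑ ≤
      ∫⁻ w, ‖v (x + ε • w) - v x‖ₑ ∂(volume.withDensity fun w => ENNReal.ofReal (Φ w)) := by
  rw [integral_shift_scale hε x, lintegral_withDensity_eq_lintegral_mul₀ (by fun_prop)
    (by fun_prop)]
  refine (enorm_integral_le_lintegral_enorm _).trans (lintegral_mono fun w => ?_)
  rw [← mul_assoc, enorm_mul]
  simp only [Pi.mul_apply]
  gcongr
  rw [Real.enorm_eq_ofReal_abs]
  exact ENNReal.ofReal_le_ofReal (hk x w)

/-- Mollification. -/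
def moll (ε : ℝ) (f : Eucl n → ℝ) : Eucl n → ℝ :=
  convolution f (bump ε) (ContinuousLinearMap.mul ℝ ℝ) volume

lemma moll_apply (f : Eucl n → ℝ) (x : Eucl n) : moll ε f x = ∫ y, f y * bump ε (x - y) := rfl

lemma contDiff_moll (hε : 0 < ε) {f : Eucl n → ℝ} (hf : LocallyIntegrable f) :
    ContDiff ℝ ∞ (moll ε f) :=
  (hasCompactSupport_bump hε).contDiff_convolution_right _ hf contDiff_bump

lemma hasCompactSupport_moll (hε : 0 < ε) {f : Eucl n → ℝ} (hf : HasCompactSupport f) :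
    HasCompactSupport (moll ε f) :=
  HasCompactSupport.convolution _ hf (hasCompactSupport_bump hε)

lemma pd_moll (hε : 0 < ε) {f : Eucl n → ℝ} (hf : LocallyIntegrable f) (x : Eucl n) :
    pd i (moll ε f) x = ∫ y, f y * pd i (bump ε) (x - y) := by
  have hb : ContDiff ℝ 1 (bump (n := n) ε) := contDiff_bump.of_le (by simp)
  have h := (hasCompactSupport_bump hε).hasFDerivAt_convolution_right
    (ContinuousLinearMap.mul ℝ ℝ) hf hb x
  rw [pd, moll, h.fderiv, convolution_precompR_apply _ hf ((hasCompactSupport_bump hε).fderiv ℝ)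
    (hb.continuous_fderiv (by simp))]
  rfl

lemma pd_bump_sub (x y : Eucl n) :
    pd i (fun y => bump ε (x - y)) y = - pd i (bump ε) (x - y) := by
  have h := (ContDiff.diffAt (contDiff_bump (n := n) (ε := ε)) (x := x - y)).hasFDerivAt.comp y
    ((hasFDerivAt_id y).const_sub x)
  have e : (fun y => bump ε (x - y)) = bump ε ∘ fun y => x - id y := rfl
  simp [pd, e, h.fderiv]

lemma hasCompactSupport_bump_sub (hε : 0 < ε) (x : Eucl n) :
    HasCompactSupport fun y => bump ε (x - y) :=
  (hasCompactSupport_bump hε).comp_homeomorph (Homeomorph.subLeft x)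

lemma contDiff_bump_sub (x : Eucl n) : ContDiff ℝ ∞ fun y => bump ε (x - y) :=
  contDiff_bump.comp (contDiff_const.sub contDiff_id)

/-- Integration by parts moves the derivative onto the kernel, giving the same integral as
differentiating the convolution; hence mollification commutes with `pd`. -/
lemma moll_pd (hε : 0 < ε) {f : Eucl n → ℝ} (hf : ContDiff ℝ ∞ f) (x : Eucl n) :
    moll ε (pd i f) x = ∫ y, f y * pd i (bump ε) (x - y) := by
  have h := integral_mul_pd (i := i) isOpen_univ (contDiff_bump_sub (ε := ε) x)
    (hasCompactSupport_bump_sub hε x) (subset_univ _) hf.contDiffOn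
  simp only [pd_bump_sub, neg_mul, integral_neg, neg_neg] at h
  rw [moll_apply]
  simp only [mul_comm (pd i f _), mul_comm (f _), h]

lemma pd_moll_eq_moll_pd (hε : 0 < ε) {f : Eucl n → ℝ} (hf : ContDiff ℝ ∞ f) :
    pd i (moll ε f) = moll ε (pd i f) :=
  funext fun x => by rw [moll_pd hε hf, pd_moll hε hf.continuous.locallyIntegrable]

/-- The kernel has total mass 1, so the mollification error is an average of increments of `v`,
which the translation estimates control. -/
lemma moll_sub_self (hε : 0 < ε) {v : Eucl n → ℝ} (hv : Integrable v) (x : Eucl n) :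
    moll ε v x - v x = ∫ y, bump ε (x - y) * (v y - v x) := by
  have h1 : Integrable fun y => v y * bump ε (x - y) :=
    (hasCompactSupport_bump hε).convolutionExists_right (ContinuousLinearMap.mul ℝ ℝ)
      hv.locallyIntegrable contDiff_bump.continuous x
  have h2 : Integrable fun y => v x * bump ε (x - y) :=
    ((contDiff_bump_sub x).continuous.integrable_of_hasCompactSupport
      (hasCompactSupport_bump_sub hε x)).const_mul _
  have e : ∀ y, bump ε (x - y) * (v y - v x) = v y * bump ε (x - y) - v x * bump ε (x - y) :=
    fun y => by ring
  simp only [e]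
  rw [integral_sub h1 h2, integral_const_mul, integral_sub_left_eq_self (bump ε) volume x,
    integral_bump hε, mul_one, moll_apply]

/-- Fubini for a bounded continuous kernel. -/
lemma integral_kernel_swap {k : Eucl n → Eucl n → ℝ} (hk : Continuous fun p : Eucl n × Eucl n =>
    k p.1 p.2) {C : ℝ} (hC : ∀ x y, |k x y| ≤ C) {f g : Eucl n → ℝ} (hf : Integrable f)
    (hg : Integrable g) :
    ∫ x, f x * ∫ y, k x y * g y = ∫ y, (∫ x, k x y * f x) * g y := by
  have hi : Integrable (fun p : Eucl n × Eucl n => k p.1 p.2 * (f p.1 * g p.2))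
      (volume.prod volume) :=
    (hf.mul_prod hg).bdd_mul (c := C) hk.aestronglyMeasurable (Eventually.of_forall fun p => hC _ _)
  calc ∫ x, f x * ∫ y, k x y * g y = ∫ x, ∫ y, k x y * (f x * g y) := by
        congr 1; ext x; rw [← integral_const_mul]; congr 1; ext y; ring
    _ = ∫ y, ∫ x, k x y * (f x * g y) := integral_integral_swap hi
    _ = _ := by
        congr 1; ext y; rw [← integral_mul_const]; congr 1; ext x; ring

lemma exists_abs_le_of_hasCompactSupport {f : Eucl n → ℝ} (hf : Continuous f)
    (hc : HasCompactSupport f) : ∃ C, ∀ x, |f x| ≤ C := by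
  simpa using hf.bounded_above_of_compact_support hc

/-- Mollification is symmetric. -/
lemma integral_mul_moll (hε : 0 < ε) {f g : Eucl n → ℝ} (hf : Integrable f) (hg : Integrable g) :
    ∫ x, f x * moll ε g x = ∫ x, moll ε f x * g x := by
  obtain ⟨C, hC⟩ := exists_abs_le_of_hasCompactSupport (contDiff_bump (ε := ε)).continuous
    (hasCompactSupport_bump (n := n) hε)
  have h := integral_kernel_swap (k := fun x y => bump ε (x - y))
    (contDiff_bump.continuous.comp (continuous_fst.sub continuous_snd)) (fun x y => hC _) hf hg
  calc _ = ∫ x, f x * ∫ y, bump ε (x - y) * g y := by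
        simp only [moll_apply, mul_comm]
    _ = _ := h
    _ = _ := by
        congr 1; ext y; rw [moll_apply]; congr 2; ext x
        rw [← bump_neg, neg_sub, mul_comm]

end Mollifier

/-! ### Friedrichs' commutator of mollification with the divergence form operator -/

section Commutator

variable {n : ℕ} {ε : ℝ} {a : Eucl n → Matrix (Fin n) (Fin n) ℝ} {L : ℝ}

lemma integral_pd_eq_zero {i : Fin n} {f : Eucl n → ℝ} (hf : ContDiff ℝ ∞ f)
    (hc : HasCompactSupport f) : ∫ x, pd i f x = 0 := by
  have h := integral_mul_pd (i := i) (g := fun _ => 1) isOpen_univ hf hc (subset_univ _)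
    contDiffOn_const
  simp only [mul_one] at h
  rw [eq_comm, neg_eq_iff_eq_neg] at h
  rw [h]
  simp [pd]

/-- The kernel of the commutator of mollification with a divergence form operator. -/
def commKernel (ε : ℝ) (a : Eucl n → Matrix (Fin n) (Fin n) ℝ) (j : Fin n) (y x : Eucl n) : ℝ :=
  ∑ i, (pd i (bump ε) (y - x) * (a x i j - a y i j) - pd i (fun z => a z i j) y * bump ε (y - x))

/-- The profile dominating the commutator kernel. -/
def commProfile (n : ℕ) (L : ℝ) (w : Eucl n) : ℝ :=
  ∑ i, (|pd i (stdBump n) w| * (L * ‖w‖) + L * stdBump n w)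

lemma continuous_commProfile : Continuous (commProfile n L) := by
  have h1 : ∀ i, Continuous (pd i (stdBump n)) := fun i => (contDiff_pd contDiff_stdBump).continuous
  have h2 : Continuous (stdBump n) := contDiff_stdBump.continuous
  unfold commProfile
  fun_prop

lemma hasCompactSupport_commProfile : HasCompactSupport (commProfile n L) := by
  refine hasCompactSupport_stdBump.of_isClosed_subset (isClosed_tsupport _)
    (closure_minimal (fun x hx => ?_) (isClosed_tsupport _))
  by_contra h
  apply hx
  simp [commProfile, pd_eq_zero_of_notMem_tsupport h, image_eq_zero_of_notMem_tsupport h]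

lemma continuous_commKernel (ha : ∀ i j, ContDiff ℝ ∞ fun y => a y i j) (j : Fin n) :
    Continuous fun p : Eucl n × Eucl n => commKernel ε a j p.1 p.2 := by
  have h1 : ∀ i, Continuous (pd i (bump (n := n) ε)) :=
    fun i => (contDiff_pd contDiff_bump).continuous
  have h2 : Continuous (bump (n := n) ε) := contDiff_bump.continuous
  have h3 : ∀ i j, Continuous fun y => a y i j := fun i j => (ha i j).continuous
  have h4 : ∀ i j, Continuous (pd i fun y => a y i j) :=
    fun i j => (contDiff_pd (ha i j)).continuous
  unfold commKernel
  refine continuous_finsetSum _ fun i _ => ?_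
  exact (((h1 i).comp (continuous_fst.sub continuous_snd)).mul
    (((h3 i j).comp continuous_snd).sub ((h3 i j).comp continuous_fst))).sub
    (((h4 i j).comp continuous_fst).mul (h2.comp (continuous_fst.sub continuous_snd)))

/-- The factor `ε⁻¹` from `∂ρ_ε` is compensated by `|a(x) - a(x + εw)| ≤ Lε‖w‖`. After rescaling,
the kernel is bounded by a profile independent of `ε` and `x`. -/
lemma abs_commKernel_le (hε : 0 < ε) (hL : ∀ i j x y, |a x i j - a y i j| ≤ L * ‖x - y‖)
    (hL' : ∀ i j x, |pd i (fun y => a y i j) x| ≤ L) (j : Fin n) (x w : Eucl n) :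
    |ε ^ n * commKernel ε a j (x + ε • w) x| ≤ commProfile n L w := by
  rw [commKernel, Finset.mul_sum]
  refine (Finset.abs_sum_le_sum_abs _ _).trans (Finset.sum_le_sum fun i _ => ?_)
  have e : ε ^ n * (pd i (bump ε) (x + ε • w - x) * (a x i j - a (x + ε • w) i j) -
      pd i (fun z => a z i j) (x + ε • w) * bump ε (x + ε • w - x)) =
      pd i (stdBump n) w * (ε⁻¹ * (a x i j - a (x + ε • w) i j)) -
      pd i (fun z => a z i j) (x + ε • w) * stdBump n w := by
    rw [← pd_bump_smul hε w, ← bump_smul hε w, add_sub_cancel_left]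
    field_simp
  rw [e]
  refine (abs_sub _ _).trans (add_le_add ?_ ?_)
  · rw [abs_mul]
    refine mul_le_mul_of_nonneg_left ?_ (abs_nonneg _)
    rw [abs_mul, abs_of_pos (inv_pos.2 hε), inv_mul_le_iff₀ hε]
    refine (hL i j _ _).trans (le_of_eq ?_)
    rw [sub_add_cancel_left, norm_neg, norm_smul, Real.norm_of_nonneg hε.le]
    ring
  · rw [abs_mul, abs_of_nonneg (stdBump_nonneg w)]
    exact mul_le_mul_of_nonneg_right (hL' _ _ _) (stdBump_nonneg w)

/-- The constant depends on `ε`; it only serves to justify integrability and Fubini at a fixed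
scale. -/
lemma exists_abs_commKernel_le (hε : 0 < ε) (hL : ∀ i j x y, |a x i j - a y i j| ≤ L * ‖x - y‖)
    (hL' : ∀ i j x, |pd i (fun y => a y i j) x| ≤ L) (j : Fin n) :
    ∃ C, ∀ y x, |commKernel ε a j y x| ≤ C := by
  obtain ⟨C, hC⟩ := exists_abs_le_of_hasCompactSupport (continuous_commProfile (n := n) (L := L))
    hasCompactSupport_commProfile
  refine ⟨(ε ^ n)⁻¹ * C, fun y x => ?_⟩
  have h := (abs_commKernel_le hε hL hL' j x (ε⁻¹ • (y - x))).trans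
    ((le_abs_self _).trans (hC _))
  rw [smul_smul, mul_inv_cancel₀ hε.ne', one_smul, add_sub_cancel, abs_mul,
    abs_of_pos (pow_pos hε n)] at h
  rwa [le_inv_mul_iff₀ (pow_pos hε n)]

lemma bump_sub_eq (x : Eucl n) : (fun y => bump ε (y - x)) = fun y => bump ε (x - y) := by
  ext y; rw [← bump_neg, neg_sub]

lemma pd_bump_sub' (i : Fin n) (x y : Eucl n) :
    pd i (fun y => bump ε (y - x)) y = pd i (bump ε) (y - x) := by
  have h := (ContDiff.diffAt (contDiff_bump (n := n) (ε := ε)) (x := y - x)).hasFDerivAt.comp y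
    ((hasFDerivAt_id y).sub_const x)
  have e : (fun y => bump ε (y - x)) = bump ε ∘ fun y => id y - x := rfl
  rw [pd, e, h.fderiv]
  rfl

/-- As a function of `y` the kernel is the divergence `∑ ∂_i [ρ_ε(y - x)(a_ij(x) - a_ij(y))]` of a
compactly supported field, so it integrates to zero. -/
lemma integral_commKernel (hε : 0 < ε) (ha : ∀ i j, ContDiff ℝ ∞ fun y => a y i j) (j : Fin n)
    (x : Eucl n) : Integrable (fun y => commKernel ε a j y x) ∧ ∫ y, commKernel ε a j y x = 0 := by
  have hs : ContDiff ℝ ∞ fun y => bump ε (y - x) := by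
    rw [bump_sub_eq]; exact contDiff_bump_sub x
  have hc : HasCompactSupport fun y => bump ε (y - x) := by
    rw [bump_sub_eq]; exact hasCompactSupport_bump_sub hε x
  have hd : ∀ i, ContDiff ℝ ∞ fun y => a x i j - a y i j := fun i => contDiff_const.sub (ha i j)
  have e : ∀ i y, pd i (bump ε) (y - x) * (a x i j - a y i j) -
      pd i (fun z => a z i j) y * bump ε (y - x) =
      pd i (fun y => bump ε (y - x) * (a x i j - a y i j)) y := by
    intro i y
    rw [pd_mul (ContDiff.diffAt hs) (ContDiff.diffAt (hd i)), pd_bump_sub',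
      pd_sub (differentiableAt_const _) (ContDiff.diffAt (ha i j))]
    simp [pd]
    ring
  have hi : ∀ i, Integrable (pd i (fun y => bump ε (y - x) * (a x i j - a y i j))) := fun i =>
    (contDiff_pd (hs.mul (hd i))).continuous.integrable_of_hasCompactSupport
      (HasCompactSupport.pd hc.mul_right)
  simp only [commKernel, e]
  refine ⟨integrable_finsetSum _ fun i _ => hi i, ?_⟩
  rw [integral_finsetSum _ fun i _ => hi i]
  exact Finset.sum_eq_zero fun i _ => integral_pd_eq_zero (hs.mul (hd i)) hc.mul_right

/-- The commutator of mollification with a divergence form operator. -/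
lemma moll_divForm (hε : 0 < ε) (ha : ∀ i j, ContDiff ℝ ∞ fun y => a y i j) {η : Eucl n → ℝ}
    (hη : ContDiff ℝ ∞ η) (hηc : HasCompactSupport η) (y : Eucl n) :
    moll ε (divForm a η) y =
      divForm a (moll ε η) y + ∑ j, ∫ x, commKernel ε a j y x * pd j η x := by
  have hI : ∀ i j, Integrable fun x => pd i (bump ε) (y - x) * a x i j * pd j η x := fun i j =>
    ((((contDiff_pd contDiff_bump).continuous.comp (continuous_const.sub continuous_id)).mul
      (ha i j).continuous).mul (contDiff_pd hη).continuous).integrable_of_hasCompactSupport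
      (HasCompactSupport.pd hηc).mul_left
  have hJ : ∀ i j, Integrable fun x => pd i (bump ε) (y - x) * pd j η x := fun i j =>
    (((contDiff_pd contDiff_bump).continuous.comp (continuous_const.sub continuous_id)).mul
      (contDiff_pd hη).continuous).integrable_of_hasCompactSupport
      (HasCompactSupport.pd hηc).mul_left
  have hK : ∀ j, Integrable fun x => bump ε (y - x) * pd j η x := fun j =>
    ((contDiff_bump.continuous.comp (continuous_const.sub continuous_id)).mul
      (contDiff_pd hη).continuous).integrable_of_hasCompactSupport
      (HasCompactSupport.pd hηc).mul_left
  have h1 : moll ε (divForm a η) y =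
      ∑ i, ∑ j, ∫ x, pd i (bump ε) (y - x) * a x i j * pd j η x := by
    have h2 : ∀ i, Integrable fun x => pd i (fun z => ∑ j, a z i j * pd j η z) x * bump ε (y - x) :=
      fun i => ((contDiff_pd (contDiff_flux ha hη)).continuous.mul
        (contDiff_bump_sub y).continuous).integrable_of_hasCompactSupport
        (hasCompactSupport_bump_sub hε y).mul_left
    simp only [moll_apply, divForm, Finset.sum_mul]
    rw [integral_finsetSum _ fun i _ => h2 i]
    refine Finset.sum_congr rfl fun i _ => ?_
    -- The outer derivative goes to the kernel, so only first derivatives of `η` remain; the same is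
    -- arranged in the expansion of `divForm a (moll ε η)` below.
    rw [← moll_apply, moll_pd hε (contDiff_flux ha hη), ← integral_finsetSum _ fun j _ => hI i j]
    congr 1; ext x
    rw [Finset.sum_mul]
    exact Finset.sum_congr rfl fun j _ => by ring
  have h2 : divForm a (moll ε η) y = ∑ i, ∑ j, (a y i j * ∫ x, pd i (bump ε) (y - x) * pd j η x) +
      ∑ i, ∑ j, (pd i (fun z => a z i j) y * ∫ x, bump ε (y - x) * pd j η x) := by
    rw [← Finset.sum_add_distrib]
    refine Finset.sum_congr rfl fun i _ => ?_
    have hd : ∀ j, ContDiff ℝ ∞ (moll ε (pd j η)) := fun j =>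
      contDiff_moll hε (contDiff_pd hη).continuous.locallyIntegrable
    simp only [pd_moll_eq_moll_pd hε hη]
    rw [pd_sum fun j _ => ContDiff.diffAt ((ha i j).mul (hd j)), ← Finset.sum_add_distrib]
    refine Finset.sum_congr rfl fun j _ => ?_
    rw [pd_mul (ContDiff.diffAt (ha i j)) (ContDiff.diffAt (hd j)),
      pd_moll hε (contDiff_pd hη).continuous.locallyIntegrable, moll_apply]
    simp only [mul_comm (pd j η _)]
  have h3 : ∀ j, ∫ x, commKernel ε a j y x * pd j η x =
      ∑ i, ((∫ x, pd i (bump ε) (y - x) * a x i j * pd j η x) -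
        a y i j * (∫ x, pd i (bump ε) (y - x) * pd j η x) -
        pd i (fun z => a z i j) y * ∫ x, bump ε (y - x) * pd j η x) := by
    intro j
    have e : ∀ x, commKernel ε a j y x * pd j η x =
        ∑ i, (pd i (bump ε) (y - x) * a x i j * pd j η x -
          a y i j * (pd i (bump ε) (y - x) * pd j η x) -
          pd i (fun z => a z i j) y * (bump ε (y - x) * pd j η x)) := by
      intro x
      rw [commKernel, Finset.sum_mul]
      exact Finset.sum_congr rfl fun i _ => by ring
    simp only [e]
    have hs : ∀ i, Integrable fun x => pd i (bump ε) (y - x) * a x i j * pd j η x -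
        a y i j * (pd i (bump ε) (y - x) * pd j η x) :=
      fun i => (hI i j).sub ((hJ i j).const_mul _)
    have hs' : ∀ i, Integrable fun x => pd i (bump ε) (y - x) * a x i j * pd j η x -
        a y i j * (pd i (bump ε) (y - x) * pd j η x) -
        pd i (fun z => a z i j) y * (bump ε (y - x) * pd j η x) :=
      fun i => (hs i).sub ((hK j).const_mul _)
    rw [integral_finsetSum _ fun i _ => hs' i]
    refine Finset.sum_congr rfl fun i _ => ?_
    rw [integral_sub (hs i) ((hK j).const_mul _), integral_sub (hI i j) ((hJ i j).const_mul _),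
      integral_const_mul, integral_const_mul]
  rw [h1, h2]
  simp only [h3]
  rw [Finset.sum_comm (f := fun j i => _ - _ - _)]
  simp only [Finset.sum_sub_distrib]
  ring

/-- The function `v` solves `∑ ∂_i (a_ij ∂_j v) = h₀ + ∑ ∂_i h_i` in the sense of distributions. -/
def WeakEq (a : Eucl n → Matrix (Fin n) (Fin n) ℝ) (v h₀ : Eucl n → ℝ) (h : Fin n → Eucl n → ℝ) :
    Prop :=
  ∀ η : Eucl n → ℝ, ContDiff ℝ ∞ η → HasCompactSupport η →
    ∫ x, v x * divForm a η x = (∫ x, h₀ x * η x) - ∑ i, ∫ x, h i x * pd i η x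

/-- The mollified commutator acting on `v`. -/
def commOp (ε : ℝ) (a : Eucl n → Matrix (Fin n) (Fin n) ℝ) (v : Eucl n → ℝ) (j : Fin n)
    (x : Eucl n) : ℝ :=
  ∫ y, commKernel ε a j y x * v y

/-- Since the kernel has mean zero in `y`, the constant `v x` can be subtracted for free. Only
increments of `v` enter, so no derivative of `v` is required. -/
lemma commOp_eq (hε : 0 < ε) (ha : ∀ i j, ContDiff ℝ ∞ fun y => a y i j)
    (hL : ∀ i j x y, |a x i j - a y i j| ≤ L * ‖x - y‖)
    (hL' : ∀ i j x, |pd i (fun y => a y i j) x| ≤ L) {v : Eucl n → ℝ} (hv : Integrable v)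
    (j : Fin n) (x : Eucl n) :
    commOp ε a v j x = ∫ y, commKernel ε a j y x * (v y - v x) := by
  obtain ⟨C, hC⟩ := exists_abs_commKernel_le hε hL hL' j
  obtain ⟨h1, h2⟩ := integral_commKernel hε ha j x
  have h3 : Integrable fun y => commKernel ε a j y x * v y :=
    hv.bdd_mul (c := C) ((continuous_commKernel ha j).comp
      (continuous_id.prodMk continuous_const)).aestronglyMeasurable
      (Eventually.of_forall fun y => hC y x)
  simp only [mul_sub]
  rw [integral_sub h3 (h1.mul_const _), integral_mul_const, h2, commOp]
  ring

/-- Use the mollified test function `moll ε η` in the equation for `v`. By symmetry of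
mollification, everything moves onto `v` and the data, except for the commutator. As its terms are
paired with `pd j η`, it can be absorbed in the flux data with a minus sign. -/
lemma WeakEq.mollify (hε : 0 < ε) (ha : ∀ i j, ContDiff ℝ ∞ fun y => a y i j)
    (hL : ∀ i j x y, |a x i j - a y i j| ≤ L * ‖x - y‖)
    (hL' : ∀ i j x, |pd i (fun y => a y i j) x| ≤ L) {v h₀ : Eucl n → ℝ} {h : Fin n → Eucl n → ℝ}
    (hv : Integrable v) (hh₀ : Integrable h₀) (hh : ∀ i, Integrable (h i))
    (hR : ∀ j, MemLp (commOp ε a v j) 2 volume)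
    (hw : WeakEq a v h₀ h) :
    WeakEq a (moll ε v) (moll ε h₀) (fun i x => moll ε (h i) x - commOp ε a v i x) := by
  intro η hη hηc
  have hη' : ∀ j, Integrable (pd j η) := fun j =>
    (contDiff_pd hη).continuous.integrable_of_hasCompactSupport (HasCompactSupport.pd hηc)
  have hcη : ∀ j, ∃ C, ∀ x, |pd j η x| ≤ C := fun j =>
    exists_abs_le_of_hasCompactSupport (contDiff_pd hη).continuous (HasCompactSupport.pd hηc)
  have hm : ContDiff ℝ ∞ (moll ε η) := contDiff_moll hε hη.continuous.locallyIntegrable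
  have hmc : HasCompactSupport (moll ε η) := hasCompactSupport_moll hε hηc
  have hw' := hw _ hm hmc
  have hsw : ∀ j, ∫ y, v y * ∫ x, commKernel ε a j y x * pd j η x =
      ∫ x, commOp ε a v j x * pd j η x := fun j => by
    obtain ⟨C, hC⟩ := exists_abs_commKernel_le hε hL hL' j
    exact integral_kernel_swap (continuous_commKernel ha j) hC hv (hη' j)
  have hint : ∀ j, Integrable fun y => v y * ∫ x, commKernel ε a j y x * pd j η x := fun j => by
    obtain ⟨C, hC⟩ := exists_abs_commKernel_le hε hL hL' j
    refine hv.mul_bdd (c := C * ∫ x, |pd j η x|) ?_ (Eventually.of_forall fun y => ?_)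
    · exact (StronglyMeasurable.integral_prod_right
        (f := fun y x => commKernel ε a j y x * pd j η x)
        ((continuous_commKernel ha j).mul ((contDiff_pd hη).continuous.comp
          continuous_snd)).stronglyMeasurable).aestronglyMeasurable
    · rw [← integral_const_mul]
      refine norm_integral_le_of_norm_le ((hη' j).abs.const_mul C)
        (Eventually.of_forall fun x => ?_)
      rw [Real.norm_eq_abs, abs_mul]
      exact mul_le_mul_of_nonneg_right (hC y x) (abs_nonneg _)
  have hint0 : Integrable fun y => v y * divForm a (moll ε η) y := by
    obtain ⟨C, hC⟩ := exists_abs_le_of_hasCompactSupport (contDiff_divForm ha hm).continuous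
      (HasCompactSupport.divForm hmc)
    exact hv.mul_bdd (c := C) (contDiff_divForm ha hm).continuous.aestronglyMeasurable
      (Eventually.of_forall hC)
  rw [← integral_mul_moll hε hv ((contDiff_divForm ha
    hη).continuous.integrable_of_hasCompactSupport (HasCompactSupport.divForm hηc))]
  simp only [moll_divForm hε ha hη hηc, mul_add, Finset.mul_sum]
  rw [integral_add hint0 (integrable_finsetSum _ fun j _ => hint j), hw',
    integral_finsetSum _ fun j _ => hint j,
    integral_mul_moll hε hh₀ (hη.continuous.integrable_of_hasCompactSupport hηc)]
  simp only [hsw, pd_moll_eq_moll_pd hε hη]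
  have hs : ∀ i, ∫ x, (moll ε (h i) x - commOp ε a v i x) * pd i η x =
      (∫ x, h i x * moll ε (pd i η) x) - ∫ x, commOp ε a v i x * pd i η x := by
    intro i
    rw [integral_mul_moll hε (hh i) (hη' i), ← integral_sub]
    · simp only [sub_mul]
    · obtain ⟨C, hC⟩ := hcη i
      refine Integrable.mul_bdd (c := C) ?_ (contDiff_pd hη).continuous.aestronglyMeasurable
        (Eventually.of_forall hC)
      exact (hh i).integrable_convolution _ (contDiff_bump.continuous.integrable_of_hasCompactSupport
        (hasCompactSupport_bump hε))
    · exact integrable_mul_of_memLp_two (hR i) ((contDiff_pd hη).continuous.memLp_of_hasCompactSupport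
        (HasCompactSupport.pd hηc))
  simp only [hs, Finset.sum_sub_distrib]
  ring

end Commutator

/-! ### Smooth approximate solutions and the energy estimate -/

section Approximation

variable {n : ℕ} {a : Eucl n → Matrix (Fin n) (Fin n) ℝ} {L : ℝ}

lemma tendsto_integral_sq_sub {α : Type*} [MeasurableSpace α] {μ : Measure α} {f g : ℕ → α → ℝ}
    (hf : ∀ k, MemLp (f k) 2 μ) (hg : ∀ k, MemLp (g k) 2 μ)
    (hf0 : Tendsto (fun k => ∫ x, f k x ^ 2 ∂μ) atTop (𝓝 0))
    (hg0 : Tendsto (fun k => ∫ x, g k x ^ 2 ∂μ) atTop (𝓝 0)) :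
    Tendsto (fun k => ∫ x, (f k x - g k x) ^ 2 ∂μ) atTop (𝓝 0) := by
  refine squeeze_zero (fun k => integral_nonneg fun x => sq_nonneg _) (fun k => ?_)
    (by simpa using (hf0.const_mul 2).add (hg0.const_mul 2))
  rw [← integral_const_mul, ← integral_const_mul, ← integral_add
    ((hf k).integrable_sq.const_mul _) ((hg k).integrable_sq.const_mul _)]
  have hi : Integrable (fun x => (f k x - g k x) ^ 2) μ := ((hf k).sub (hg k)).integrable_sq
  exact integral_mono hi (((hf k).integrable_sq.const_mul _).add
    ((hg k).integrable_sq.const_mul _)) fun x => by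
      have := sq_nonneg (f k x + g k x)
      simp only
      nlinarith

lemma isFiniteMeasure_withDensity_profile {Φ : Eucl n → ℝ} (hΦ : Continuous Φ)
    (hΦc : HasCompactSupport Φ) :
    IsFiniteMeasure (volume.withDensity fun w => ENNReal.ofReal (Φ w)) :=
  isFiniteMeasure_withDensity_ofReal (hΦ.integrable_of_hasCompactSupport hΦc).2

/-- A null sequence of positive scales. -/
def scale (k : ℕ) : ℝ := 1 / ((k : ℝ) + 1)

lemma scale_pos (k : ℕ) : 0 < scale k := by unfold scale; positivity

lemma tendsto_scale : Tendsto scale atTop (𝓝 0) := tendsto_one_div_add_atTop_nhds_zero_nat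

/-- The error is an average of increments with respect to the fixed finite measure of density
`stdBump n`, hence null in `L²`. -/
lemma moll_tendsto {f : Eucl n → ℝ} (hfm : Measurable f) (hf : MemLp f 2 volume)
    (hf1 : Integrable f) : (∀ k, MemLp (moll (scale k) f) 2 volume) ∧
    Tendsto (fun k => ∫ x, (moll (scale k) f x - f x) ^ 2) atTop (𝓝 0) := by
  have := isFiniteMeasure_withDensity_profile (contDiff_stdBump (n := n)).continuous
    hasCompactSupport_stdBump
  have hc : ∀ k, Continuous (moll (scale k) f) := fun k =>
    (contDiff_moll (scale_pos k) hf1.locallyIntegrable).continuous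
  obtain ⟨h1, h2⟩ := tendsto_integral_sq_of_average_bound hf hfm
    (volume.withDensity fun w => ENNReal.ofReal (stdBump n w)) tendsto_scale
    (R := fun k x => moll (scale k) f x - f x)
    (fun k => ((hc k).measurable.sub hfm).aestronglyMeasurable) (fun k x => by
      rw [moll_sub_self (scale_pos k) hf1]
      refine enorm_integral_kernel_le (scale_pos k) contDiff_stdBump.continuous
        (k := fun y x => bump (scale k) (x - y)) (fun x w => le_of_eq ?_) f hfm x
      rw [sub_add_cancel_left, bump_neg, bump_smul (scale_pos k), abs_of_nonneg (stdBump_nonneg w)])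
  refine ⟨fun k => ?_, h2⟩
  have := (h1 k).add hf
  refine this.ae_eq (Eventually.of_forall fun x => ?_)
  simp

/-- The Friedrichs lemma: the commutator is dominated by averages of increments of `v` against the
fixed density `commProfile n L`. These vanish in `L²` for every `v` in `L²`. -/
lemma commOp_tendsto (ha : ∀ i j, ContDiff ℝ ∞ fun y => a y i j)
    (hL : ∀ i j x y, |a x i j - a y i j| ≤ L * ‖x - y‖)
    (hL' : ∀ i j x, |pd i (fun y => a y i j) x| ≤ L) {v : Eucl n → ℝ} (hvm : Measurable v)
    (hv : MemLp v 2 volume) (hv1 : Integrable v) (j : Fin n) :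
    (∀ k, MemLp (commOp (scale k) a v j) 2 volume) ∧
    Tendsto (fun k => ∫ x, commOp (scale k) a v j x ^ 2) atTop (𝓝 0) := by
  have := isFiniteMeasure_withDensity_profile (continuous_commProfile (n := n) (L := L))
    hasCompactSupport_commProfile
  refine tendsto_integral_sq_of_average_bound hv hvm
    (volume.withDensity fun w => ENNReal.ofReal (commProfile n L w)) tendsto_scale
    (fun k => ?_) (fun k x => ?_)
  · exact (StronglyMeasurable.integral_prod_left
      (f := fun y x => commKernel (scale k) a j y x * v y)
      ((continuous_commKernel ha j).measurable.mul
        (hvm.comp measurable_fst)).stronglyMeasurable).aestronglyMeasurable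
  · rw [commOp_eq (scale_pos k) ha hL hL' hv1]
    exact enorm_integral_kernel_le (scale_pos k) continuous_commProfile
      (fun x w => abs_commKernel_le (scale_pos k) hL hL' j x w) v hvm x

/-- A weak solution can be approximated in `L²` by smooth compactly supported solutions of equations
with converging data. -/
theorem WeakEq.exists_approx (ha : ∀ i j, ContDiff ℝ ∞ fun y => a y i j)
    (hL : ∀ i j x y, |a x i j - a y i j| ≤ L * ‖x - y‖)
    (hL' : ∀ i j x, |pd i (fun y => a y i j) x| ≤ L) {v h₀ : Eucl n → ℝ} {h : Fin n → Eucl n → ℝ}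
    (hvm : Measurable v) (hv : MemLp v 2 volume) (hvc : HasCompactSupport v)
    (hhm₀ : Measurable h₀) (hh₀ : MemLp h₀ 2 volume) (hhc₀ : HasCompactSupport h₀)
    (hhm : ∀ i, Measurable (h i)) (hh : ∀ i, MemLp (h i) 2 volume)
    (hhc : ∀ i, HasCompactSupport (h i)) (hw : WeakEq a v h₀ h) :
    ∃ (V H₀ : ℕ → Eucl n → ℝ) (H : ℕ → Fin n → Eucl n → ℝ),
      (∀ k, ContDiff ℝ ∞ (V k)) ∧ (∀ k, HasCompactSupport (V k)) ∧
      (∀ k, MemLp (H₀ k) 2 volume) ∧ (∀ k i, MemLp (H k i) 2 volume) ∧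
      (∀ k, WeakEq a (V k) (H₀ k) (H k)) ∧
      Tendsto (fun k => ∫ x, (V k x - v x) ^ 2) atTop (𝓝 0) ∧
      Tendsto (fun k => ∫ x, (H₀ k x - h₀ x) ^ 2) atTop (𝓝 0) ∧
      ∀ i, Tendsto (fun k => ∫ x, (H k i x - h i x) ^ 2) atTop (𝓝 0) := by
  have hint : ∀ {f : Eucl n → ℝ}, MemLp f 2 volume → HasCompactSupport f → Integrable f := by
    intro f hf hfc
    rw [← integrableOn_iff_integrable_of_support_subset (subset_tsupport f)]
    have := hfc.isCompact.measure_lt_top (μ := (volume : Measure (Eucl n)))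
    have : IsFiniteMeasure (volume.restrict (tsupport f)) := ⟨by simpa using this⟩
    exact (hf.restrict _).integrable (by norm_num)
  have hv1 := hint hv hvc
  have hR := commOp_tendsto ha hL hL' hvm hv hv1
  have hM := fun i => moll_tendsto (hhm i) (hh i) (hint (hh i) (hhc i))
  refine ⟨fun k => moll (scale k) v, fun k => moll (scale k) h₀,
    fun k i x => moll (scale k) (h i) x - commOp (scale k) a v i x,
    fun k => contDiff_moll (scale_pos k) hv1.locallyIntegrable,
    fun k => hasCompactSupport_moll (scale_pos k) hvc,
    (moll_tendsto hhm₀ hh₀ (hint hh₀ hhc₀)).1, fun k i => ((hM i).1 k).sub ((hR i).1 k),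
    fun k => hw.mollify (scale_pos k) ha hL hL' hv1 (hint hh₀ hhc₀) (fun i => hint (hh i) (hhc i))
      fun j => (hR j).1 k,
    (moll_tendsto hvm hv hv1).2, (moll_tendsto hhm₀ hh₀ (hint hh₀ hhc₀)).2, fun i => ?_⟩
  have := tendsto_integral_sq_sub (fun k => ((hM i).1 k).sub (hh i)) (hR i).1 (hM i).2 (hR i).2
  refine this.congr fun k => ?_
  congr 1; ext x
  simp only [Pi.sub_apply]
  ring

/-- The energy estimate. -/
lemma WeakEq.energy (ha : ∀ i j, ContDiff ℝ ∞ fun y => a y i j) {c : ℝ} (hc : 0 < c)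
    (hell : ∀ x (ξ : Fin n → ℝ), c * ∑ i, ξ i ^ 2 ≤ ∑ i, ξ i * ∑ j, a x i j * ξ j)
    {V H₀ : Eucl n → ℝ} {H : Fin n → Eucl n → ℝ} (hV : ContDiff ℝ ∞ V) (hVc : HasCompactSupport V)
    (hH₀ : MemLp H₀ 2 volume) (hH : ∀ i, MemLp (H i) 2 volume) (hw : WeakEq a V H₀ H) :
    c / 2 * ∑ i, ∫ x, pd i V x ^ 2 ≤
      (∫ x, H₀ x ^ 2) + (∫ x, V x ^ 2) + ∑ i, (2 * c)⁻¹ * ∫ x, H i x ^ 2 := by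
  have hVL := hV.continuous.memLp_of_hasCompactSupport (p := 2) (μ := volume) hVc
  have hpL : ∀ i, MemLp (pd i V) 2 volume := fun i =>
    (contDiff_pd hV).continuous.memLp_of_hasCompactSupport (HasCompactSupport.pd hVc)
  -- The solution is smooth with compact support, so it is an admissible test function; the left
  -- side becomes minus the Dirichlet integral.
  have h1 := hw V hV hVc
  rw [integral_mul_divForm (U := univ) (fun i j => (ha i j).contDiffOn) isOpen_univ hV hVc
    (subset_univ _) hV.contDiffOn] at h1
  have hflux : Integrable fun y => ∑ i, pd i V y * ∑ j, a y i j * pd j V y := by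
    refine integrable_finsetSum _ fun i _ => ?_
    exact ((contDiff_pd hV).mul (contDiff_flux ha hV)).continuous.integrable_of_hasCompactSupport
      (HasCompactSupport.pd hVc).mul_right
  have h2 : c * ∑ i, ∫ x, pd i V x ^ 2 ≤ ∫ y, ∑ i, pd i V y * ∑ j, a y i j * pd j V y := by
    rw [← integral_finsetSum _ fun i _ => (hpL i).integrable_sq, ← integral_const_mul]
    exact integral_mono ((integrable_finsetSum _ fun i _ => (hpL i).integrable_sq).const_mul _)
      hflux fun x => hell x fun i => pd i V x
  have h3 : - ∫ x, H₀ x * V x ≤ (∫ x, H₀ x ^ 2) + ∫ x, V x ^ 2 := by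
    rw [← integral_neg, ← integral_add hH₀.integrable_sq hVL.integrable_sq]
    refine integral_mono (integrable_mul_of_memLp_two hH₀ hVL).neg
      (hH₀.integrable_sq.add hVL.integrable_sq) fun x => ?_
    simp only
    nlinarith [sq_nonneg (H₀ x + V x), sq_nonneg (H₀ x), sq_nonneg (V x)]
  -- Young's inequality, weighted so that exactly half of the coercive term `c ∫ |∇V|²` absorbs the
  -- gradient.
  have h4 : ∀ i, ∫ x, H i x * pd i V x ≤
      (2 * c)⁻¹ * (∫ x, H i x ^ 2) + c / 2 * ∫ x, pd i V x ^ 2 := by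
    intro i
    rw [← integral_const_mul, ← integral_const_mul, ← integral_add
      ((hH i).integrable_sq.const_mul _) ((hpL i).integrable_sq.const_mul _)]
    refine integral_mono (integrable_mul_of_memLp_two (hH i) (hpL i))
      (((hH i).integrable_sq.const_mul _).add ((hpL i).integrable_sq.const_mul _)) fun x => ?_
    have e : (2 * c)⁻¹ * H i x ^ 2 + c / 2 * pd i V x ^ 2 - H i x * pd i V x =
        (2 * c)⁻¹ * (H i x - c * pd i V x) ^ 2 := by
      field_simp; ring
    have : 0 ≤ (2 * c)⁻¹ * (H i x - c * pd i V x) ^ 2 := by positivity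
    simp only
    linarith
  have h5 := Finset.sum_le_sum fun i (_ : i ∈ Finset.univ) => h4 i
  rw [Finset.sum_add_distrib, ← Finset.mul_sum (Finset.univ) _ (c / 2)] at h5
  linarith

end Approximation

/-! ### The regularized modulus and the pointwise inequality -/

section RegularizedNorm

/-- The regularized absolute value `√(p² + q² + δ²)` of `p + iq`. -/
def regAbs (δ p q : ℝ) : ℝ := √(p ^ 2 + q ^ 2 + δ ^ 2)

variable {δ : ℝ}

lemma regAbs_sq (p q : ℝ) : regAbs δ p q ^ 2 = p ^ 2 + q ^ 2 + δ ^ 2 :=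
  Real.sq_sqrt (by positivity)

lemma le_regAbs (p q : ℝ) : δ ≤ regAbs δ p q :=
  Real.le_sqrt_of_sq_le (by nlinarith [sq_nonneg p, sq_nonneg q])

lemma regAbs_pos (hδ : 0 < δ) (p q : ℝ) : 0 < regAbs δ p q := hδ.trans_le (le_regAbs p q)

lemma abs_le_regAbs_left (p q : ℝ) : |p| ≤ regAbs δ p q :=
  Real.abs_le_sqrt (by nlinarith [sq_nonneg δ, sq_nonneg q])

lemma regAbs_comm (p q : ℝ) : regAbs δ p q = regAbs δ q p := by
  simp only [regAbs, add_comm (p ^ 2)]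

/-- The reverse triangle inequality for the vectors `(P, Q, δ)` and `(p, q, δ)` of `ℝ³`, whose third
coordinates cancel. -/
lemma sq_regAbs_sub_le (hδ : 0 < δ) (p q P Q : ℝ) :
    (regAbs δ P Q - regAbs δ p q) ^ 2 ≤ (P - p) ^ 2 + (Q - q) ^ 2 := by
  have h1 := regAbs_sq (δ := δ) p q
  have h2 := regAbs_sq (δ := δ) P Q
  have h3 : P * p + Q * q + δ ^ 2 ≤ regAbs δ P Q * regAbs δ p q := by
    refine le_of_sq_le_sq ?_ (mul_pos (regAbs_pos hδ _ _) (regAbs_pos hδ _ _)).le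
    rw [mul_pow, h1, h2]
    nlinarith [sq_nonneg (P * q - Q * p), sq_nonneg (δ * (P - p)), sq_nonneg (δ * (Q - q))]
  nlinarith

/-- For fixed `δ` the regularized sign is Lipschitz, because the denominator is at least `δ`. This
transfers `L²` convergence to the test functions `φP/s`. -/
lemma sq_div_regAbs_sub_le (hδ : 0 < δ) (p q P Q : ℝ) :
    (P / regAbs δ P Q - p / regAbs δ p q) ^ 2 ≤
      4 / δ ^ 2 * ((P - p) ^ 2 + (Q - q) ^ 2) := by
  set S := regAbs δ P Q with hS
  set s := regAbs δ p q with hs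
  have hS0 : 0 < S := regAbs_pos hδ _ _
  have hs0 : 0 < s := regAbs_pos hδ _ _
  have h1 : (S - s) ^ 2 ≤ (P - p) ^ 2 + (Q - q) ^ 2 := sq_regAbs_sub_le hδ _ _ _ _
  have hps : (p / s) ^ 2 ≤ 1 := by
    rw [sq_le_one_iff_abs_le_one, abs_div, abs_of_pos hs0, div_le_one hs0]
    exact abs_le_regAbs_left p q
  have e : P / S - p / s = ((P - p) - p / s * (S - s)) / S := by
    field_simp; ring
  rw [e, div_pow, div_mul_eq_mul_div (4 : ℝ)]
  refine div_le_div₀ (by positivity) ?_ (by positivity)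
    (pow_le_pow_left₀ hδ.le (le_regAbs _ _) 2)
  have h2 : ((P - p) - p / s * (S - s)) ^ 2 ≤ 2 * (P - p) ^ 2 + 2 * ((p / s) ^ 2 * (S - s) ^ 2) := by
    nlinarith [sq_nonneg ((P - p) + p / s * (S - s))]
  have h3 : (p / s) ^ 2 * (S - s) ^ 2 ≤ 1 * (S - s) ^ 2 :=
    mul_le_mul_of_nonneg_right hps (sq_nonneg _)
  nlinarith [sq_nonneg (Q - q)]

/-- The algebraic core of Kato's inequality. -/
lemma kato_pointwise {n : ℕ} (B : Matrix (Fin n) (Fin n) ℝ)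
    (hB : ∀ ξ : Fin n → ℝ, 0 ≤ ∑ i, ξ i * ∑ j, B i j * ξ j) {u w : ℝ} (huw : u ^ 2 + w ^ 2 ≤ 1)
    (ξ ζ : Fin n → ℝ) :
    ∑ i, (u * ξ i + w * ζ i) * ∑ j, B i j * (u * ξ j + w * ζ j) ≤
      (∑ i, ξ i * ∑ j, B i j * ξ j) + ∑ i, ζ i * ∑ j, B i j * ζ j := by
  have h1 := hB fun i => w * ξ i - u * ζ i
  have h2 := hB ξ
  have h3 := hB ζ
  -- Lagrange's identity for the quadratic form of `B`: the mixed terms of the two left-hand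
  -- summands cancel, so symmetry of `B` plays no role.
  have e : (∑ i, (u * ξ i + w * ζ i) * ∑ j, B i j * (u * ξ j + w * ζ j)) +
      ∑ i, (w * ξ i - u * ζ i) * ∑ j, B i j * (w * ξ j - u * ζ j) =
      (u ^ 2 + w ^ 2) * ((∑ i, ξ i * ∑ j, B i j * ξ j) + ∑ i, ζ i * ∑ j, B i j * ζ j) := by
    simp only [Finset.mul_sum, ← Finset.sum_add_distrib]
    refine Finset.sum_congr rfl fun i _ => Finset.sum_congr rfl fun j _ => ?_
    ring
  nlinarith

end RegularizedNorm

/-! ### Kato's inequality for smooth functions -/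

section SmoothKato

variable {n : ℕ} {a : Eucl n → Matrix (Fin n) (Fin n) ℝ} {δ : ℝ} {P Q φ : Eucl n → ℝ}

lemma contDiff_regAbs (hδ : 0 < δ) (hP : ContDiff ℝ ∞ P) (hQ : ContDiff ℝ ∞ Q) :
    ContDiff ℝ ∞ fun x => regAbs δ (P x) (Q x) :=
  (((hP.pow 2).add (hQ.pow 2)).add contDiff_const).sqrt fun _ => by positivity

/-- Differentiate `s² = P² + Q² + δ²` instead of the root and divide by `2s`. -/
lemma pd_regAbs (hδ : 0 < δ) (hP : ContDiff ℝ ∞ P) (hQ : ContDiff ℝ ∞ Q) (i : Fin n)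
    (x : Eucl n) : pd i (fun x => regAbs δ (P x) (Q x)) x =
      P x / regAbs δ (P x) (Q x) * pd i P x + Q x / regAbs δ (P x) (Q x) * pd i Q x := by
  have hs := contDiff_regAbs hδ hP hQ
  have h1 : pd i (fun x => regAbs δ (P x) (Q x) * regAbs δ (P x) (Q x)) x =
      pd i (fun x => P x * P x + Q x * Q x + δ ^ 2) x := by
    congr 1; ext y; rw [← sq, regAbs_sq]; ring
  rw [pd_mul (ContDiff.diffAt hs) (ContDiff.diffAt hs),
    pd_add (ContDiff.diffAt ((hP.mul hP).add (hQ.mul hQ))) (differentiableAt_const _),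
    pd_add (ContDiff.diffAt (hP.mul hP)) (ContDiff.diffAt (hQ.mul hQ)),
    pd_mul (ContDiff.diffAt hP) (ContDiff.diffAt hP),
    pd_mul (ContDiff.diffAt hQ) (ContDiff.diffAt hQ)] at h1
  have h2 : pd i (fun _ : Eucl n => δ ^ 2) x = 0 := by simp [pd]
  have h0 := (regAbs_pos hδ (P x) (Q x)).ne'
  field_simp
  linarith

lemma contDiff_kato_test (hδ : 0 < δ) (hP : ContDiff ℝ ∞ P) (hQ : ContDiff ℝ ∞ Q)
    (hφ : ContDiff ℝ ∞ φ) : ContDiff ℝ ∞ fun x => φ x * (P x / regAbs δ (P x) (Q x)) :=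
  hφ.mul (hP.div (contDiff_regAbs hδ hP hQ) fun _ => (regAbs_pos hδ _ _).ne')

/-- The derivative of the quotient is read off from `P = s · (P/s)`. The derivative of `s` is left
unexpanded, so that `a(∇s,∇s)` can be recognized later. -/
lemma pd_kato_test (hδ : 0 < δ) (hP : ContDiff ℝ ∞ P) (hQ : ContDiff ℝ ∞ Q)
    (hφ : ContDiff ℝ ∞ φ) (i : Fin n) (x : Eucl n) :
    pd i (fun x => φ x * (P x / regAbs δ (P x) (Q x))) x =
      pd i φ x * (P x / regAbs δ (P x) (Q x)) + φ x / regAbs δ (P x) (Q x) *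
        (pd i P x - P x / regAbs δ (P x) (Q x) * pd i (fun x => regAbs δ (P x) (Q x)) x) := by
  have hs := contDiff_regAbs hδ hP hQ
  have hne : ∀ x, regAbs δ (P x) (Q x) ≠ 0 := fun x => (regAbs_pos hδ _ _).ne'
  have hd : ContDiff ℝ ∞ fun x => P x / regAbs δ (P x) (Q x) := hP.div hs hne
  have h1 : pd i P x = pd i (fun x => regAbs δ (P x) (Q x) * (P x / regAbs δ (P x) (Q x))) x := by
    congr 1; ext y; field_simp [hne y]
  rw [pd_mul (ContDiff.diffAt hs) (ContDiff.diffAt hd)] at h1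
  rw [pd_mul (ContDiff.diffAt hφ) (ContDiff.diffAt hd), h1]
  field_simp [hne x]
  ring

/-- Integration by parts with the compact support on the second factor. -/
lemma integral_mul_divForm_of_hasCompactSupport (ha : ∀ i j, ContDiff ℝ ∞ fun y => a y i j)
    {f g : Eucl n → ℝ} (hf : ContDiff ℝ ∞ f) (hg : ContDiff ℝ ∞ g) (hgc : HasCompactSupport g) :
    Integrable (fun y => ∑ i, pd i f y * ∑ j, a y i j * pd j g y) ∧
    ∫ y, f y * divForm a g y = - ∫ y, ∑ i, pd i f y * ∑ j, a y i j * pd j g y := by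
  have hX : ∀ i, ContDiff ℝ ∞ fun y => ∑ j, a y i j * pd j g y := fun i => contDiff_flux ha hg
  have hXc : ∀ i, HasCompactSupport fun y => ∑ j, a y i j * pd j g y := fun i => by
    refine hgc.of_isClosed_subset (isClosed_tsupport _)
      (closure_minimal (fun x hx => ?_) (isClosed_tsupport g))
    by_contra h
    apply hx
    simp [pd_eq_zero_of_notMem_tsupport h]
  have h1 : ∀ i, Integrable fun y => f y * pd i (fun y => ∑ j, a y i j * pd j g y) y := fun i =>
    (hf.mul (contDiff_pd (hX i))).continuous.integrable_of_hasCompactSupport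
      (HasCompactSupport.pd (hXc i)).mul_left
  have h2 : ∀ i, Integrable fun y => pd i f y * ∑ j, a y i j * pd j g y := fun i =>
    ((contDiff_pd hf).mul (hX i)).continuous.integrable_of_hasCompactSupport (hXc i).mul_left
  refine ⟨integrable_finsetSum _ fun i _ => h2 i, ?_⟩
  simp only [divForm, Finset.mul_sum (Finset.univ) _ (f _)]
  rw [integral_finsetSum _ fun i _ => h1 i, integral_finsetSum _ fun i _ => h2 i,
    ← Finset.sum_neg_distrib]
  refine Finset.sum_congr rfl fun i _ => ?_
  have h := integral_mul_pd (i := i) isOpen_univ (hX i) (hXc i) (subset_univ _) hf.contDiffOn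
  simp only [mul_comm (pd i f _), h, neg_neg]
  simp only [mul_comm]

/-- Kato's inequality for smooth functions, in weak form. -/
lemma kato_smooth (ha : ∀ i j, ContDiff ℝ ∞ fun y => a y i j)
    (hpos : ∀ x (ξ : Fin n → ℝ), 0 ≤ ∑ i, ξ i * ∑ j, a x i j * ξ j) (hδ : 0 < δ)
    (hP : ContDiff ℝ ∞ P) (hQ : ContDiff ℝ ∞ Q) (hφ : ContDiff ℝ ∞ φ) (hφc : HasCompactSupport φ)
    (hφ0 : ∀ x, 0 ≤ φ x) :
    (∫ x, P x * divForm a (fun x => φ x * (P x / regAbs δ (P x) (Q x))) x) +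
      ∫ x, Q x * divForm a (fun x => φ x * (Q x / regAbs δ (P x) (Q x))) x ≤
    ∫ x, regAbs δ (P x) (Q x) * divForm a φ x := by
  have hs := contDiff_regAbs hδ hP hQ
  have hηP := contDiff_kato_test hδ hP hQ hφ
  have hηQ := contDiff_kato_test hδ hQ hP hφ
  simp only [regAbs_comm (Q _) (P _)] at hηQ
  obtain ⟨i1, e1⟩ := integral_mul_divForm_of_hasCompactSupport ha hP hηP hφc.mul_right
  obtain ⟨i2, e2⟩ := integral_mul_divForm_of_hasCompactSupport ha hQ hηQ hφc.mul_right
  obtain ⟨i3, e3⟩ := integral_mul_divForm_of_hasCompactSupport ha hs hφ hφc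
  -- Integration by parts reverses the sign, so the claim becomes a pointwise lower bound for the
  -- sum of the two Dirichlet integrands.
  rw [e1, e2, e3, ← neg_add, neg_le_neg_iff, ← integral_add i1 i2]
  refine integral_mono i3 (i1.add i2) fun x => ?_
  have hs0 := regAbs_pos hδ (P x) (Q x)
  have hpq := pd_kato_test hδ hQ hP hφ
  simp only [regAbs_comm (Q _) (P _)] at hpq
  simp only [pd_kato_test hδ hP hQ hφ, hpq]
  have hps := fun i => pd_regAbs hδ hP hQ i x
  have hsq := regAbs_sq (δ := δ) (P x) (Q x)
  set s := regAbs δ (P x) (Q x) with hsdef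
  have hk := kato_pointwise (a x) (hpos x) (u := P x / s) (w := Q x / s) (by
    rw [div_pow, div_pow, ← add_div, div_le_one (by positivity), hsq]
    nlinarith [sq_nonneg δ]) (fun i => pd i P x) (fun i => pd i Q x)
  simp only [← hps] at hk
  -- The combination `(P∇P + Q∇Q)/s` multiplying `∇φ` is `∇s`, and likewise in the subtracted
  -- quadratic term. What remains beyond `a(∇s,∇φ)` is `φ/s` times the nonnegative defect of
  -- `kato_pointwise`.
  have e : ((∑ i, pd i P x * ∑ j, a x i j * (pd j φ x * (P x / s) + φ x / s *
        (pd j P x - P x / s * pd j (fun x => regAbs δ (P x) (Q x)) x))) +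
      ∑ i, pd i Q x * ∑ j, a x i j * (pd j φ x * (Q x / s) + φ x / s *
        (pd j Q x - Q x / s * pd j (fun x => regAbs δ (P x) (Q x)) x))) =
      (∑ i, pd i (fun x => regAbs δ (P x) (Q x)) x * ∑ j, a x i j * pd j φ x) +
      φ x / s * (((∑ i, pd i P x * ∑ j, a x i j * pd j P x) +
        ∑ i, pd i Q x * ∑ j, a x i j * pd j Q x) -
        ∑ i, pd i (fun x => regAbs δ (P x) (Q x)) x *
          ∑ j, a x i j * pd j (fun x => regAbs δ (P x) (Q x)) x) := by
    simp only [Finset.mul_sum, mul_sub, mul_add, ← Finset.sum_add_distrib, ← Finset.sum_sub_distrib]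
    refine Finset.sum_congr rfl fun i _ => Finset.sum_congr rfl fun j _ => ?_
    rw [hps i]
    ring
  rw [e]
  have : 0 ≤ φ x / s := div_nonneg (hφ0 x) hs0.le
  nlinarith

end SmoothKato

/-! ### Passage to the limit, first in the mollification and then in `δ` -/

section EuclideanKato

variable {n : ℕ} {a : Eucl n → Matrix (Fin n) (Fin n) ℝ} {L c δ : ℝ}

/-- Smooth globally Lipschitz uniformly elliptic coefficients. -/
structure IsEllipticCoeff (a : Eucl n → Matrix (Fin n) (Fin n) ℝ) (L c : ℝ) : Prop where
  smooth : ∀ i j, ContDiff ℝ ∞ fun y => a y i j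
  lipschitz : ∀ i j x y, |a x i j - a y i j| ≤ L * ‖x - y‖
  pd_le : ∀ i j k x, |pd k (fun y => a y i j) x| ≤ L
  pos : 0 < c
  elliptic : ∀ x (ξ : Fin n → ℝ), c * ∑ i, ξ i ^ 2 ≤ ∑ i, ξ i * ∑ j, a x i j * ξ j

/-- Measurable square-integrable functions with compact support. -/
structure IsL2c (f : Eucl n → ℝ) : Prop where
  measurable : Measurable f
  memLp : MemLp f 2 volume
  compact : HasCompactSupport f

/-- Weak solutions have `L²`-approximations by smooth functions with bounded energy, solving
equations with converging data. -/
lemma WeakEq.exists_approx_bounded (ha : IsEllipticCoeff a L c) {v h₀ : Eucl n → ℝ}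
    {h : Fin n → Eucl n → ℝ} (hv : IsL2c v) (hh₀ : IsL2c h₀) (hh : ∀ i, IsL2c (h i))
    (hw : WeakEq a v h₀ h) :
    ∃ (V H₀ : ℕ → Eucl n → ℝ) (H : ℕ → Fin n → Eucl n → ℝ),
      (∀ k, ContDiff ℝ ∞ (V k)) ∧ (∀ k, HasCompactSupport (V k)) ∧
      (∀ k, MemLp (H₀ k) 2 volume) ∧ (∀ k i, MemLp (H k i) 2 volume) ∧
      (∀ k, WeakEq a (V k) (H₀ k) (H k)) ∧
      Tendsto (fun k => ∫ x, (V k x - v x) ^ 2) atTop (𝓝 0) ∧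
      Tendsto (fun k => ∫ x, (H₀ k x - h₀ x) ^ 2) atTop (𝓝 0) ∧
      (∀ i, Tendsto (fun k => ∫ x, (H k i x - h i x) ^ 2) atTop (𝓝 0)) ∧
      ∃ C, ∀ k i, ∫ x, pd i (V k) x ^ 2 ≤ C := by
  obtain ⟨V, H₀, H, hV, hVc, hH₀, hH, hwk, hVt, hH₀t, hHt⟩ := hw.exists_approx ha.smooth
    ha.lipschitz (fun i j x => ha.pd_le i j i x) hv.measurable hv.memLp hv.compact hh₀.measurable
    hh₀.memLp hh₀.compact (fun i => (hh i).measurable) (fun i => (hh i).memLp)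
    (fun i => (hh i).compact)
  refine ⟨V, H₀, H, hV, hVc, hH₀, hH, hwk, hVt, hH₀t, hHt, ?_⟩
  obtain ⟨C₁, hC₁⟩ := exists_integral_sq_le hH₀ hh₀.memLp hH₀t
  obtain ⟨C₂, hC₂⟩ := exists_integral_sq_le
    (fun k => (hV k).continuous.memLp_of_hasCompactSupport (hVc k)) hv.memLp hVt
  have h3 := fun i => exists_integral_sq_le (fun k => hH k i) (hh i).memLp (hHt i)
  choose C₃ hC₃ using h3
  have hc := ha.pos
  refine ⟨(c / 2)⁻¹ * (C₁ + C₂ + ∑ i, (2 * c)⁻¹ * C₃ i), fun k i => ?_⟩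
  rw [le_inv_mul_iff₀ (by positivity)]
  have h1 := (hwk k).energy ha.smooth ha.pos ha.elliptic (hV k) (hVc k) (hH₀ k) (hH k)
  have h2 : ∫ x, pd i (V k) x ^ 2 ≤ ∑ i, ∫ x, pd i (V k) x ^ 2 :=
    Finset.single_le_sum (f := fun i => ∫ x, pd i (V k) x ^ 2)
      (fun i _ => integral_nonneg fun x => sq_nonneg _) (Finset.mem_univ i)
  have h4 : ∑ i, (2 * c)⁻¹ * ∫ x, H k i x ^ 2 ≤ ∑ i, (2 * c)⁻¹ * C₃ i :=
    Finset.sum_le_sum fun i _ => mul_le_mul_of_nonneg_left (hC₃ i k) (by positivity)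
  have h5 := mul_le_mul_of_nonneg_left h2 (show 0 ≤ c / 2 by positivity)
  linarith [hC₁ k, hC₂ k]

/-- Passing to the limit in the weak equation along test functions bounded in energy. -/
lemma tendsto_integral_divForm_test {V H₀ : ℕ → Eucl n → ℝ} {H : ℕ → Fin n → Eucl n → ℝ}
    {h₀ : Eucl n → ℝ} {h : Fin n → Eucl n → ℝ} (hH₀ : ∀ k, MemLp (H₀ k) 2 volume)
    (hH : ∀ k i, MemLp (H k i) 2 volume) (hw : ∀ k, WeakEq a (V k) (H₀ k) (H k))
    (hh₀ : MemLp h₀ 2 volume) (hh : ∀ i, MemLp (h i) 2 volume)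
    (hH₀t : Tendsto (fun k => ∫ x, (H₀ k x - h₀ x) ^ 2) atTop (𝓝 0))
    (hHt : ∀ i, Tendsto (fun k => ∫ x, (H k i x - h i x) ^ 2) atTop (𝓝 0))
    {η : ℕ → Eucl n → ℝ} {η₀ : Eucl n → ℝ} (hη : ∀ k, ContDiff ℝ ∞ (η k))
    (hηc : ∀ k, HasCompactSupport (η k)) (hη₀ : MemLp η₀ 2 volume)
    (hηt : Tendsto (fun k => ∫ x, (η k x - η₀ x) ^ 2) atTop (𝓝 0))
    {C : ℝ} (hC : ∀ k i, ∫ x, pd i (η k) x ^ 2 ≤ C)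
    (hhη : ∀ k i x, x ∈ tsupport (η k) → h i x = 0) :
    Tendsto (fun k => ∫ x, V k x * divForm a (η k) x) atTop (𝓝 (∫ x, h₀ x * η₀ x)) := by
  have hηL : ∀ k, MemLp (η k) 2 volume :=
    fun k => (hη k).continuous.memLp_of_hasCompactSupport (hηc k)
  have hpL : ∀ k i, MemLp (pd i (η k)) 2 volume := fun k i =>
    (contDiff_pd (hη k)).continuous.memLp_of_hasCompactSupport (HasCompactSupport.pd (hηc k))
  obtain ⟨C', hC'⟩ := exists_integral_sq_le hηL hη₀ hηt
  -- The errors come from `H₀`, from `η` and from the fluxes. Each is a null sequence paired with a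
  -- bounded one; for the fluxes the bounded one is the gradient of `η k`.
  have t1 := tendsto_integral_mul_zero (fun k => (hH₀ k).sub hh₀) hηL hH₀t hC'
  have t2 := tendsto_integral_mul_zero (fun k => (hηL k).sub hη₀) (fun _ => hh₀) hηt
    (fun _ => le_rfl)
  have t3 := fun i => tendsto_integral_mul_zero (fun k => (hH k i).sub (hh i))
    (fun k => hpL k i) (hHt i) (fun k => hC k i)
  have t4 := ((t1.add t2).add (tendsto_const_nhds (x := ∫ x, h₀ x * η₀ x))).sub
    (tendsto_finsetSum Finset.univ fun i _ => t3 i)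
  simp only [add_zero, zero_add, Finset.sum_const_zero, sub_zero] at t4
  refine t4.congr fun k => ?_
  rw [hw k (η k) (hη k) (hηc k)]
  -- The limit flux `h i` vanishes on the support of `η k`, so subtracting it changes nothing and a
  -- null sequence appears.
  have e1 : ∀ i, ∫ x, (H k i - h i) x * pd i (η k) x = ∫ x, H k i x * pd i (η k) x := by
    intro i
    congr 1; ext x
    by_cases hx : x ∈ tsupport (η k)
    · simp [hhη k i x hx]
    · simp [pd_eq_zero_of_notMem_tsupport hx]
  have e2 : ∫ x, (H₀ k - h₀) x * η k x = (∫ x, H₀ k x * η k x) - ∫ x, h₀ x * η k x := by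
    rw [← integral_sub (integrable_mul_of_memLp_two (hH₀ k) (hηL k))
      (integrable_mul_of_memLp_two hh₀ (hηL k))]
    simp [sub_mul]
  have e3 : ∫ x, (η k - η₀) x * h₀ x = (∫ x, h₀ x * η k x) - ∫ x, h₀ x * η₀ x := by
    rw [← integral_sub (integrable_mul_of_memLp_two hh₀ (hηL k))
      (integrable_mul_of_memLp_two hh₀ hη₀)]
    simp only [Pi.sub_apply, sub_mul, mul_comm (h₀ _)]
  simp only [e1, e2, e3]
  ring

lemma sq_div_regAbs_le_one (p q : ℝ) (hδ : 0 < δ) : (p / regAbs δ p q) ^ 2 ≤ 1 := by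
  rw [sq_le_one_iff_abs_le_one, abs_div, abs_of_pos (regAbs_pos hδ _ _),
    div_le_one (regAbs_pos hδ _ _)]
  exact abs_le_regAbs_left p q

/-- With `δ` fixed, the gradient of `φP/s` is controlled by those of `φ`, `P` and `Q`. Thus the
energy bound for the approximate solutions passes to their test functions. -/
lemma sq_pd_kato_test_le (hδ : 0 < δ) {P Q φ : Eucl n → ℝ} (hP : ContDiff ℝ ∞ P)
    (hQ : ContDiff ℝ ∞ Q) (hφ : ContDiff ℝ ∞ φ) {M : ℝ} (hM : ∀ x, |φ x| ≤ M) (i : Fin n)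
    (x : Eucl n) :
    pd i (fun x => φ x * (P x / regAbs δ (P x) (Q x))) x ^ 2 ≤
      2 * pd i φ x ^ 2 + 4 * (M / δ) ^ 2 * (pd i P x ^ 2 + pd i Q x ^ 2) := by
  rw [pd_kato_test hδ hP hQ hφ, pd_regAbs hδ hP hQ]
  have hu := sq_div_regAbs_le_one (P x) (Q x) hδ
  have hw := sq_div_regAbs_le_one (Q x) (P x) hδ
  rw [regAbs_comm] at hw
  have hφs : (φ x / regAbs δ (P x) (Q x)) ^ 2 ≤ (M / δ) ^ 2 := by
    rw [← sq_abs, abs_div, abs_of_pos (regAbs_pos hδ _ _)]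
    exact pow_le_pow_left₀ (by have := regAbs_pos hδ (P x) (Q x); positivity)
      (div_le_div₀ ((abs_nonneg _).trans (hM x)) (hM x) hδ (le_regAbs _ _)) 2
  set u := P x / regAbs δ (P x) (Q x)
  set w := Q x / regAbs δ (P x) (Q x)
  set f := φ x / regAbs δ (P x) (Q x)
  set A := pd i P x
  set B := pd i Q x
  have h1 : (A - u * (u * A + w * B)) ^ 2 ≤ 2 * (A ^ 2 + B ^ 2) := by
    have e : A - u * (u * A + w * B) = (1 - u ^ 2) * A - u * w * B := by ring
    have h2 : (1 - u ^ 2) ^ 2 ≤ 1 := by nlinarith [sq_nonneg u]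
    have h3 : (u * w) ^ 2 ≤ 1 := by
      rw [mul_pow]; exact mul_le_one₀ hu (sq_nonneg _) hw
    rw [e]
    have h4 := mul_le_mul_of_nonneg_right h2 (sq_nonneg A)
    have h5 := mul_le_mul_of_nonneg_right h3 (sq_nonneg B)
    nlinarith [sq_nonneg ((1 - u ^ 2) * A + u * w * B)]
  have h6 : (f * (A - u * (u * A + w * B))) ^ 2 ≤ (M / δ) ^ 2 * (2 * (A ^ 2 + B ^ 2)) := by
    rw [mul_pow]
    exact mul_le_mul hφs h1 (sq_nonneg _) (sq_nonneg _)
  have h7 := mul_le_mul_of_nonneg_left hu (sq_nonneg (pd i φ x))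
  nlinarith [sq_nonneg (pd i φ x * u - f * (A - u * (u * A + w * B)))]

/-- Kato's inequality with a regularized absolute value for weak solutions. -/
lemma kato_regularized (ha : IsEllipticCoeff a L c) (hδ : 0 < δ) {p q F G φ : Eucl n → ℝ}
    {h h' : Fin n → Eucl n → ℝ} (hp : IsL2c p) (hq : IsL2c q) (hF : IsL2c F) (hG : IsL2c G)
    (hh : ∀ i, IsL2c (h i)) (hh' : ∀ i, IsL2c (h' i)) (hwp : WeakEq a p F h)
    (hwq : WeakEq a q G h') (hφ : ContDiff ℝ ∞ φ) (hφc : HasCompactSupport φ)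
    (hφ0 : ∀ x, 0 ≤ φ x) (hhφ : ∀ i x, x ∈ tsupport φ → h i x = 0)
    (hhφ' : ∀ i x, x ∈ tsupport φ → h' i x = 0) :
    (∫ x, F x * (φ x * (p x / regAbs δ (p x) (q x)))) +
      ∫ x, G x * (φ x * (q x / regAbs δ (p x) (q x))) ≤
    ∫ x, regAbs δ (p x) (q x) * divForm a φ x := by
  obtain ⟨P, F', H, hP, hPc, hF', hH, hwP, hPt, hFt, hHt, C₁, hC₁⟩ :=
    hwp.exists_approx_bounded ha hp hF hh
  obtain ⟨Q, G', H', hQ, hQc, hG', hH', hwQ, hQt, hGt, hHt', C₂, hC₂⟩ :=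
    hwq.exists_approx_bounded ha hq hG hh'
  obtain ⟨M, hM⟩ := exists_abs_le_of_hasCompactSupport hφ.continuous hφc
  have hpos : ∀ x (ξ : Fin n → ℝ), 0 ≤ ∑ i, ξ i * ∑ j, a x i j * ξ j := fun x ξ =>
    (mul_nonneg ha.pos.le (Finset.sum_nonneg fun i _ => sq_nonneg _)).trans (ha.elliptic x ξ)
  have hPL : ∀ k, MemLp (P k) 2 volume := fun k =>
    (hP k).continuous.memLp_of_hasCompactSupport (hPc k)
  have hQL : ∀ k, MemLp (Q k) 2 volume := fun k =>
    (hQ k).continuous.memLp_of_hasCompactSupport (hQc k)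
  have hi1 : ∀ k, Integrable fun x => (P k x - p x) ^ 2 :=
    fun k => ((hPL k).sub hp.memLp).integrable_sq
  have hi2 : ∀ k, Integrable fun x => (Q k x - q x) ^ 2 :=
    fun k => ((hQL k).sub hq.memLp).integrable_sq
  have hdiff : Tendsto (fun k => ∫ x, ((P k x - p x) ^ 2 + (Q k x - q x) ^ 2)) atTop (𝓝 0) := by
    simpa [integral_add (hi1 _) (hi2 _)] using hPt.add hQt
  -- Stated for arbitrary pairs so that it serves both components, with the roles of `p` and `q`
  -- exchanged.
  have key : ∀ {p q : Eucl n → ℝ} {P Q : ℕ → Eucl n → ℝ}, Measurable p → Measurable q →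
      (∀ k, ContDiff ℝ ∞ (P k)) → (∀ k, ContDiff ℝ ∞ (Q k)) →
      (∀ k, Integrable fun x => (P k x - p x) ^ 2 + (Q k x - q x) ^ 2) →
      Tendsto (fun k => ∫ x, ((P k x - p x) ^ 2 + (Q k x - q x) ^ 2)) atTop (𝓝 0) →
      MemLp (fun x => φ x * (p x / regAbs δ (p x) (q x))) 2 volume ∧
      Tendsto (fun k => ∫ x, (φ x * (P k x / regAbs δ (P k x) (Q k x)) -
        φ x * (p x / regAbs δ (p x) (q x))) ^ 2) atTop (𝓝 0) := by
    intro p q P Q hpm hqm hP hQ hi ht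
    have hm : Measurable fun x => p x / regAbs δ (p x) (q x) :=
      hpm.div (((hpm.pow_const 2).add (hqm.pow_const 2)).add_const _).sqrt
    have hmem : MemLp (fun x => φ x * (p x / regAbs δ (p x) (q x))) 2 volume := by
      refine (hφ.continuous.memLp_of_hasCompactSupport (p := 2) hφc).mono
        (hφ.continuous.measurable.mul hm).aestronglyMeasurable (Eventually.of_forall fun x => ?_)
      rw [norm_mul]
      refine mul_le_of_le_one_right (norm_nonneg _) ?_
      exact (sq_le_one_iff_abs_le_one _).1 (sq_div_regAbs_le_one _ _ hδ)
    refine ⟨hmem, ?_⟩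
    have ht' := ht.const_mul (M ^ 2 * (4 / δ ^ 2))
    rw [mul_zero] at ht'
    refine squeeze_zero (fun k => integral_nonneg fun x => sq_nonneg _) (fun k => ?_) ht'
    rw [← integral_const_mul]
    have hmem' : MemLp (fun x => φ x * (P k x / regAbs δ (P k x) (Q k x))) 2 volume :=
      (contDiff_kato_test hδ (hP k) (hQ k) hφ).continuous.memLp_of_hasCompactSupport hφc.mul_right
    refine integral_mono (hmem'.sub hmem).integrable_sq ((hi k).const_mul _) fun x => ?_
    simp only [← mul_sub, mul_pow, mul_assoc]
    refine mul_le_mul ?_ (sq_div_regAbs_sub_le hδ _ _ _ _) (sq_nonneg _) (sq_nonneg _)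
    rw [← sq_abs]
    exact pow_le_pow_left₀ (abs_nonneg _) (hM x) 2
  have hbound : ∀ {P Q : ℕ → Eucl n → ℝ} {C₁ C₂ : ℝ}, (∀ k, ContDiff ℝ ∞ (P k)) →
      (∀ k, ContDiff ℝ ∞ (Q k)) → (∀ k, HasCompactSupport (P k)) →
      (∀ k, HasCompactSupport (Q k)) → (∀ k i, ∫ x, pd i (P k) x ^ 2 ≤ C₁) →
      (∀ k i, ∫ x, pd i (Q k) x ^ 2 ≤ C₂) → ∃ C, ∀ k i,
      ∫ x, pd i (fun x => φ x * (P k x / regAbs δ (P k x) (Q k x))) x ^ 2 ≤ C := by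
    intro P Q C₁ C₂ hP hQ hPc hQc hC₁ hC₂
    have hsq : ∀ {f : Eucl n → ℝ} (i : Fin n), ContDiff ℝ ∞ f → HasCompactSupport f →
        Integrable fun x => pd i f x ^ 2 := fun i hf hfc =>
      ((contDiff_pd hf).continuous.memLp_of_hasCompactSupport (p := 2)
        (HasCompactSupport.pd hfc)).integrable_sq
    refine ⟨2 * (∑ i, ∫ x, pd i φ x ^ 2) + 4 * (M / δ) ^ 2 * (C₁ + C₂), fun k i => ?_⟩
    have h1 : ∫ x, pd i φ x ^ 2 ≤ ∑ i, ∫ x, pd i φ x ^ 2 :=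
      Finset.single_le_sum (f := fun i => ∫ x, pd i φ x ^ 2)
        (fun i _ => integral_nonneg fun x => sq_nonneg _) (Finset.mem_univ i)
    have iA := (hsq i hφ hφc).const_mul 2
    have iB : Integrable fun x => pd i (P k) x ^ 2 + pd i (Q k) x ^ 2 :=
      (hsq i (hP k) (hPc k)).add (hsq i (hQ k) (hQc k))
    have h2 := integral_mono (hsq i (contDiff_kato_test hδ (hP k) (hQ k) hφ) hφc.mul_right)
      (iA.add (iB.const_mul (4 * (M / δ) ^ 2)))
      (fun x => sq_pd_kato_test_le hδ (hP k) (hQ k) hφ hM i x)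
    simp only [Pi.add_apply] at h2
    rw [integral_add iA (iB.const_mul _), integral_const_mul, integral_const_mul,
      integral_add (hsq i (hP k) (hPc k)) (hsq i (hQ k) (hQc k))] at h2
    have h3 : 4 * (M / δ) ^ 2 * ((∫ x, pd i (P k) x ^ 2) + ∫ x, pd i (Q k) x ^ 2) ≤
        4 * (M / δ) ^ 2 * (C₁ + C₂) :=
      mul_le_mul_of_nonneg_left (add_le_add (hC₁ k i) (hC₂ k i)) (by positivity)
    linarith
  have hsub : ∀ {θ : Eucl n → ℝ}, tsupport (fun x => φ x * θ x) ⊆ tsupport φ :=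
    fun {θ} => tsupport_mul_subset_left
  obtain ⟨m1, t1⟩ := key hp.measurable hq.measurable hP hQ (fun k => (hi1 k).add (hi2 k)) hdiff
  obtain ⟨C₃, hC₃⟩ := hbound hP hQ hPc hQc hC₁ hC₂
  obtain ⟨m2, t2⟩ := key hq.measurable hp.measurable hQ hP (fun k => (hi2 k).add (hi1 k))
    (by simpa only [add_comm] using hdiff)
  obtain ⟨C₄, hC₄⟩ := hbound hQ hP hQc hPc hC₂ hC₁
  have T1 := tendsto_integral_divForm_test hF' hH hwP hF.memLp (fun i => (hh i).memLp) hFt hHt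
    (fun k => contDiff_kato_test hδ (hP k) (hQ k) hφ) (fun k => hφc.mul_right) m1 t1 hC₃
    (fun k i x hx => hhφ i x (hsub hx))
  have T2 := tendsto_integral_divForm_test hG' hH' hwQ hG.memLp (fun i => (hh' i).memLp) hGt hHt'
    (fun k => contDiff_kato_test hδ (hQ k) (hP k) hφ) (fun k => hφc.mul_right) m2 t2 hC₄
    (fun k i x hx => hhφ' i x (hsub hx))
  simp only [regAbs_comm (q _) (p _), regAbs_comm (Q _ _) (P _ _)] at T2
  have T3 : Tendsto (fun k => ∫ x, regAbs δ (P k x) (Q k x) * divForm a φ x) atTop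
      (𝓝 (∫ x, regAbs δ (p x) (q x) * divForm a φ x)) := by
    have hdL : MemLp (divForm a φ) 2 volume :=
      (contDiff_divForm ha.smooth hφ).continuous.memLp_of_hasCompactSupport
        (HasCompactSupport.divForm hφc)
    have hdI : Integrable (divForm a φ) :=
      (contDiff_divForm ha.smooth hφ).continuous.integrable_of_hasCompactSupport
        (HasCompactSupport.divForm hφc)
    have hsm : Measurable fun x => regAbs δ (p x) (q x) :=
      (((hp.measurable.pow_const 2).add (hq.measurable.pow_const 2)).add_const _).sqrt
    have hle : ∀ k x, (regAbs δ (P k x) (Q k x) - regAbs δ (p x) (q x)) ^ 2 ≤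
        (P k x - p x) ^ 2 + (Q k x - q x) ^ 2 := fun k x => sq_regAbs_sub_le hδ _ _ _ _
    have hmd : ∀ k, MemLp (fun x => regAbs δ (P k x) (Q k x) - regAbs δ (p x) (q x)) 2 volume := by
      intro k
      have hms : AEStronglyMeasurable
          (fun x => regAbs δ (P k x) (Q k x) - regAbs δ (p x) (q x)) volume :=
        ((contDiff_regAbs hδ (hP k) (hQ k)).continuous.measurable.sub hsm).aestronglyMeasurable
      rw [memLp_two_iff_integrable_sq hms]
      refine ((hi1 k).add (hi2 k)).mono' (hms.pow 2) (Eventually.of_forall fun x => ?_)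
      rw [Real.norm_of_nonneg (sq_nonneg _)]
      exact hle k x
    have hmt : Tendsto (fun k => ∫ x, (regAbs δ (P k x) (Q k x) - regAbs δ (p x) (q x)) ^ 2) atTop
        (𝓝 0) := squeeze_zero (fun k => integral_nonneg fun x => sq_nonneg _)
      (fun k => integral_mono (hmd k).integrable_sq ((hi1 k).add (hi2 k)) (hle k)) hdiff
    have t := (tendsto_integral_mul_zero hmd (fun _ => hdL) hmt fun _ => le_rfl).add
      (tendsto_const_nhds (x := ∫ x, regAbs δ (p x) (q x) * divForm a φ x))
    rw [zero_add] at t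
    refine t.congr fun k => ?_
    have iK : Integrable fun x => regAbs δ (P k x) (Q k x) * divForm a φ x :=
      ((contDiff_regAbs hδ (hP k) (hQ k)).mul
        (contDiff_divForm ha.smooth hφ)).continuous.integrable_of_hasCompactSupport
        (HasCompactSupport.divForm hφc).mul_left
    have iD : Integrable fun x => (regAbs δ (P k x) (Q k x) - regAbs δ (p x) (q x)) *
        divForm a φ x := integrable_mul_of_memLp_two (hmd k) hdL
    have iL : Integrable fun x => regAbs δ (p x) (q x) * divForm a φ x := by
      refine (iK.sub iD).congr (Eventually.of_forall fun x => ?_)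
      simp only [Pi.sub_apply]
      ring
    rw [← integral_add iD iL]
    congr 1; ext x; ring
  exact le_of_tendsto_of_tendsto' (T1.add T2) T3 fun k =>
    kato_smooth ha.smooth hpos hδ (hP k) (hQ k) hφ hφc hφ0

/-- Kato's inequality for weak solutions of divergence form equations in Euclidean space. -/
theorem kato_euclidean (ha : IsEllipticCoeff a L c) {p q F G φ : Eucl n → ℝ}
    {h h' : Fin n → Eucl n → ℝ} (hp : IsL2c p) (hq : IsL2c q) (hF : IsL2c F) (hG : IsL2c G)
    (hh : ∀ i, IsL2c (h i)) (hh' : ∀ i, IsL2c (h' i)) (hwp : WeakEq a p F h)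
    (hwq : WeakEq a q G h') (hφ : ContDiff ℝ ∞ φ) (hφc : HasCompactSupport φ)
    (hφ0 : ∀ x, 0 ≤ φ x) (hhφ : ∀ i x, x ∈ tsupport φ → h i x = 0)
    (hhφ' : ∀ i x, x ∈ tsupport φ → h' i x = 0) :
    ∫ x, (F x * (p x / √(p x ^ 2 + q x ^ 2)) + G x * (q x / √(p x ^ 2 + q x ^ 2))) * φ x ≤
    ∫ x, √(p x ^ 2 + q x ^ 2) * divForm a φ x := by
  have hφL : MemLp φ 2 volume := hφ.continuous.memLp_of_hasCompactSupport hφc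
  have hdL : MemLp (divForm a φ) 2 volume :=
    (contDiff_divForm ha.smooth hφ).continuous.memLp_of_hasCompactSupport
      (HasCompactSupport.divForm hφc)
  have hdI : Integrable (divForm a φ) :=
    (contDiff_divForm ha.smooth hφ).continuous.integrable_of_hasCompactSupport
      (HasCompactSupport.divForm hφc)
  have hδt : ∀ p q : ℝ, Tendsto (fun k => regAbs (scale k) p q) atTop (𝓝 (√(p ^ 2 + q ^ 2))) := by
    intro p q
    have h := ((tendsto_scale.pow 2).const_add (p ^ 2 + q ^ 2)).sqrt
    simpa [regAbs] using h
  have hmreg : ∀ {p q : Eucl n → ℝ} (δ : ℝ), Measurable p → Measurable q →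
      Measurable fun x => regAbs δ (p x) (q x) := fun δ hp hq =>
    (((hp.pow_const 2).add (hq.pow_const 2)).add_const _).sqrt
  have key : ∀ {p q F : Eucl n → ℝ}, IsL2c p → IsL2c q → IsL2c F →
      Integrable (fun x => F x * (φ x * (p x / √(p x ^ 2 + q x ^ 2)))) ∧
      Tendsto (fun k => ∫ x, F x * (φ x * (p x / regAbs (scale k) (p x) (q x)))) atTop
        (𝓝 (∫ x, F x * (φ x * (p x / √(p x ^ 2 + q x ^ 2))))) := by
    intro p q F hp hq hF
    have hb : Integrable fun x => |F x * φ x| := (integrable_mul_of_memLp_two hF.memLp hφL).abs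
    have hm : ∀ k, AEStronglyMeasurable
        (fun x => F x * (φ x * (p x / regAbs (scale k) (p x) (q x)))) volume := fun k =>
      (hF.measurable.mul (hφ.continuous.measurable.mul (hp.measurable.div
        (hmreg _ hp.measurable hq.measurable)))).aestronglyMeasurable
    have hle : ∀ k x, ‖F x * (φ x * (p x / regAbs (scale k) (p x) (q x)))‖ ≤ |F x * φ x| := by
      intro k x
      rw [← mul_assoc, norm_mul, Real.norm_eq_abs]
      exact mul_le_of_le_one_right (abs_nonneg _)
        ((sq_le_one_iff_abs_le_one _).1 (sq_div_regAbs_le_one _ _ (scale_pos k)))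
    have hlim : ∀ x, Tendsto (fun k => F x * (φ x * (p x / regAbs (scale k) (p x) (q x)))) atTop
        (𝓝 (F x * (φ x * (p x / √(p x ^ 2 + q x ^ 2))))) := by
      intro x
      -- Where `p` vanishes all quotients are zero, including the limit `0 / 0 = 0`, in accordance
      -- with `sgn 0 = 0`. Elsewhere the limiting denominator is positive.
      by_cases h0 : p x = 0
      · simp [h0]
      · refine ((tendsto_const_nhds.div (hδt _ _) ?_).const_mul _).const_mul _
        have : 0 < p x ^ 2 + q x ^ 2 := by positivity
        exact (Real.sqrt_pos.2 this).ne'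
    refine ⟨?_, tendsto_integral_of_dominated_convergence _ hm hb
      (fun k => Eventually.of_forall (hle k)) (Eventually.of_forall hlim)⟩
    exact hb.mono' (aestronglyMeasurable_of_tendsto_ae atTop hm (Eventually.of_forall hlim))
      (Eventually.of_forall fun x => le_of_tendsto' (hlim x).norm fun k => hle k x)
  obtain ⟨i1, t1⟩ := key hp hq hF
  obtain ⟨i2, t2⟩ := key hq hp hG
  simp only [add_comm (q _ ^ 2), regAbs_comm (q _) (p _)] at i2 t2
  have t3 : Tendsto (fun k => ∫ x, regAbs (scale k) (p x) (q x) * divForm a φ x) atTop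
      (𝓝 (∫ x, √(p x ^ 2 + q x ^ 2) * divForm a φ x)) := by
    refine tendsto_integral_of_dominated_convergence
      (fun x => (|p x| + |q x| + 1) * |divForm a φ x|) (fun k => ?_) ?_ (fun k => ?_) ?_
    · exact ((hmreg _ hp.measurable hq.measurable).mul
        (contDiff_divForm ha.smooth hφ).continuous.measurable).aestronglyMeasurable
    · simp only [add_mul, one_mul]
      exact ((integrable_mul_of_memLp_two hp.memLp.abs hdL.abs).add
        (integrable_mul_of_memLp_two hq.memLp.abs hdL.abs)).add hdI.abs
    · refine Eventually.of_forall fun x => ?_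
      rw [norm_mul, Real.norm_eq_abs, Real.norm_eq_abs]
      refine mul_le_mul_of_nonneg_right ?_ (abs_nonneg _)
      rw [abs_of_pos (regAbs_pos (scale_pos k) _ _), regAbs]
      refine Real.sqrt_le_iff.2 ⟨by positivity, ?_⟩
      -- Scales at most 1 give the majorant `|p| + |q| + 1` for the regularized modulus.
      have hs : scale k ≤ 1 := by
        rw [scale, div_le_one (by positivity)]; linarith [(Nat.cast_nonneg k : (0 : ℝ) ≤ k)]
      have hs0 := scale_pos k
      nlinarith [sq_abs (p x), sq_abs (q x), abs_nonneg (p x), abs_nonneg (q x),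
        mul_nonneg (abs_nonneg (p x)) (abs_nonneg (q x))]
    · exact Eventually.of_forall fun x => (hδt _ _).mul_const _
  have hfin := le_of_tendsto_of_tendsto' (t1.add t2) t3 fun k =>
    kato_regularized ha (scale_pos k) hp hq hF hG hh hh' hwp hwq hφ hφc hφ0 hhφ hhφ'
  rw [← integral_add i1 i2] at hfin
  refine le_trans (le_of_eq ?_) hfin
  congr 1; ext x; ring

end EuclideanKato

/-! ### Cutoffs, extension of the coefficients, and local solutions -/

section Localization

variable {n : ℕ} {U : Set (Eucl n)} {a : Eucl n → Matrix (Fin n) (Fin n) ℝ}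

/-- Smooth cutoff functions, together with a compact neighbourhood carrying their support. -/
lemma exists_cutoff {K : Set (Eucl n)} (hK : IsCompact K) (hU : IsOpen U) (hKU : K ⊆ U) :
    ∃ χ : Eucl n → ℝ, ContDiff ℝ ∞ χ ∧ HasCompactSupport χ ∧ tsupport χ ⊆ U ∧
      (∀ x ∈ K, ∀ᶠ y in 𝓝 x, χ y = 1) ∧ ∀ x, χ x ∈ Icc (0 : ℝ) 1 := by
  obtain ⟨K', hK', hKK', hK'U⟩ := exists_compact_between hK hU hKU
  obtain ⟨f, hf1, hf0, hf⟩ := exists_contMDiffMap_one_nhds_of_subset_interior (n := (⊤ : ℕ∞))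
    𝓘(ℝ, Eucl n) hK.isClosed hKK'
  have hsub : tsupport f ⊆ K' := closure_minimal (fun x hx => by
    by_contra h; exact hx (hf0 x h)) hK'.isClosed
  refine ⟨f, f.contMDiff.contDiff, hK'.of_isClosed_subset (isClosed_tsupport _) hsub,
    hsub.trans hK'U, fun x hx => ?_, hf⟩
  exact (eventually_nhdsSet_iff_forall.1 hf1) x hx

/-- The second-order Leibniz rule. The cross term carries `a_ij + a_ji` since `a` is not assumed
symmetric. -/
lemma divForm_mul (ha : ∀ i j, ContDiffOn ℝ ∞ (fun y => a y i j) U) (hU : IsOpen U)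
    {χ η : Eucl n → ℝ} (hχ : ContDiff ℝ ∞ χ) (hη : ContDiff ℝ ∞ η) {x : Eucl n} (hx : x ∈ U) :
    divForm a (fun y => χ y * η y) x = χ x * divForm a η x + η x * divForm a χ x +
      ∑ i, (∑ j, (a x i j + a x j i) * pd j χ x) * pd i η x := by
  have hX := fun i => ContDiffOn.diffAt
    (contDiffOn_flux (f := η) (i := i) ha hU hη.contDiffOn) hU hx
  have hY := fun i => ContDiffOn.diffAt
    (contDiffOn_flux (f := χ) (i := i) ha hU hχ.contDiffOn) hU hx
  have h1 : ∀ i, pd i (fun y => ∑ j, a y i j * pd j (fun y => χ y * η y) y) x =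
      (χ x * pd i (fun y => ∑ j, a y i j * pd j η y) x +
        pd i χ x * ∑ j, a x i j * pd j η x) +
      (η x * pd i (fun y => ∑ j, a y i j * pd j χ y) x +
        pd i η x * ∑ j, a x i j * pd j χ x) := by
    intro i
    have e : (fun y => ∑ j, a y i j * pd j (fun y => χ y * η y) y) =
        fun y => χ y * (∑ j, a y i j * pd j η y) + η y * ∑ j, a y i j * pd j χ y := by
      ext y
      rw [Finset.mul_sum, Finset.mul_sum, ← Finset.sum_add_distrib]
      refine Finset.sum_congr rfl fun j _ => ?_
      rw [pd_mul (ContDiff.diffAt hχ) (ContDiff.diffAt hη)]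
      ring
    have d1 : DifferentiableAt ℝ (fun y => χ y * ∑ j, a y i j * pd j η y) x :=
      (ContDiff.diffAt hχ).mul (hX i)
    have d2 : DifferentiableAt ℝ (fun y => η y * ∑ j, a y i j * pd j χ y) x :=
      (ContDiff.diffAt hη).mul (hY i)
    rw [e, pd_add d1 d2,
      pd_mul (ContDiff.diffAt hχ) (hX i), pd_mul (ContDiff.diffAt hη) (hY i)]
  simp only [divForm, h1, Finset.sum_add_distrib, Finset.mul_sum, Finset.sum_mul, add_mul]
  rw [Finset.sum_comm (f := fun i j => pd i χ x * (a x i j * pd j η x))]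
  have e1 : ∑ j, ∑ i, pd i χ x * (a x i j * pd j η x) =
      ∑ i, ∑ j, a x j i * pd j χ x * pd i η x :=
    Finset.sum_congr rfl fun i _ => Finset.sum_congr rfl fun j _ => by ring
  have e2 : ∑ i, ∑ j, pd i η x * (a x i j * pd j χ x) =
      ∑ i, ∑ j, a x i j * pd j χ x * pd i η x :=
    Finset.sum_congr rfl fun i _ => Finset.sum_congr rfl fun j _ => by ring
  rw [e1, e2]
  ring

/-- A positive definite continuous matrix field is uniformly elliptic on compact sets. -/
lemma exists_ellipticity {K : Set (Eucl n)} (hK : IsCompact K)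
    (ha : ∀ i j, ContinuousOn (fun y => a y i j) K)
    (hpos : ∀ x ∈ K, ∀ ξ : Fin n → ℝ, ξ ≠ 0 → 0 < ∑ i, ξ i * ∑ j, a x i j * ξ j) :
    ∃ c > 0, ∀ x ∈ K, ∀ ξ : Fin n → ℝ, c * ∑ i, ξ i ^ 2 ≤ ∑ i, ξ i * ∑ j, a x i j * ξ j := by
  have hcpt : IsCompact (K ×ˢ Metric.sphere (0 : Eucl n) 1) := hK.prod (isCompact_sphere _ _)
  have hcont : ContinuousOn (fun p : Eucl n × Eucl n => ∑ i, p.2 i * ∑ j, a p.1 i j * p.2 j)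
      (K ×ˢ Metric.sphere (0 : Eucl n) 1) := by
    have h : ∀ i j, ContinuousOn (fun p : Eucl n × Eucl n => a p.1 i j)
        (K ×ˢ Metric.sphere (0 : Eucl n) 1) := fun i j =>
      (ha i j).comp continuousOn_fst fun p hp => hp.1
    have h' : ∀ i, Continuous fun p : Eucl n × Eucl n => p.2 i := fun i =>
      (EuclideanSpace.proj (𝕜 := ℝ) i).continuous.comp continuous_snd
    exact continuousOn_finsetSum _ fun i _ => (h' i).continuousOn.mul
      (continuousOn_finsetSum _ fun j _ => (h i j).mul (h' j).continuousOn)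
  -- A positive lower bound over `K` times the unit sphere, valid also when that product is empty;
  -- homogeneity of degree two then covers all `ξ`.
  obtain ⟨c, hc, hc'⟩ := hcpt.exists_forall_le' hcont (a := 0) fun p hp =>
    hpos p.1 hp.1 (fun i => p.2 i) fun h0 => by
      have h1 : p.2 = 0 := by ext i; exact congrFun h0 i
      have h2 := hp.2
      simp [h1] at h2
  refine ⟨c, hc, fun x hx ξ => ?_⟩
  set z : Eucl n := WithLp.toLp 2 ξ with hz
  have hn : ‖z‖ ^ 2 = ∑ i, ξ i ^ 2 := by simp [EuclideanSpace.norm_sq_eq, hz]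
  by_cases h0 : z = 0
  · have : ∀ i, ξ i = 0 := fun i => by
      have := congrArg (fun z : Eucl n => z i) h0
      simpa [hz] using this
    simp [this]
  · have hz0 : 0 < ‖z‖ := norm_pos_iff.2 h0
    have h1 := hc' (x, ‖z‖⁻¹ • z) ⟨hx, by simp [norm_smul, hz0.ne']⟩
    have h2 : ∑ i, (‖z‖⁻¹ • z) i * ∑ j, a x i j * (‖z‖⁻¹ • z) j =
        (‖z‖ ^ 2)⁻¹ * ∑ i, ξ i * ∑ j, a x i j * ξ j := by
      simp only [Finset.mul_sum]
      refine Finset.sum_congr rfl fun i _ => Finset.sum_congr rfl fun j _ => ?_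
      simp only [PiLp.smul_apply, smul_eq_mul, hz]
      ring
    simp only at h1
    rw [h2, le_inv_mul_iff₀ (by positivity), hn] at h1
    linarith

/-- A locally defined elliptic coefficient field extends from a neighbourhood of a compact set. -/
lemma exists_elliptic_extension {K : Set (Eucl n)} (hK : IsCompact K) (hU : IsOpen U)
    (hKU : K ⊆ U) (ha : ∀ i j, ContDiffOn ℝ ∞ (fun y => a y i j) U)
    (hpos : ∀ x ∈ U, ∀ ξ : Fin n → ℝ, ξ ≠ 0 → 0 < ∑ i, ξ i * ∑ j, a x i j * ξ j) :
    ∃ (b : Eucl n → Matrix (Fin n) (Fin n) ℝ) (L c : ℝ), IsEllipticCoeff b L c ∧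
      ∀ x ∈ K, b =ᶠ[𝓝 x] a := by
  obtain ⟨χ, hχ, hχc, hχU, hχ1, hχI⟩ := exists_cutoff hK hU hKU
  obtain ⟨c, hc, hell⟩ := exists_ellipticity (a := a) hχc.isCompact
    (fun i j => (ha i j).continuousOn.mono hχU) fun x hx => hpos x (hχU hx)
  -- The extension is `b = 1 + χ(a - 1) = χa + (1 - χ)1`. As a compactly supported smooth
  -- perturbation of the identity it is globally Lipschitz; as a convex combination it has
  -- ellipticity constant `min c 1`.
  let d : Fin n → Fin n → Eucl n → ℝ := fun i j x => χ x * (a x i j - (1 : Matrix _ _ ℝ) i j)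
  have hd : ∀ i j, ContDiff ℝ ∞ (d i j) := fun i j =>
    contDiff_mul_of_tsupport_subset hU hχ hχU ((ha i j).sub contDiffOn_const)
  have hdc : ∀ i j, HasCompactSupport (d i j) := fun i j => hχc.mul_right
  let b : Eucl n → Matrix (Fin n) (Fin n) ℝ := fun x =>
    Matrix.of fun i j => d i j x + (1 : Matrix _ _ ℝ) i j
  have hb : ∀ x i j, b x i j = d i j x + (1 : Matrix _ _ ℝ) i j := fun _ _ _ => rfl
  have hbs : ∀ i j, ContDiff ℝ ∞ fun y => b y i j := fun i j => (hd i j).add contDiff_const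
  have hpdb : ∀ i j k x, pd k (fun y => b y i j) x = pd k (d i j) x := by
    intro i j k x
    simp only [hb]
    rw [pd_add (ContDiff.diffAt (hd i j)) (differentiableAt_const _)]
    simp [pd]
  have hL1 : ∀ i j, ∃ L : ℝ, ∀ x y, |d i j x - d i j y| ≤ L * ‖x - y‖ := fun i j => by
    obtain ⟨L, hL⟩ := (hd i j).lipschitzWith_of_hasCompactSupport (hdc i j) (by simp)
    exact ⟨L, fun x y => by simpa [dist_eq_norm] using hL.dist_le_mul x y⟩
  have hL2 : ∀ i j k, ∃ L : ℝ, ∀ x, |pd k (d i j) x| ≤ L := fun i j k =>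
    exists_abs_le_of_hasCompactSupport (contDiff_pd (hd i j)).continuous
      (HasCompactSupport.pd (hdc i j))
  choose L₁ hL₁ using hL1
  choose L₂ hL₂ using hL2
  obtain ⟨M₁, hM₁⟩ := Finite.exists_le fun p : Fin n × Fin n => L₁ p.1 p.2
  obtain ⟨M₂, hM₂⟩ := Finite.exists_le fun p : Fin n × Fin n × Fin n => L₂ p.1 p.2.1 p.2.2
  refine ⟨b, max M₁ M₂, min c 1, ⟨hbs, fun i j x y => ?_, fun i j k x => ?_,
    lt_min hc one_pos, fun x ξ => ?_⟩, fun x hx => ?_⟩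
  · rw [hb, hb, add_sub_add_right_eq_sub]
    exact (hL₁ i j x y).trans (mul_le_mul_of_nonneg_right ((hM₁ (i, j)).trans (le_max_left _ _))
      (norm_nonneg _))
  · rw [hpdb]
    exact (hL₂ i j k x).trans ((hM₂ (i, j, k)).trans (le_max_right _ _))
  · have e : ∑ i, ξ i * ∑ j, b x i j * ξ j =
        χ x * (∑ i, ξ i * ∑ j, a x i j * ξ j) + (1 - χ x) * ∑ i, ξ i ^ 2 := by
      have h1 : ∀ i, ∑ j, (1 : Matrix (Fin n) (Fin n) ℝ) i j * ξ j = ξ i := fun i => by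
        simp [Matrix.one_apply]
      have h2 : ∀ i, ∑ j, b x i j * ξ j = χ x * (∑ j, a x i j * ξ j) + (1 - χ x) * ξ i := by
        intro i
        conv_rhs => rw [← h1 i]
        rw [Finset.mul_sum, Finset.mul_sum, ← Finset.sum_add_distrib]
        exact Finset.sum_congr rfl fun j _ => by rw [hb]; ring
      simp only [h2, mul_add, Finset.sum_add_distrib, Finset.mul_sum]
      congr 1
      · exact Finset.sum_congr rfl fun i _ => Finset.sum_congr rfl fun j _ => by ring
      · exact Finset.sum_congr rfl fun i _ => by ring
    rw [e]
    have hs : 0 ≤ ∑ i, ξ i ^ 2 := Finset.sum_nonneg fun i _ => sq_nonneg _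
    have h1 : min c 1 * ∑ i, ξ i ^ 2 ≤ ∑ i, ξ i ^ 2 :=
      mul_le_of_le_one_left hs (min_le_right _ _)
    have h3 := (hχI x).2
    by_cases hx : x ∈ tsupport χ
    · have h2 : min c 1 * ∑ i, ξ i ^ 2 ≤ ∑ i, ξ i * ∑ j, a x i j * ξ j :=
        (mul_le_mul_of_nonneg_right (min_le_left _ _) hs).trans (hell x hx ξ)
      nlinarith [mul_le_mul_of_nonneg_left h2 (hχI x).1,
        mul_le_mul_of_nonneg_left h1 (sub_nonneg.2 h3)]
    · simpa [image_eq_zero_of_notMem_tsupport hx] using h1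
  · filter_upwards [hχ1 x hx] with y hy
    ext i j
    simp [hb, d, hy]

lemma IsL2c.sub {f g : Eucl n → ℝ} (hf : IsL2c f) (hg : IsL2c g) : IsL2c fun x => f x - g x :=
  ⟨hf.measurable.sub hg.measurable, hf.memLp.sub hg.memLp, hf.compact.sub hg.compact⟩

/-- A function all of whose smooth cutoffs inside `U` are measurable and square-integrable. -/
def IsL2loc (U : Set (Eucl n)) (f : Eucl n → ℝ) : Prop :=
  ∀ χ : Eucl n → ℝ, ContDiff ℝ ∞ χ → HasCompactSupport χ → tsupport χ ⊆ U →
    IsL2c fun x => χ x * f x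

/-- Kato's inequality for local weak solutions of elliptic divergence form equations. -/
theorem kato_local (hU : IsOpen U) (ha : ∀ i j, ContDiffOn ℝ ∞ (fun y => a y i j) U)
    (hpos : ∀ x ∈ U, ∀ ξ : Fin n → ℝ, ξ ≠ 0 → 0 < ∑ i, ξ i * ∑ j, a x i j * ξ j)
    {p q F G φ : Eucl n → ℝ} (hp : IsL2loc U p) (hq : IsL2loc U q) (hF : IsL2loc U F)
    (hG : IsL2loc U G)
    (hwp : ∀ η : Eucl n → ℝ, ContDiff ℝ ∞ η → HasCompactSupport η → tsupport η ⊆ U →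
      ∫ x, p x * divForm a η x = ∫ x, F x * η x)
    (hwq : ∀ η : Eucl n → ℝ, ContDiff ℝ ∞ η → HasCompactSupport η → tsupport η ⊆ U →
      ∫ x, q x * divForm a η x = ∫ x, G x * η x)
    (hφ : ContDiff ℝ ∞ φ) (hφc : HasCompactSupport φ) (hφU : tsupport φ ⊆ U)
    (hφ0 : ∀ x, 0 ≤ φ x) :
    ∫ x, (F x * (p x / √(p x ^ 2 + q x ^ 2)) + G x * (q x / √(p x ^ 2 + q x ^ 2))) * φ x ≤
    ∫ x, √(p x ^ 2 + q x ^ 2) * divForm a φ x := by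
  obtain ⟨χ, hχ, hχc, hχU, hχ1, -⟩ := exists_cutoff hφc.isCompact hU hφU
  obtain ⟨b, L, c, hb, hba⟩ := exists_elliptic_extension hχc.isCompact hU hχU ha hpos
  have hχφ : tsupport φ ⊆ tsupport χ := fun x hx =>
    subset_tsupport _ (by simp [(hχ1 x hx).self_of_nhds])
  have hL : ContDiff ℝ ∞ (divForm b χ) := contDiff_divForm hb.smooth hχ
  have hLc : HasCompactSupport (divForm b χ) := HasCompactSupport.divForm hχc
  have hLU : tsupport (divForm b χ) ⊆ U := tsupport_divForm_subset.trans hχU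
  -- The fluxes produced by the cutoff are `Z i * p`. Like `divForm b χ`, `Z i` involves only
  -- derivatives of `χ`, so both vanish on the support of `φ`, where `χ` is locally 1.
  let Z : Fin n → Eucl n → ℝ := fun i x => ∑ j, (b x i j + b x j i) * pd j χ x
  have hZ : ∀ i, ContDiff ℝ ∞ (Z i) := fun i =>
    ContDiff.sum fun j _ => ((hb.smooth i j).add (hb.smooth j i)).mul (contDiff_pd hχ)
  have hZt : ∀ i, tsupport (Z i) ⊆ tsupport χ := fun i =>
    closure_minimal (fun x hx => by
      by_contra h
      exact hx (by simp [Z, pd_eq_zero_of_notMem_tsupport h])) (isClosed_tsupport χ)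
  have hZc : ∀ i, HasCompactSupport (Z i) := fun i =>
    hχc.of_isClosed_subset (isClosed_tsupport _) (hZt i)
  have hχ' : ∀ x ∈ tsupport φ, χ =ᶠ[𝓝 x] fun _ => 1 := fun x hx => hχ1 x hx
  have hL0 : ∀ x ∈ tsupport φ, divForm b χ x = 0 := fun x hx => by
    rw [divForm_congr (EventuallyEq.refl _ b) (hχ' x hx)]
    simp [divForm, pd]
  have hZ0 : ∀ i, ∀ x ∈ tsupport φ, Z i x = 0 := fun i x hx => by
    refine Finset.sum_eq_zero fun j _ => ?_
    rw [pd_congr (hχ' x hx)]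
    simp [pd]
  have hint : ∀ {f g : Eucl n → ℝ}, IsL2c f → Continuous g → HasCompactSupport g →
      Integrable fun x => f x * g x := fun hf hg hgc =>
    integrable_mul_of_memLp_two hf.memLp (hg.memLp_of_hasCompactSupport hgc)
  have key : ∀ {p F : Eucl n → ℝ}, IsL2loc U p → IsL2loc U F →
      (∀ η : Eucl n → ℝ, ContDiff ℝ ∞ η → HasCompactSupport η → tsupport η ⊆ U →
        ∫ x, p x * divForm a η x = ∫ x, F x * η x) →
      WeakEq b (fun x => χ x * p x) (fun x => χ x * F x - divForm b χ x * p x)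
        (fun i x => Z i x * p x) := by
    intro p F hp hF hw η hη hηc
    -- The given equation only accepts test functions supported in `U`; `χη` is one, and on the
    -- support of `χ` the operators of `a` and `b` coincide.
    have h1 := hw (fun x => χ x * η x) (hχ.mul hη) hχc.mul_right
      (tsupport_mul_subset_left.trans hχU)
    have e1 : ∀ x, p x * divForm a (fun x => χ x * η x) x =
        χ x * p x * divForm b η x + (divForm b χ x * p x * η x +
          ∑ i, Z i x * p x * pd i η x) := by
      intro x
      by_cases hx : x ∈ tsupport χ
      · rw [← divForm_congr (hba x hx) (EventuallyEq.refl _ fun x => χ x * η x),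
          divForm_mul (fun i j => (hb.smooth i j).contDiffOn) isOpen_univ hχ hη (mem_univ x)]
        simp only [mul_add, Finset.mul_sum]
        rw [add_assoc]
        congr 1
        · ring
        · congr 1
          · ring
          · exact Finset.sum_congr rfl fun i _ => by simp only [Z]; ring
      · have h2 : x ∉ tsupport (divForm a fun x => χ x * η x) := fun h =>
          hx (tsupport_mul_subset_left (tsupport_divForm_subset h))
        have h3 : x ∉ tsupport (divForm b χ) := fun h => hx (tsupport_divForm_subset h)
        have h4 : ∀ i, Z i x = 0 := fun i =>
          image_eq_zero_of_notMem_tsupport fun h => hx (hZt i h)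
        simp [image_eq_zero_of_notMem_tsupport hx, image_eq_zero_of_notMem_tsupport h2,
          image_eq_zero_of_notMem_tsupport h3, h4]
    have i1 : Integrable fun x => χ x * p x * divForm b η x :=
      hint (hp χ hχ hχc hχU) (contDiff_divForm hb.smooth hη).continuous
        (HasCompactSupport.divForm hηc)
    have i2 : Integrable fun x => divForm b χ x * p x * η x :=
      hint (hp _ hL hLc hLU) hη.continuous hηc
    have i3 : ∀ i, Integrable fun x => Z i x * p x * pd i η x := fun i =>
      hint (hp _ (hZ i) (hZc i) ((hZt i).trans hχU)) (contDiff_pd hη).continuous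
        (HasCompactSupport.pd hηc)
    have i3' : Integrable fun x => ∑ i, Z i x * p x * pd i η x :=
      integrable_finsetSum _ fun i _ => i3 i
    have i4 : Integrable fun x => χ x * F x * η x := hint (hF χ hχ hχc hχU) hη.continuous hηc
    have i23 : Integrable fun x => divForm b χ x * p x * η x + ∑ i, Z i x * p x * pd i η x :=
      i2.add i3'
    simp only [e1] at h1
    rw [integral_add i1 i23, integral_add i2 i3', integral_finsetSum _ fun i _ => i3 i] at h1
    have e2 : ∫ x, (χ x * F x - divForm b χ x * p x) * η x =
        (∫ x, F x * (χ x * η x)) - ∫ x, divForm b χ x * p x * η x := by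
      simp only [sub_mul]
      rw [integral_sub i4 i2]
      congr 2; ext x; ring
    rw [e2, ← h1]
    ring
  have hmain := kato_euclidean hb (hp χ hχ hχc hχU) (hq χ hχ hχc hχU)
    ((hF χ hχ hχc hχU).sub (hp _ hL hLc hLU)) ((hG χ hχ hχc hχU).sub (hq _ hL hLc hLU))
    (fun i => hp _ (hZ i) (hZc i) ((hZt i).trans hχU))
    (fun i => hq _ (hZ i) (hZc i) ((hZt i).trans hχU)) (key hp hF hwp) (key hq hG hwq) hφ hφc hφ0
    (fun i x hx => by simp [hZ0 i x hx]) (fun i x hx => by simp [hZ0 i x hx])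
  refine le_trans (le_of_eq ?_) (hmain.trans (le_of_eq ?_))
  · congr 1; ext x
    by_cases hx : x ∈ tsupport φ
    · simp [(hχ1 x hx).self_of_nhds, hL0 x hx]
    · simp [image_eq_zero_of_notMem_tsupport hx]
  · congr 1; ext x
    by_cases hx : x ∈ tsupport φ
    · simp [(hχ1 x hx).self_of_nhds,
        divForm_congr (hba x (hχφ hx)) (EventuallyEq.refl _ φ)]
    · rw [image_eq_zero_of_notMem_tsupport fun h => hx (tsupport_divForm_subset h),
        image_eq_zero_of_notMem_tsupport fun h => hx (tsupport_divForm_subset h)]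
      simp

end Localization

/-! ### Transition maps between charts -/

section Transition

variable {n : ℕ} {M : Type*} [TopologicalSpace M]
  {e e' : OpenPartialHomeomorph M (EuclideanSpace ℝ (Fin n))}

/-- The transition map from the chart `e` to the chart `e'`. -/
def transition (e e' : OpenPartialHomeomorph M (EuclideanSpace ℝ (Fin n))) : Eucl n → Eucl n :=
  e' ∘ e.symm

lemma transition_apply (y : Eucl n) : transition e e' y = e' (e.symm y) := rfl

/-- The domain of the transition map. -/
def overlap (e e' : OpenPartialHomeomorph M (EuclideanSpace ℝ (Fin n))) : Set (Eucl n) :=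
  e.target ∩ e.symm ⁻¹' e'.source

lemma isOpen_overlap : IsOpen (overlap e e') := e.isOpen_inter_preimage_symm e'.open_source

lemma image_transition {A : Set M} (hA : A ⊆ e.source ∩ e'.source) :
    transition e e' '' (e.target ∩ e.symm ⁻¹' A) = e'.target ∩ e'.symm ⁻¹' A := by
  ext z
  constructor
  · rintro ⟨y, ⟨hy, hyA⟩, rfl⟩
    refine ⟨e'.map_source (hA hyA).2, ?_⟩
    rw [mem_preimage, transition_apply, e'.left_inv (hA hyA).2]
    exact hyA
  · rintro ⟨hz, hzA⟩
    refine ⟨e (e'.symm z), ⟨e.map_source (hA hzA).1, ?_⟩, ?_⟩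
    · rw [mem_preimage, e.left_inv (hA hzA).1]
      exact hzA
    · rw [transition_apply, e.left_inv (hA hzA).1, e'.right_inv hz]

lemma injOn_transition : InjOn (transition e e') (overlap e e') := fun _ hy _ hz h =>
  e.symm.injOn hy.1 hz.1 (e'.injOn hy.2 hz.2 h)

lemma image_transition_overlap : transition e e' '' overlap e e' = overlap e' e := by
  have h := image_transition (e := e) (e' := e') (A := e.source ∩ e'.source) subset_rfl
  have h1 : ∀ e e' : OpenPartialHomeomorph M (EuclideanSpace ℝ (Fin n)),
      e.target ∩ e.symm ⁻¹' (e.source ∩ e'.source) = overlap e e' := fun e e' => by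
    ext y
    simp only [overlap, mem_inter_iff, mem_preimage]
    exact ⟨fun h => ⟨h.1, h.2.2⟩, fun h => ⟨h.1, e.map_target h.1, h.2⟩⟩
  rwa [h1, inter_comm e.source, h1] at h

lemma transition_transition {y : Eucl n} (hy : y ∈ overlap e e') :
    transition e' e (transition e e' y) = y := by
  rw [transition_apply, transition_apply, e'.left_inv hy.2, e.right_inv hy.1]

lemma mapsTo_transition : MapsTo (transition e e') (overlap e e') (overlap e' e) :=
  fun _ hy => image_transition_overlap (e := e) (e' := e') ▸ mem_image_of_mem _ hy

/-- The Jacobian matrix of the transition map. -/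
def jac (e e' : OpenPartialHomeomorph M (EuclideanSpace ℝ (Fin n))) (y : Eucl n) :
    Matrix (Fin n) (Fin n) ℝ :=
  Matrix.of fun k i => fderiv ℝ (transition e e') y (stdVec i) k

lemma det_jac (y : Eucl n) : (jac e e' y).det = (fderiv ℝ (transition e e') y).det := by
  rw [ContinuousLinearMap.det, ← LinearMap.det_toMatrix (EuclideanSpace.basisFun (Fin n)
    ℝ).toBasis]
  congr 1

end Transition

/-! ### The metric in coordinates and its transformation laws -/

section Gram

variable {n : ℕ} {M : Type*} [TopologicalSpace M] [ChartedSpace (EuclideanSpace ℝ (Fin n)) M]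
  [IsManifold (𝓡 n) ∞ M] {g : SmoothMetric n M}
  {e e' : OpenPartialHomeomorph M (EuclideanSpace ℝ (Fin n))}

lemma contMDiffOn_chart (he : e ∈ atlas (EuclideanSpace ℝ (Fin n)) M) :
    ContMDiffOn (𝓡 n) (𝓡 n) ∞ e e.source :=
  contMDiffOn_of_mem_maximalAtlas (IsManifold.subset_maximalAtlas he)

lemma contMDiffOn_chart_symm (he : e ∈ atlas (EuclideanSpace ℝ (Fin n)) M) :
    ContMDiffOn (𝓡 n) (𝓡 n) ∞ e.symm e.target :=
  contMDiffOn_symm_of_mem_maximalAtlas (IsManifold.subset_maximalAtlas he)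

lemma mdifferentiable_of_mem_atlas' (he : e ∈ atlas (EuclideanSpace ℝ (Fin n)) M) :
    e.MDifferentiable (𝓡 n) (𝓡 n) :=
  ⟨(contMDiffOn_chart he).mdifferentiableOn (by simp),
    (contMDiffOn_chart_symm he).mdifferentiableOn (by simp)⟩

/-- The coordinate field is the tangent map of `e.symm` applied to a constant section, so it is
smooth as a section along `e.symm`. -/
lemma contMDiffOn_coordVec (he : e ∈ atlas (EuclideanSpace ℝ (Fin n)) M) (i : Fin n) :
    ContMDiffOn (𝓡 n) ((𝓡 n).prod 𝓘(ℝ, EuclideanSpace ℝ (Fin n))) ∞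
      (fun y => Bundle.TotalSpace.mk' (EuclideanSpace ℝ (Fin n))
        (E := fun x : M => TangentSpace (𝓡 n) x) (e.symm y) (coordVec e i y)) e.target := by
  have h1 := (contMDiffOn_chart_symm he).contMDiffOn_tangentMapWithin (m := ∞) (by simp)
    e.open_target.uniqueMDiffOn
  have h2 : ContMDiffOn (𝓡 n) (𝓡 n).tangent ∞
      (fun y : Eucl n => (⟨y, stdVec i⟩ : TangentBundle (𝓡 n) (Eucl n))) e.target :=
    contMDiffOn_vectorSpace_iff_contDiffOn.2 contDiffOn_const
  refine (h1.comp h2 fun y hy => hy).congr fun y hy => ?_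
  simp only [Function.comp, tangentMapWithin]
  rw [mfderivWithin_eq_mfderiv (e.open_target.uniqueMDiffOn y hy)
    ((mdifferentiable_of_mem_atlas' he).mdifferentiableAt_symm hy)]
  rfl

lemma contDiffOn_gram (he : e ∈ atlas (EuclideanSpace ℝ (Fin n)) M) (i j : Fin n) :
    ContDiffOn ℝ ∞ (fun y => gram g e y i j) e.target := by
  have h := ContMDiffOn.clm_bundle_apply₂ (F₁ := EuclideanSpace ℝ (Fin n))
    (F₂ := EuclideanSpace ℝ (Fin n)) (F₃ := ℝ) (E₃ := Bundle.Trivial M ℝ)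
    (g.contMDiff.comp_contMDiffOn (contMDiffOn_chart_symm he))
    (contMDiffOn_coordVec he i) (contMDiffOn_coordVec he j)
  rw [← contMDiffOn_iff_contDiffOn]
  intro y hy
  exact ((Bundle.contMDiffWithinAt_totalSpace.1 (h y hy)).2 :)

/-- The metric in the chart `e`, as a bilinear form on the model space. -/
def chartForm (g : SmoothMetric n M) (e : OpenPartialHomeomorph M (EuclideanSpace ℝ (Fin n)))
    (y : Eucl n) : Eucl n →ₗ[ℝ] Eucl n →ₗ[ℝ] ℝ :=
  LinearMap.mk₂ ℝ (fun u w => g.inner (e.symm y)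
      (mfderiv (𝓡 n) (𝓡 n) e.symm y u) (mfderiv (𝓡 n) (𝓡 n) e.symm y w))
    (fun u u' w => by erw [map_add]; simp) (fun c u w => by erw [map_smul]; simp)
    (fun u w w' => by erw [map_add]; simp) (fun c u w => by erw [map_smul]; simp)

lemma gram_apply (y : Eucl n) (i j : Fin n) :
    gram g e y i j = chartForm g e y (stdVec i) (stdVec j) := rfl

lemma chartForm_symm (y u w : Eucl n) : chartForm g e y u w = chartForm g e y w u :=
  g.symm _ _ _

lemma chartForm_pos (he : e ∈ atlas (EuclideanSpace ℝ (Fin n)) M) {y : Eucl n}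
    (hy : y ∈ e.target) {u : Eucl n} (hu : u ≠ 0) : 0 < chartForm g e y u u := by
  refine g.pos _ _ fun h => hu ?_
  refine (mdifferentiable_of_mem_atlas' he).symm.mfderiv_injective hy ?_
  rw [h]
  exact (map_zero (mfderiv (𝓡 n) (𝓡 n) e.symm y)).symm

lemma contDiffOn_transition (he : e ∈ atlas (EuclideanSpace ℝ (Fin n)) M)
    (he' : e' ∈ atlas (EuclideanSpace ℝ (Fin n)) M) :
    ContDiffOn ℝ ∞ (transition e e') (overlap e e') := by
  rw [← contMDiffOn_iff_contDiffOn]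
  exact (contMDiffOn_chart he').comp ((contMDiffOn_chart_symm he).mono inter_subset_left)
    fun y hy => hy.2

lemma hasFDerivAt_transition (he : e ∈ atlas (EuclideanSpace ℝ (Fin n)) M)
    (he' : e' ∈ atlas (EuclideanSpace ℝ (Fin n)) M) {y : Eucl n} (hy : y ∈ overlap e e') :
    HasFDerivAt (transition e e') (fderiv ℝ (transition e e') y) y :=
  (((contDiffOn_transition he he').contDiffAt (isOpen_overlap.mem_nhds hy)).differentiableAt
    (by simp)).hasFDerivAt

/-- Near `y` one has `e.symm = e'.symm ∘ transition e e'`; the claim is the chain rule inserted in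
the metric. -/
lemma chartForm_change (he : e ∈ atlas (EuclideanSpace ℝ (Fin n)) M)
    (he' : e' ∈ atlas (EuclideanSpace ℝ (Fin n)) M) {y : Eucl n} (hy : y ∈ overlap e e')
    (u w : Eucl n) : chartForm g e y u w = chartForm g e' (transition e e' y)
      (fderiv ℝ (transition e e') y u) (fderiv ℝ (transition e e') y w) := by
  have hτ : transition e e' y ∈ e'.target := e'.map_source hy.2
  have hev : e.symm =ᶠ[𝓝 y] e'.symm ∘ transition e e' := by
    filter_upwards [isOpen_overlap.mem_nhds hy] with z hz
    exact (e'.left_inv hz.2).symm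
  have hd : MDifferentiableAt (𝓡 n) (𝓡 n) (transition e e') y :=
    ((contDiffOn_transition he he').contDiffAt (isOpen_overlap.mem_nhds
      hy)).contMDiffAt.mdifferentiableAt (by simp)
  have h1 := HasMFDerivAt.comp y
    ((mdifferentiable_of_mem_atlas' he').mdifferentiableAt_symm hτ).hasMFDerivAt hd.hasMFDerivAt
  have h2 := (h1.congr_of_eventuallyEq hev).mfderiv
  have h3 : ∀ u : Eucl n, (mfderiv (𝓡 n) (𝓡 n) e.symm y u : Eucl n) =
      mfderiv (𝓡 n) (𝓡 n) e'.symm (transition e e' y) (fderiv ℝ (transition e e') y u) := by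
    intro u
    have := congrArg (fun L : Eucl n →L[ℝ] Eucl n => L u) h2
    rw [← mfderiv_eq_fderiv]
    exact this
  -- Viewing the metric with values in forms on the fixed model space allows the base point to be
  -- rewritten without transport between tangent spaces.
  let G : M → Eucl n →L[ℝ] Eucl n →L[ℝ] ℝ := fun x => g.inner x
  have h4 : G (e.symm y) = G (e'.symm (transition e e' y)) := by
    rw [transition_apply, e'.left_inv hy.2]
  change G (e.symm y) (mfderiv (𝓡 n) (𝓡 n) e.symm y u : Eucl n)
    (mfderiv (𝓡 n) (𝓡 n) e.symm y w : Eucl n) = _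
  rw [h3, h3, h4]
  rfl

lemma sum_smul_stdVec (u : Eucl n) : ∑ i, u i • stdVec i = u := by
  ext j
  simp [stdVec, Pi.single_apply]

lemma chartForm_eq_sum (y u w : Eucl n) :
    chartForm g e y u w = ∑ i, u i * ∑ j, gram g e y i j * w j := by
  conv_lhs => rw [← sum_smul_stdVec u, ← sum_smul_stdVec w]
  simp only [map_sum, map_smul, LinearMap.sum_apply, LinearMap.smul_apply, smul_eq_mul,
    ← gram_apply, Finset.mul_sum]
  rw [Finset.sum_comm]
  exact Finset.sum_congr rfl fun i _ => Finset.sum_congr rfl fun j _ => by ring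

lemma posDef_gram (he : e ∈ atlas (EuclideanSpace ℝ (Fin n)) M) {y : Eucl n}
    (hy : y ∈ e.target) : (gram g e y).PosDef := by
  refine Matrix.PosDef.of_dotProduct_mulVec_pos ?_ fun ξ hξ => ?_
  · ext i j
    simp only [Matrix.conjTranspose_apply, star_trivial, gram_apply]
    exact chartForm_symm _ _ _
  · have h := chartForm_pos (g := g) he hy (u := WithLp.toLp 2 ξ) fun h => hξ (by
      simpa using congrArg (WithLp.ofLp) h)
    rw [chartForm_eq_sum] at h
    exact h

lemma gram_change (he : e ∈ atlas (EuclideanSpace ℝ (Fin n)) M)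
    (he' : e' ∈ atlas (EuclideanSpace ℝ (Fin n)) M) {y : Eucl n} (hy : y ∈ overlap e e') :
    gram g e y = (jac e e' y).transpose * gram g e' (transition e e' y) * jac e e' y := by
  ext i j
  rw [gram_apply, chartForm_change he he' hy, chartForm_eq_sum, Matrix.mul_assoc,
    Matrix.mul_apply]
  simp only [Matrix.mul_apply, Matrix.transpose_apply, jac, Matrix.of_apply]

lemma sqrtDet_pos (he : e ∈ atlas (EuclideanSpace ℝ (Fin n)) M) {y : Eucl n}
    (hy : y ∈ e.target) : 0 < sqrtDet g e y :=
  Real.sqrt_pos.2 (posDef_gram he hy).det_pos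

/-- Taking determinants in `gram_change` gives the factor `(det J)²`, whose root is the Jacobian in
the change of variables formula. -/
lemma sqrtDet_change (he : e ∈ atlas (EuclideanSpace ℝ (Fin n)) M)
    (he' : e' ∈ atlas (EuclideanSpace ℝ (Fin n)) M) {y : Eucl n} (hy : y ∈ overlap e e') :
    sqrtDet g e y = |(fderiv ℝ (transition e e') y).det| * sqrtDet g e' (transition e e' y) := by
  rw [sqrtDet, gram_change he he' hy, Matrix.det_mul, Matrix.det_mul, Matrix.det_transpose,
    ← det_jac, sqrtDet, ← Real.sqrt_sq_eq_abs, ← Real.sqrt_mul (sq_nonneg _)]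
  congr 1
  ring

lemma contDiffOn_det {m : ℕ} {U : Set (Eucl n)} {A : Eucl n → Matrix (Fin m) (Fin m) ℝ}
    (hA : ∀ i j, ContDiffOn ℝ ∞ (fun y => A y i j) U) : ContDiffOn ℝ ∞ (fun y => (A y).det) U := by
  simp only [Matrix.det_apply']
  exact ContDiffOn.sum fun σ _ => contDiffOn_const.mul (contDiffOn_prod fun i _ => hA _ _)

lemma contDiffOn_sqrtDet (he : e ∈ atlas (EuclideanSpace ℝ (Fin n)) M) :
    ContDiffOn ℝ ∞ (sqrtDet g e) e.target :=
  (contDiffOn_det (contDiffOn_gram he)).sqrt fun _ hy => (posDef_gram he hy).det_pos.ne'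

lemma aemeasurable_sqrtDet (he : e ∈ atlas (EuclideanSpace ℝ (Fin n)) M) :
    AEMeasurable (fun y => ENNReal.ofReal (sqrtDet g e y)) (volume.restrict e.target) :=
  ((contDiffOn_sqrtDet he).continuousOn.aemeasurable e.open_target.measurableSet).ennreal_ofReal

lemma contDiffOn_gram_inv (he : e ∈ atlas (EuclideanSpace ℝ (Fin n)) M) (i j : Fin n) :
    ContDiffOn ℝ ∞ (fun y => (gram g e y)⁻¹ i j) e.target := by
  simp only [Matrix.inv_def, Matrix.smul_apply, Ring.inverse_eq_inv', smul_eq_mul,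
    Matrix.adjugate_apply]
  refine ((contDiffOn_det (contDiffOn_gram he)).inv fun _ hy =>
    (posDef_gram he hy).det_pos.ne').mul (contDiffOn_det fun i' j' => ?_)
  simp only [Matrix.updateRow_apply]
  split_ifs
  · exact contDiffOn_const
  · exact contDiffOn_gram he i' j'

/-- The coefficients `√|g| g^ij` of the Laplacian in divergence form. -/
def lapCoeff (g : SmoothMetric n M) (e : OpenPartialHomeomorph M (EuclideanSpace ℝ (Fin n)))
    (y : Eucl n) : Matrix (Fin n) (Fin n) ℝ :=
  sqrtDet g e y • (gram g e y)⁻¹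

lemma contDiffOn_lapCoeff (he : e ∈ atlas (EuclideanSpace ℝ (Fin n)) M) (i j : Fin n) :
    ContDiffOn ℝ ∞ (fun y => lapCoeff g e y i j) e.target :=
  (contDiffOn_sqrtDet he).mul (contDiffOn_gram_inv he i j)

lemma lapCoeff_pos (he : e ∈ atlas (EuclideanSpace ℝ (Fin n)) M) {y : Eucl n}
    (hy : y ∈ e.target) (ξ : Fin n → ℝ) (hξ : ξ ≠ 0) :
    0 < ∑ i, ξ i * ∑ j, lapCoeff g e y i j * ξ j := by
  have h := (posDef_gram (g := g) he hy).inv.dotProduct_mulVec_pos hξ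
  have e1 : ∑ i, ξ i * ∑ j, lapCoeff g e y i j * ξ j =
      sqrtDet g e y * (star ξ ⬝ᵥ ((gram g e y)⁻¹.mulVec ξ)) := by
    simp only [dotProduct, Matrix.mulVec, lapCoeff, Matrix.smul_apply, smul_eq_mul, star_trivial,
      Finset.mul_sum]
    exact Finset.sum_congr rfl fun i _ => Finset.sum_congr rfl fun j _ => by ring
  rw [e1]
  exact mul_pos (sqrtDet_pos he hy) h

lemma laplacianInChart_eq (f : M → ℝ) (x : M) : laplacianInChart g e f x =
    (sqrtDet g e (e x))⁻¹ * divForm (lapCoeff g e) (fun y => f (e.symm y)) (e x) := by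
  rw [laplacianInChart, divForm]
  congr 1
  refine Finset.sum_congr rfl fun i _ => ?_
  simp only [pd, lapCoeff, Matrix.smul_apply, smul_eq_mul, mul_assoc, Finset.mul_sum]

end Gram

/-! ### The Riemannian measure in charts -/

section RiemannianMeasure

variable {n : ℕ} {M : Type*} [TopologicalSpace M] [ChartedSpace (EuclideanSpace ℝ (Fin n)) M]
  [IsManifold (𝓡 n) ∞ M] [MeasurableSpace M] [BorelSpace M] {g : SmoothMetric n M}
  {e e' : OpenPartialHomeomorph M (EuclideanSpace ℝ (Fin n))}

lemma measurableSet_target_inter_preimage {M : Type*} [TopologicalSpace M] [MeasurableSpace M]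
    [BorelSpace M] (e : OpenPartialHomeomorph M (EuclideanSpace ℝ (Fin n))) {A : Set M}
    (hA : MeasurableSet A) : MeasurableSet (e.target ∩ e.symm ⁻¹' A) := by
  have h := (continuousOn_iff_continuous_domRestrict.1 e.continuousOn_symm).measurable hA
  have h' := e.open_target.measurableSet.subtype_image h
  convert! h' using 1
  ext y
  simp [and_comm]

lemma aemeasurable_chart_symm {M : Type*} [TopologicalSpace M] [MeasurableSpace M]
    [BorelSpace M] {e : OpenPartialHomeomorph M (EuclideanSpace ℝ (Fin n))} (μ : Measure (Eucl n)) :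
    AEMeasurable e.symm (μ.restrict e.target) :=
  e.continuousOn_symm.aemeasurable e.open_target.measurableSet

lemma chartVolume_apply {A : Set M} (hA : MeasurableSet A) :
    chartVolume g e A = ∫⁻ y in e.target ∩ e.symm ⁻¹' A, ENNReal.ofReal (sqrtDet g e y) := by
  have hm := measurableSet_target_inter_preimage e hA
  rw [chartVolume, ← restrict_withDensity e.open_target.measurableSet,
    Measure.map_apply_of_aemeasurable (aemeasurable_chart_symm _) hA,
    Measure.restrict_apply' e.open_target.measurableSet, inter_comm, withDensity_apply _ hm]

lemma chartVolume_inter_source {A : Set M} (hA : MeasurableSet A) :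
    chartVolume g e (A ∩ e.source) = chartVolume g e A := by
  rw [chartVolume_apply hA, chartVolume_apply (hA.inter e.open_source.measurableSet)]
  congr 2
  ext y
  simp only [mem_inter_iff, mem_preimage, and_congr_right_iff, and_iff_left_iff_imp]
  exact fun hy _ => e.map_target hy

/-- The Riemannian volumes of two charts agree on the intersection of their domains. -/
lemma chartVolume_congr (he : e ∈ atlas (EuclideanSpace ℝ (Fin n)) M)
    (he' : e' ∈ atlas (EuclideanSpace ℝ (Fin n)) M) {A : Set M} (hA : MeasurableSet A)
    (hAs : A ⊆ e.source ∩ e'.source) : chartVolume g e A = chartVolume g e' A := by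
  have hsub : e.target ∩ e.symm ⁻¹' A ⊆ overlap e e' := fun y hy => ⟨hy.1, (hAs hy.2).2⟩
  rw [chartVolume_apply hA, chartVolume_apply hA, ← image_transition hAs,
    lintegral_image_eq_lintegral_abs_det_fderiv_mul volume
      (measurableSet_target_inter_preimage e hA)
      (fun y hy => (hasFDerivAt_transition he he' (hsub hy)).hasFDerivWithinAt)
      (injOn_transition.mono hsub)]
  refine setLIntegral_congr_fun (measurableSet_target_inter_preimage e hA) fun y hy => ?_
  rw [sqrtDet_change he he' (hsub hy), ENNReal.ofReal_mul (abs_nonneg _)]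

/-- On the domain of a chart, the Riemannian measure is the Riemannian volume of the chart. -/
lemma riemannianMeasure_restrict (he : e ∈ atlas (EuclideanSpace ℝ (Fin n)) M) :
    (riemannianMeasure g).restrict e.source = chartVolume g e := by
  have hs : MeasurableSet e.source := e.open_source.measurableSet
  have hle : ∀ e' ∈ atlas (EuclideanSpace ℝ (Fin n)) M, chartVolume g e' ≤ riemannianMeasure g :=
    fun e' he' => le_iSup₂ (f := fun e (_ : e ∈ atlas (EuclideanSpace ℝ (Fin n)) M) =>
      chartVolume g e) e' he'
  -- It suffices to bound each chart volume. Split a set along `e.source`: inside, the chart volume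
  -- agrees with that of `e` on the overlap; outside, it is at most the Riemannian measure.
  have hup : riemannianMeasure g ≤
      chartVolume g e + (riemannianMeasure g).restrict e.sourceᶜ := by
    refine iSup₂_le fun e' he' => Measure.le_intro fun A hA _ => ?_
    rw [Measure.add_apply, Measure.restrict_apply hA, ← measure_inter_add_sdiff A hs]
    refine add_le_add ?_ (hle e' he' _)
    rw [← chartVolume_inter_source (hA.inter hs), ← chartVolume_congr he he'
      ((hA.inter hs).inter e'.open_source.measurableSet) fun x hx => ⟨hx.1.2, hx.2⟩]
    exact measure_mono fun x hx => hx.1.1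
  refine Measure.ext fun A hA => ?_
  rw [Measure.restrict_apply hA]
  refine le_antisymm ?_ ?_
  · refine (hup _).trans (le_of_eq ?_)
    rw [Measure.add_apply, Measure.restrict_apply (hA.inter hs), inter_assoc, inter_compl_self,
      inter_empty, measure_empty, add_zero, chartVolume_inter_source hA]
  · rw [← chartVolume_inter_source hA]
    exact hle e he _

variable {F : Type*} [NormedAddCommGroup F] [NormedSpace ℝ F] {f : M → F}

lemma setIntegral_chart (he : e ∈ atlas (EuclideanSpace ℝ (Fin n)) M)
    (hf : AEStronglyMeasurable f (riemannianMeasure g)) :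
    ∫ x in e.source, f x ∂(riemannianMeasure g) =
      ∫ y in e.target, sqrtDet g e y • f (e.symm y) := by
  have hf' := hf.restrict (s := e.source)
  have hm : AEMeasurable e.symm ((volume.restrict e.target).withDensity
      fun y => ENNReal.ofReal (sqrtDet g e y)) := by
    rw [← restrict_withDensity e.open_target.measurableSet]
    exact aemeasurable_chart_symm _
  rw [riemannianMeasure_restrict he, chartVolume] at hf' ⊢
  rw [integral_map hm hf', integral_withDensity_eq_integral_toReal_smul₀ (aemeasurable_sqrtDet he)
    (Eventually.of_forall fun _ => ENNReal.ofReal_lt_top)]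
  simp [ENNReal.toReal_ofReal, sqrtDet]

lemma integrableOn_chart (he : e ∈ atlas (EuclideanSpace ℝ (Fin n)) M)
    (hf : Integrable f (riemannianMeasure g)) :
    IntegrableOn (fun y => sqrtDet g e y • f (e.symm y)) e.target := by
  have hf' := hf.integrableOn (s := e.source)
  have hm : AEMeasurable e.symm ((volume.restrict e.target).withDensity
      fun y => ENNReal.ofReal (sqrtDet g e y)) := by
    rw [← restrict_withDensity e.open_target.measurableSet]
    exact aemeasurable_chart_symm _
  rw [IntegrableOn, riemannianMeasure_restrict he, chartVolume] at hf'
  rw [integrable_map_measure hf'.1 hm, integrable_withDensity_iff_integrable_smul₀'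
    (aemeasurable_sqrtDet he) (Eventually.of_forall fun _ => ENNReal.ofReal_lt_top)] at hf'
  simpa [IntegrableOn, ENNReal.toReal_ofReal, sqrtDet, Function.comp_def] using hf'

end RiemannianMeasure

/-! ### Transport of test functions -/

section Transfer

variable {n : ℕ} {X Y : Type*} [TopologicalSpace X] [ChartedSpace (EuclideanSpace ℝ (Fin n)) X]
  [TopologicalSpace Y] [ChartedSpace (EuclideanSpace ℝ (Fin n)) Y] [T2Space Y]
  {U : Set X} {V : Set Y} {σ : Y → X} {τ : X → Y} {φ : X → ℝ}

/-- Test functions are transported by diffeomorphisms between open sets. -/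
lemma tsupport_indicator_comp_subset (hφc : HasCompactSupport φ) (hφU : tsupport φ ⊆ U)
    (hτ : ContinuousOn τ U) (hστ : ∀ y ∈ V, τ (σ y) = y) :
    tsupport (V.indicator (φ ∘ σ)) ⊆ τ '' tsupport φ := by
  refine closure_minimal (fun y hy => ?_)
    (hφc.isCompact.image_of_continuousOn (hτ.mono hφU)).isClosed
  obtain ⟨hyV, hy0⟩ : y ∈ V ∩ Function.support (φ ∘ σ) := by
    rwa [← support_indicator]
  exact ⟨σ y, subset_tsupport _ hy0, hστ y hyV⟩

/-- Extension by zero stays smooth: the support lies in the compact image of `tsupport φ`, closed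
because `Y` is Hausdorff and contained in the open set `V`. -/
lemma isTestFunction_indicator_comp (hφ : IsTestFunction n φ) (hφU : tsupport φ ⊆ U)
    (hV : IsOpen V) (hσ : ContMDiffOn (𝓡 n) (𝓡 n) ∞ σ V) (hτ : ContinuousOn τ U)
    (hτUV : MapsTo τ U V) (hστ : ∀ y ∈ V, τ (σ y) = y) :
    IsTestFunction n (V.indicator (φ ∘ σ)) := by
  have hK := hφ.2.isCompact.image_of_continuousOn (hτ.mono hφU)
  have hsub := tsupport_indicator_comp_subset (Y := Y) hφ.2 hφU hτ hστ
  refine ⟨fun y => ?_, hK.of_isClosed_subset (isClosed_tsupport _) hsub⟩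
  by_cases hy : y ∈ V
  · refine ((hφ.1.comp_contMDiffOn hσ).contMDiffAt (hV.mem_nhds hy)).congr_of_eventuallyEq ?_
    filter_upwards [hV.mem_nhds hy] with z hz using indicator_of_mem hz _
  · have h : y ∉ tsupport (V.indicator (φ ∘ σ)) := fun h => by
      obtain ⟨x, hx, rfl⟩ := hsub h
      exact hy (hτUV (hφU hx))
    exact contMDiffAt_const.congr_of_eventuallyEq (notMem_tsupport_iff_eventuallyEq.1 h)

end Transfer

lemma isTestFunction_iff {n : ℕ} {η : Eucl n → ℝ} :
    IsTestFunction n η ↔ ContDiff ℝ ∞ η ∧ HasCompactSupport η := by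
  rw [IsTestFunction, contMDiff_iff_contDiff]

/-! ### Independence of the Laplacian from the chart -/

section ChartInvariance

variable {n : ℕ} {M : Type*} [TopologicalSpace M] [ChartedSpace (EuclideanSpace ℝ (Fin n)) M]
  [IsManifold (𝓡 n) ∞ M] {g : SmoothMetric n M}
  {e e' : OpenPartialHomeomorph M (EuclideanSpace ℝ (Fin n))}

lemma pd_comp_transition (he : e ∈ atlas (EuclideanSpace ℝ (Fin n)) M)
    (he' : e' ∈ atlas (EuclideanSpace ℝ (Fin n)) M) {y : Eucl n} (hy : y ∈ overlap e e')
    {u v : Eucl n → ℝ} (huv : u =ᶠ[𝓝 y] v ∘ transition e e')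
    (hv : DifferentiableAt ℝ v (transition e e' y)) (i : Fin n) :
    pd i u y = ((jac e e' y).transpose.mulVec fun k => pd k v (transition e e' y)) i := by
  have h := ((hv.hasFDerivAt.comp y (hasFDerivAt_transition he he' hy)).congr_of_eventuallyEq
    huv).fderiv
  rw [pd, h, ContinuousLinearMap.comp_apply, ← sum_smul_stdVec (fderiv ℝ (transition e e') y _)]
  simp [Matrix.mulVec, dotProduct, jac, pd]

/-- From `G = Jᵀ G' J` with `J` invertible, `J G⁻¹ Jᵀ = G'⁻¹`; the densities contribute `|det J|`.
-/
lemma lapCoeff_change (he : e ∈ atlas (EuclideanSpace ℝ (Fin n)) M)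
    (he' : e' ∈ atlas (EuclideanSpace ℝ (Fin n)) M) {y : Eucl n} (hy : y ∈ overlap e e') :
    jac e e' y * lapCoeff g e y * (jac e e' y).transpose =
      |(fderiv ℝ (transition e e') y).det| • lapCoeff g e' (transition e e' y) := by
  have hJ : IsUnit (jac e e' y).det := by
    refine isUnit_iff_ne_zero.2 fun h => (posDef_gram (g := g) he hy.1).det_pos.ne' ?_
    rw [gram_change he he' hy, Matrix.det_mul, h, mul_zero]
  have hJ' : IsUnit (jac e e' y).transpose.det := by rwa [Matrix.det_transpose]
  rw [lapCoeff, lapCoeff, sqrtDet_change he he' hy, gram_change he he' hy, Matrix.mul_inv_rev,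
    Matrix.mul_inv_rev, smul_smul, Matrix.mul_smul, Matrix.smul_mul]
  congr 1
  rw [Matrix.mul_nonsing_inv_cancel_left _ _ hJ, Matrix.mul_assoc, Matrix.nonsing_inv_mul _ hJ',
    Matrix.mul_one]

lemma sum_pd_mul_eq_dotProduct (a : Matrix (Fin n) (Fin n) ℝ) (η u : Eucl n → ℝ) (y : Eucl n) :
    ∑ i, pd i η y * ∑ j, a i j * pd j u y =
      (fun i => pd i η y) ⬝ᵥ a.mulVec fun j => pd j u y := rfl

/-- Gradients transform by `Jᵀ`, so `lapCoeff_change` leaves exactly the factor needed for the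
Dirichlet integrals in the two charts to agree. -/
lemma dirichlet_change (he : e ∈ atlas (EuclideanSpace ℝ (Fin n)) M)
    (he' : e' ∈ atlas (EuclideanSpace ℝ (Fin n)) M) {y : Eucl n} (hy : y ∈ overlap e e')
    {η η' u v : Eucl n → ℝ} (hη : η =ᶠ[𝓝 y] η' ∘ transition e e')
    (hη' : DifferentiableAt ℝ η' (transition e e' y)) (huv : u =ᶠ[𝓝 y] v ∘ transition e e')
    (hv : DifferentiableAt ℝ v (transition e e' y)) :
    ∑ i, pd i η y * ∑ j, lapCoeff g e y i j * pd j u y =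
      |(fderiv ℝ (transition e e') y).det| * ∑ i, pd i η' (transition e e' y) *
        ∑ j, lapCoeff g e' (transition e e' y) i j * pd j v (transition e e' y) := by
  rw [sum_pd_mul_eq_dotProduct, sum_pd_mul_eq_dotProduct,
    funext fun i => pd_comp_transition he he' hy hη hη' i,
    funext fun i => pd_comp_transition he he' hy huv hv i, ← smul_eq_mul, ← dotProduct_smul,
    ← Matrix.smul_mulVec, ← lapCoeff_change he he' hy, Matrix.mulVec_transpose,
    ← Matrix.dotProduct_mulVec, Matrix.mulVec_mulVec, Matrix.mulVec_mulVec, Matrix.mul_assoc]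

/-- The divergence form of the Laplacian does not depend on the chart. -/
lemma divForm_lapCoeff_change (he : e ∈ atlas (EuclideanSpace ℝ (Fin n)) M)
    (he' : e' ∈ atlas (EuclideanSpace ℝ (Fin n)) M) {u v : Eucl n → ℝ}
    (hv : ContDiffOn ℝ ∞ v (overlap e' e))
    (huv : EqOn u (v ∘ transition e e') (overlap e e')) {y : Eucl n} (hy : y ∈ overlap e e') :
    (sqrtDet g e y)⁻¹ * divForm (lapCoeff g e) u y = (sqrtDet g e' (transition e e' y))⁻¹ *
      divForm (lapCoeff g e') v (transition e e' y) := by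
  set τ := transition e e' with hτ
  have hO : IsOpen (overlap e e') := isOpen_overlap
  have hO' : IsOpen (overlap e' e) := isOpen_overlap
  have hτs : ContDiffOn ℝ ∞ τ (overlap e e') := contDiffOn_transition he he'
  have hτs' : ContDiffOn ℝ ∞ (transition e' e) (overlap e' e) := contDiffOn_transition he' he
  have hu : ContDiffOn ℝ ∞ u (overlap e e') := (hv.comp hτs mapsTo_transition).congr huv
  have ha : ∀ i j, ContDiffOn ℝ ∞ (fun y => lapCoeff g e y i j) (overlap e e') := fun i j =>
    (contDiffOn_lapCoeff he i j).mono inter_subset_left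
  have ha' : ∀ i j, ContDiffOn ℝ ∞ (fun y => lapCoeff g e' y i j) (overlap e' e) := fun i j =>
    (contDiffOn_lapCoeff he' i j).mono inter_subset_left
  -- This equals the Jacobian `|det Dτ|` on the overlap; written as a quotient of densities, it is
  -- visibly continuous.
  let r : Eucl n → ℝ := fun y => sqrtDet g e y * (sqrtDet g e' (τ y))⁻¹
  have hr : ∀ y ∈ overlap e e', r y = |(fderiv ℝ τ y).det| := fun y hy => by
    have h := sqrtDet_pos (g := g) he' (e'.map_source hy.2)
    simp only [r]
    rw [sqrtDet_change he he' hy, mul_inv_cancel_right₀ (by exact h.ne')]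
  let D : Eucl n → ℝ := fun y => divForm (lapCoeff g e) u y - r y * divForm (lapCoeff g e') v (τ y)
  have hrc : ContinuousOn r (overlap e e') :=
    ((contDiffOn_sqrtDet he).continuousOn.mono inter_subset_left).mul
      (((contDiffOn_sqrtDet he').continuousOn.comp hτs.continuousOn
        fun y hy => e'.map_source hy.2).inv₀ fun y hy =>
          (sqrtDet_pos he' (e'.map_source hy.2)).ne')
  have hD1 : ContinuousOn (divForm (lapCoeff g e) u) (overlap e e') :=
    (contDiffOn_divForm ha hO hu).continuousOn
  have hD2 : ContinuousOn (fun y => r y * divForm (lapCoeff g e') v (τ y)) (overlap e e') :=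
    hrc.mul ((contDiffOn_divForm ha' hO' hv).continuousOn.comp hτs.continuousOn mapsTo_transition)
  have hDc : ContinuousOn D (overlap e e') := hD1.sub hD2
  have hcov : ∀ f : Eucl n → ℝ, ∫ z in overlap e' e, f z =
      ∫ y in overlap e e', |(fderiv ℝ τ y).det| * f (τ y) := fun f => by
    rw [← image_transition_overlap, integral_image_eq_integral_abs_det_fderiv_smul volume
      hO.measurableSet (fun y hy => (hasFDerivAt_transition he he' hy).hasFDerivWithinAt)
      injOn_transition]
    rfl
  -- Fundamental lemma of the calculus of variations: integrated against any test function, both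
  -- terms of `D` reduce by parts to the same Dirichlet integral.
  have hzero : ∀ᵐ y, y ∈ overlap e e' → D y = 0 := by
    refine hO.ae_eq_zero_of_integral_contDiff_smul_eq_zero
      (hDc.locallyIntegrableOn hO.measurableSet) fun η hη hηc hηU => ?_
    let η' : Eucl n → ℝ := (overlap e' e).indicator (η ∘ transition e' e)
    have ht : ContDiff ℝ ∞ η' ∧ HasCompactSupport η' :=
      isTestFunction_iff.1 (isTestFunction_indicator_comp
      (isTestFunction_iff.2 ⟨hη, hηc⟩) hηU hO' (contMDiffOn_iff_contDiffOn.2 hτs')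
      hτs.continuousOn mapsTo_transition fun z hz => transition_transition hz)
    have hη'U : tsupport η' ⊆ overlap e' e :=
      (tsupport_indicator_comp_subset hηc hηU hτs.continuousOn fun z hz =>
        transition_transition hz).trans
        ((image_mono hηU).trans image_transition_overlap.subset)
    have hηη' : ∀ y ∈ overlap e e', η' (τ y) = η y := fun y hy => by
      simp only [η']
      rw [indicator_of_mem (mapsTo_transition hy), Function.comp_apply, transition_transition hy]
    have hset : ∀ {f h : Eucl n → ℝ} {O : Set (Eucl n)}, (∀ y ∉ tsupport h, f y = 0) →
        tsupport h ⊆ O → ∫ y, f y = ∫ y in O, f y := fun hf hO =>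
      (setIntegral_eq_integral_of_forall_compl_eq_zero fun y hy => hf y fun h => hy (hO h)).symm
    have h1 := integral_mul_divForm ha hO hη hηc hηU hu
    have h2 := integral_mul_divForm ha' hO' ht.1 ht.2 hη'U hv
    have d1 : ∫ y in overlap e e', ∑ i, pd i η y * ∑ j, lapCoeff g e y i j * pd j u y =
        ∫ y, ∑ i, pd i η y * ∑ j, lapCoeff g e y i j * pd j u y :=
      (hset (h := η) (fun y hy => by simp [pd_eq_zero_of_notMem_tsupport hy]) hηU).symm
    have d2 : ∫ y in overlap e' e, ∑ i, pd i η' y * ∑ j, lapCoeff g e' y i j * pd j v y =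
        ∫ y, ∑ i, pd i η' y * ∑ j, lapCoeff g e' y i j * pd j v y :=
      (hset (h := η') (fun y hy => by simp [pd_eq_zero_of_notMem_tsupport hy]) hη'U).symm
    have d3 : ∫ y in overlap e' e, η' y * divForm (lapCoeff g e') v y =
        ∫ y, η' y * divForm (lapCoeff g e') v y :=
      (hset (h := η') (fun y hy => by
        rw [image_eq_zero_of_notMem_tsupport hy, zero_mul]) hη'U).symm
    rw [← d1] at h1
    rw [← d2, ← d3, hcov, hcov] at h2
    have h3 : ∫ y in overlap e e', |(fderiv ℝ τ y).det| * (η' (τ y) *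
        divForm (lapCoeff g e') v (τ y)) =
        ∫ y, η y * (r y * divForm (lapCoeff g e') v (τ y)) := by
      rw [hset (h := η) (fun y hy => by
        rw [image_eq_zero_of_notMem_tsupport hy, zero_mul]) hηU]
      refine setIntegral_congr_fun hO.measurableSet fun y hy => ?_
      rw [hηη' y hy, hr y hy]
      ring
    have h4 : ∫ y in overlap e e', ∑ i, pd i η y * ∑ j, lapCoeff g e y i j * pd j u y =
        ∫ y in overlap e e', |(fderiv ℝ τ y).det| * ∑ i, pd i η' (τ y) *
          ∑ j, lapCoeff g e' (τ y) i j * pd j v (τ y) := by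
      refine setIntegral_congr_fun hO.measurableSet fun y hy => ?_
      refine dirichlet_change he he' hy ?_ (ContDiff.diffAt ht.1) ?_
        (ContDiffOn.diffAt hv hO' (mapsTo_transition hy))
      · filter_upwards [hO.mem_nhds hy] with z hz using (hηη' z hz).symm
      · filter_upwards [hO.mem_nhds hy] with z hz using huv hz
    rw [h3, ← h4] at h2
    have i1 : Integrable fun y => η y * divForm (lapCoeff g e) u y :=
      (continuous_mul_of_tsupport_subset hO hη.continuous hηU
        hD1).integrable_of_hasCompactSupport hηc.mul_right
    have i2 : Integrable fun y => η y * (r y * divForm (lapCoeff g e') v (τ y)) :=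
      (continuous_mul_of_tsupport_subset hO hη.continuous hηU
        hD2).integrable_of_hasCompactSupport hηc.mul_right
    simp only [D, smul_eq_mul, mul_sub]
    rw [integral_sub i1 i2, h1, h2, sub_self]
  -- Continuity of `D` upgrades vanishing almost everywhere to vanishing everywhere.
  have hEq : EqOn D 0 (overlap e e') :=
    Measure.eqOn_open_of_ae_eq ((ae_restrict_iff' hO.measurableSet).2 hzero) hO hDc
      continuousOn_const
  have h := hEq hy
  simp only [D, r, Pi.zero_apply, sub_eq_zero] at h
  rw [h, mul_assoc, inv_mul_cancel_left₀ (sqrtDet_pos he hy.1).ne']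

end ChartInvariance

lemma divForm_sum {n : ℕ} {U : Set (Eucl n)} {a : Eucl n → Matrix (Fin n) (Fin n) ℝ}
    (ha : ∀ i j, ContDiffOn ℝ ∞ (fun y => a y i j) U) (hU : IsOpen U) {ι : Type*} {s : Finset ι}
    {f : ι → Eucl n → ℝ} (hf : ∀ k ∈ s, ContDiffOn ℝ ∞ (f k) U) {x : Eucl n} (hx : x ∈ U) :
    divForm a (fun y => ∑ k ∈ s, f k y) x = ∑ k ∈ s, divForm a (f k) x := by
  have h : ∀ i, pd i (fun y => ∑ j, a y i j * pd j (fun y => ∑ k ∈ s, f k y) y) x =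
      ∑ k ∈ s, pd i (fun y => ∑ j, a y i j * pd j (f k) y) x := fun i => by
    rw [← pd_sum fun k hk => ContDiffOn.diffAt (contDiffOn_flux ha hU (hf k hk)) hU hx]
    refine pd_congr ?_
    filter_upwards [hU.mem_nhds hx] with y hy
    rw [Finset.sum_comm]
    refine Finset.sum_congr rfl fun j _ => ?_
    rw [pd_sum fun k hk => ContDiffOn.diffAt (hf k hk) hU hy, Finset.mul_sum]
  simp only [divForm, h]
  exact Finset.sum_comm

/-! ### The global Laplace–Beltrami operator on test functions -/

section LaplaceBeltrami

variable {n : ℕ} {M : Type*} [TopologicalSpace M] [ChartedSpace (EuclideanSpace ℝ (Fin n)) M]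
  [IsManifold (𝓡 n) ∞ M] {g : SmoothMetric n M}
  {e : OpenPartialHomeomorph M (EuclideanSpace ℝ (Fin n))} {φ : M → ℝ}

lemma contDiffOn_comp_chart_symm (hφ : ContMDiff (𝓡 n) 𝓘(ℝ, ℝ) ∞ φ)
    (he : e ∈ atlas (EuclideanSpace ℝ (Fin n)) M) :
    ContDiffOn ℝ ∞ (fun y => φ (e.symm y)) e.target :=
  contMDiffOn_iff_contDiffOn.1 (hφ.comp_contMDiffOn (contMDiffOn_chart_symm he))

/-- The Laplace–Beltrami operator can be computed in any chart. -/
lemma laplaceBeltrami_eq (hφ : ContMDiff (𝓡 n) 𝓘(ℝ, ℝ) ∞ φ)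
    (he : e ∈ atlas (EuclideanSpace ℝ (Fin n)) M) {x : M} (hx : x ∈ e.source) :
    laplaceBeltrami g φ x =
      (sqrtDet g e (e x))⁻¹ * divForm (lapCoeff g e) (fun y => φ (e.symm y)) (e x) := by
  have hx' := mem_chart_source (EuclideanSpace ℝ (Fin n)) x
  set e₀ := chartAt (EuclideanSpace ℝ (Fin n)) x with he₀
  have hO : e₀ x ∈ overlap e₀ e := ⟨e₀.map_source hx', by rwa [mem_preimage, e₀.left_inv hx']⟩
  rw [laplaceBeltrami, ← he₀, laplacianInChart_eq, divForm_lapCoeff_change (chart_mem_atlas _ x) he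
    (v := fun y => φ (e.symm y)) ((contDiffOn_comp_chart_symm hφ he).mono inter_subset_left)
    (fun y hy => by simp only [Function.comp, transition_apply, e.left_inv hy.2]; rfl) hO,
    transition_apply, e₀.left_inv hx']

lemma laplaceBeltrami_chart_symm (hφ : ContMDiff (𝓡 n) 𝓘(ℝ, ℝ) ∞ φ)
    (he : e ∈ atlas (EuclideanSpace ℝ (Fin n)) M) {y : Eucl n} (hy : y ∈ e.target) :
    sqrtDet g e y * laplaceBeltrami g φ (e.symm y) =
      divForm (lapCoeff g e) (fun y => φ (e.symm y)) y := by
  rw [laplaceBeltrami_eq hφ he (e.map_target hy), e.right_inv hy,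
    mul_inv_cancel_left₀ (sqrtDet_pos he hy).ne']

lemma continuous_laplaceBeltrami (hφ : ContMDiff (𝓡 n) 𝓘(ℝ, ℝ) ∞ φ) :
    Continuous (laplaceBeltrami g φ) := by
  refine continuous_iff_continuousAt.2 fun x => ?_
  have hx := mem_chart_source (EuclideanSpace ℝ (Fin n)) x
  have he := chart_mem_atlas (EuclideanSpace ℝ (Fin n)) x
  have h : ContinuousOn (fun y => (sqrtDet g (chartAt (EuclideanSpace ℝ (Fin n)) x) y)⁻¹ *
      divForm (lapCoeff g (chartAt (EuclideanSpace ℝ (Fin n)) x))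
        (fun y => φ ((chartAt (EuclideanSpace ℝ (Fin n)) x).symm y)) y)
      (chartAt (EuclideanSpace ℝ (Fin n)) x).target :=
    ((contDiffOn_sqrtDet he).continuousOn.inv₀ fun y hy => (sqrtDet_pos he hy).ne').mul
      (contDiffOn_divForm (contDiffOn_lapCoeff he) (OpenPartialHomeomorph.open_target _)
        (contDiffOn_comp_chart_symm hφ he)).continuousOn
  refine ((h.comp (OpenPartialHomeomorph.continuousOn _) fun z hz =>
    OpenPartialHomeomorph.map_source _ hz).congr fun z hz =>
      laplaceBeltrami_eq hφ he hz).continuousAt ((OpenPartialHomeomorph.open_source _).mem_nhds hx)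

lemma laplaceBeltrami_eq_zero {x : M} (hx : x ∉ tsupport φ) : laplaceBeltrami g φ x = 0 := by
  have hx' := mem_chart_source (EuclideanSpace ℝ (Fin n)) x
  rw [laplaceBeltrami, laplacianInChart_eq]
  have h : (fun y => φ ((chartAt (EuclideanSpace ℝ (Fin n)) x).symm y)) =ᶠ[𝓝
      (chartAt (EuclideanSpace ℝ (Fin n)) x x)] fun _ => 0 :=
    (OpenPartialHomeomorph.tendsto_symm _ hx').eventually
      (notMem_tsupport_iff_eventuallyEq.1 hx)
  rw [divForm_congr (EventuallyEq.refl _ _) h]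
  simp [divForm, pd]

lemma tsupport_laplaceBeltrami_subset : tsupport (laplaceBeltrami g φ) ⊆ tsupport φ :=
  closure_minimal (fun x hx => by
    by_contra h
    exact hx (laplaceBeltrami_eq_zero h)) (isClosed_tsupport φ)

lemma HasCompactSupport.laplaceBeltrami (hφ : HasCompactSupport φ) :
    HasCompactSupport (laplaceBeltrami g φ) :=
  hφ.of_isClosed_subset (isClosed_tsupport _) tsupport_laplaceBeltrami_subset

lemma laplaceBeltrami_sum {ι : Type*} {s : Finset ι} {φ : ι → M → ℝ}
    (hφ : ∀ k ∈ s, ContMDiff (𝓡 n) 𝓘(ℝ, ℝ) ∞ (φ k)) (x : M) :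
    laplaceBeltrami g (fun x => ∑ k ∈ s, φ k x) x = ∑ k ∈ s, laplaceBeltrami g (φ k) x := by
  have he := chart_mem_atlas (EuclideanSpace ℝ (Fin n)) x
  simp only [laplaceBeltrami, laplacianInChart_eq, ← Finset.mul_sum]
  rw [divForm_sum (contDiffOn_lapCoeff he) (OpenPartialHomeomorph.open_target _)
    (fun k hk => contDiffOn_comp_chart_symm (hφ k hk) he)
    (OpenPartialHomeomorph.map_source _ (mem_chart_source _ x))]

/-- A test function is a finite sum of test functions supported in domains of charts. -/
lemma exists_sum_testFunction [T2Space M] [SigmaCompactSpace M]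
    (hφ : IsTestFunction n φ) (hφ0 : ∀ x, 0 ≤ φ x) :
    ∃ (s : Finset M) (φ' : M → M → ℝ), (∀ c, IsTestFunction n (φ' c)) ∧ (∀ c x, 0 ≤ φ' c x) ∧
      (∀ c, tsupport (φ' c) ⊆ (chartAt (EuclideanSpace ℝ (Fin n)) c).source) ∧
      φ = fun x => ∑ c ∈ s, φ' c x := by
  obtain ⟨θ, hθ⟩ := SmoothPartitionOfUnity.exists_isSubordinate_chartAt_source (𝓡 n) M
  -- Local finiteness leaves only finitely many members of the partition meeting the support of `φ`.
  have hfin := θ.locallyFinite.finite_nonempty_inter_compact hφ.2.isCompact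
  refine ⟨hfin.toFinset, fun c x => θ c x * φ x, fun c => ⟨(θ c).contMDiff.mul hφ.1,
    hφ.2.mul_left⟩, fun c x => mul_nonneg (θ.nonneg c x) (hφ0 x),
    fun c => (tsupport_mul_subset_left).trans (hθ c), ?_⟩
  ext x
  rw [← Finset.sum_mul]
  by_cases hx : x ∈ tsupport φ
  · rw [← finsum_eq_sum_of_support_subset, θ.sum_eq_one (mem_univ x), one_mul]
    intro c hc
    simp only [Finite.coe_toFinset]
    exact ⟨x, hc, hx⟩
  · rw [image_eq_zero_of_notMem_tsupport hx, mul_zero]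

end LaplaceBeltrami

/-- No case distinction is left in the result: at `z = 0` the convention `0 / 0 = 0` agrees with
`sgn 0 = 0`. -/
lemma re_sgn_mul (z w : ℂ) : (sgn z * w).re = (z.re * w.re + z.im * w.im) / ‖z‖ := by
  rw [sgn]
  split_ifs with h
  · simp [h]
  · have e1 : conj z / (‖z‖ : ℂ) * w = conj z * w / (‖z‖ : ℂ) := by ring
    rw [e1, Complex.div_ofReal_re]
    simp

lemma norm_sgn_le (z : ℂ) : ‖sgn z‖ ≤ 1 := by
  rw [sgn]
  split_ifs with h
  · simp
  · simp [h]

lemma measurable_sgn : Measurable sgn :=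
  Measurable.ite (measurableSet_singleton 0) measurable_const
    ((Complex.continuous_conj.measurable).div
      (Complex.continuous_ofReal.measurable.comp measurable_norm))

lemma integral_mul_congr {α : Type*} [MeasurableSpace α] {μ : Measure α} {𝕜 : Type*} [RCLike 𝕜]
    {u v h : α → 𝕜} (huv : u =ᵐ[μ] v) : ∫ x, u x * h x ∂μ = ∫ x, v x * h x ∂μ :=
  integral_congr_ae (by filter_upwards [huv] with x hx; rw [hx])

/-! ### Reduction of the theorem to a single chart -/

section ChartReduction

variable {n : ℕ} {M : Type*} [TopologicalSpace M] [ChartedSpace (EuclideanSpace ℝ (Fin n)) M]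
  [IsManifold (𝓡 n) ∞ M] [MeasurableSpace M] [BorelSpace M] {g : SmoothMetric n M}
  {e : OpenPartialHomeomorph M (EuclideanSpace ℝ (Fin n))}

lemma isL2loc_chart (he : e ∈ atlas (EuclideanSpace ℝ (Fin n)) M) {u : M → ℝ} (hum : Measurable u)
    (hu : Integrable (fun x => u x ^ 2) (riemannianMeasure g)) {ρ : Eucl n → ℝ}
    (hρ : ContinuousOn ρ e.target) :
    IsL2loc e.target (e.target.indicator fun y => ρ y * u (e.symm y)) := by
  intro χ hχ hχc hχU
  have hm : Measurable (e.target.indicator fun y => ρ y * u (e.symm y)) := by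
    refine measurable_of_restrict_of_restrict_compl e.open_target.measurableSet ?_ ?_
    · have h1 : Measurable (e.target.domRestrict ρ) :=
        (continuousOn_iff_continuous_domRestrict.1 hρ).measurable
      have h2 : Measurable (e.target.domRestrict e.symm) :=
        (continuousOn_iff_continuous_domRestrict.1 e.continuousOn_symm).measurable
      convert! h1.mul (hum.comp h2) using 1
      ext y
      simp [y.2]
    · convert! (measurable_const : Measurable fun _ => (0 : ℝ)) using 1
      ext y
      have h := y.2
      rw [mem_compl_iff] at h
      simp [h]
  have hm' := hχ.continuous.measurable.mul hm
  have hw := (contDiffOn_sqrtDet (g := g) he).continuousOn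
  -- The square `(χρu)²` is the product of `χ²ρ²/√|g|`, continuous with compact support and hence
  -- bounded, and `√|g| u²`, integrable by hypothesis.
  have hc : Continuous fun y => χ y * (χ y * ρ y ^ 2 * (sqrtDet g e y)⁻¹) :=
    continuous_mul_of_tsupport_subset e.open_target hχ.continuous hχU
      ((hχ.continuous.continuousOn.mul (hρ.pow 2)).mul
        (hw.inv₀ fun y hy => (sqrtDet_pos he hy).ne'))
  obtain ⟨C, hC⟩ := exists_abs_le_of_hasCompactSupport hc hχc.mul_right
  refine ⟨hm', (memLp_two_iff_integrable_sq hm'.aestronglyMeasurable).2 ?_, hχc.mul_right⟩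
  have h := ((integrableOn_chart he hu).integrable_indicator e.open_target.measurableSet).bdd_mul
    hc.aestronglyMeasurable (Eventually.of_forall hC)
  refine h.congr (Eventually.of_forall fun y => ?_)
  by_cases hy : y ∈ e.target
  · have := (sqrtDet_pos (g := g) he hy).ne'
    simp only [indicator_of_mem hy, smul_eq_mul, Pi.mul_apply]
    field_simp
  · simp [indicator_of_notMem hy]

lemma integral_mul_chart (he : e ∈ atlas (EuclideanSpace ℝ (Fin n)) M) {f h : M → ℝ}
    (hf : AEStronglyMeasurable f (riemannianMeasure g)) (hh : Continuous h)
    (hU : tsupport h ⊆ e.source) : ∫ x, f x * h x ∂(riemannianMeasure g) =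
      ∫ y in e.target, sqrtDet g e y * (f (e.symm y) * h (e.symm y)) := by
  rw [← setIntegral_eq_integral_of_forall_compl_eq_zero (s := e.source) fun x hx => by
    rw [image_eq_zero_of_notMem_tsupport fun h => hx (hU h), mul_zero]]
  exact setIntegral_chart he (hf.mul hh.aestronglyMeasurable)

variable [T2Space M]

/-- A weak equation for the Laplacian, read in a chart. -/
lemma weak_chart (he : e ∈ atlas (EuclideanSpace ℝ (Fin n)) M) {u f : M → ℝ}
    (hu : AEStronglyMeasurable u (riemannianMeasure g))
    (hf : AEStronglyMeasurable f (riemannianMeasure g))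
    (hw : ∀ φ : M → ℝ, IsTestFunction n φ →
      ∫ x, u x * laplaceBeltrami g φ x ∂(riemannianMeasure g) =
        ∫ x, f x * φ x ∂(riemannianMeasure g)) {η : Eucl n → ℝ} (hη : ContDiff ℝ ∞ η)
    (hηc : HasCompactSupport η) (hηU : tsupport η ⊆ e.target) :
    ∫ y, e.target.indicator (fun y => u (e.symm y)) y * divForm (lapCoeff g e) η y =
      ∫ y, e.target.indicator (fun y => sqrtDet g e y * f (e.symm y)) y * η y := by
  let φ : M → ℝ := e.source.indicator (η ∘ e)
  have hφ : IsTestFunction n φ := isTestFunction_indicator_comp (isTestFunction_iff.2 ⟨hη, hηc⟩)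
    hηU e.open_source (contMDiffOn_chart he) e.continuousOn_symm e.mapsTo_symm
    fun x hx => e.left_inv hx
  have hφU : tsupport φ ⊆ e.source :=
    (tsupport_indicator_comp_subset hηc hηU e.continuousOn_symm fun x hx => e.left_inv hx).trans
      (image_subset_iff.2 fun y hy => e.map_target (hηU hy))
  have hφη : ∀ y ∈ e.target, φ (e.symm y) = η y := fun y hy => by
    simp only [φ]
    rw [indicator_of_mem (e.map_target hy), Function.comp_apply, e.right_inv hy]
  have hL := continuous_laplaceBeltrami (g := g) hφ.1
  have h := hw φ hφ
  rw [integral_mul_chart he hu hL (tsupport_laplaceBeltrami_subset.trans hφU),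
    integral_mul_chart he hf hφ.1.continuous hφU] at h
  have hind : ∀ u h : Eucl n → ℝ, ∫ y, e.target.indicator u y * h y = ∫ y in e.target, u y * h y :=
    fun u h => by
      rw [← integral_indicator e.open_target.measurableSet]
      simp only [indicator_mul_left]
  rw [hind, hind]
  -- On the left the density is absorbed, since `√|g| Δφ` is the divergence form operator applied to
  -- `η`; on the right it stays with `f`.
  refine Eq.trans ?_ (h.trans ?_)
  · refine setIntegral_congr_fun e.open_target.measurableSet fun y hy => ?_
    have hev : (fun y => φ (e.symm y)) =ᶠ[𝓝 y] η := by
      filter_upwards [e.open_target.mem_nhds hy] with z hz using hφη z hz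
    rw [← divForm_congr (EventuallyEq.refl _ _) hev, ← laplaceBeltrami_chart_symm hφ.1 he hy]
    ring
  · refine setIntegral_congr_fun e.open_target.measurableSet fun y hy => ?_
    rw [hφη y hy]
    ring

/-- Kato's inequality against test functions supported in the domain of a chart. -/
lemma kato_chart (he : e ∈ atlas (EuclideanSpace ℝ (Fin n)) M) {ψ f : M → ℂ} (hψm : Measurable ψ)
    (hfm : Measurable f) (hψ : MemLp ψ 2 (riemannianMeasure g))
    (hf : MemLp f 2 (riemannianMeasure g)) (hΔ : IsDistribLaplacian g ψ f) {φ : M → ℝ}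
    (hφ : IsTestFunction n φ) (hφU : tsupport φ ⊆ e.source) (hφ0 : ∀ x, 0 ≤ φ x) :
    ∫ x, (sgn (ψ x) * f x).re * φ x ∂(riemannianMeasure g) ≤
      ∫ x, ‖ψ x‖ * laplaceBeltrami g φ x ∂(riemannianMeasure g) := by
  have hsq : ∀ {u : M → ℂ}, MemLp u 2 (riemannianMeasure g) →
      Integrable (fun x => (u x).re ^ 2) (riemannianMeasure g) ∧
        Integrable (fun x => (u x).im ^ 2) (riemannianMeasure g) := fun hu =>
    ⟨MemLp.integrable_sq hu.re, MemLp.integrable_sq hu.im⟩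
  have hre : ∀ {u : M → ℂ}, Measurable u → Measurable fun x => (u x).re := fun hu =>
    Complex.measurable_re.comp hu
  have him : ∀ {u : M → ℂ}, Measurable u → Measurable fun x => (u x).im := fun hu =>
    Complex.measurable_im.comp hu
  have hw := (contDiffOn_sqrtDet (g := g) he).continuousOn
  have hint : ∀ {u : M → ℂ} {h : M → ℝ}, LocallyIntegrable u (riemannianMeasure g) →
      Continuous h → HasCompactSupport h →
      Integrable (fun x => u x * (h x : ℂ)) (riemannianMeasure g) := fun {u h} hu hh hhc => by
    have := hu.integrable_smul_left_of_hasCompactSupport hh hhc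
    refine this.congr (Eventually.of_forall fun x => ?_)
    simp only [Complex.real_smul]
    ring
  -- Test functions and `Δ` are real, so the complex equation decouples into its real and imaginary
  -- parts.
  have hweak : ∀ φ : M → ℝ, IsTestFunction n φ →
      ∫ x, (ψ x).re * laplaceBeltrami g φ x ∂(riemannianMeasure g) =
        ∫ x, (f x).re * φ x ∂(riemannianMeasure g) ∧
      ∫ x, (ψ x).im * laplaceBeltrami g φ x ∂(riemannianMeasure g) =
        ∫ x, (f x).im * φ x ∂(riemannianMeasure g) := fun φ hφ => by
    have i1 := hint hΔ.1 (continuous_laplaceBeltrami (g := g) hφ.1)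
      (HasCompactSupport.laplaceBeltrami hφ.2)
    have i2 := hint hΔ.2.1 hφ.1.continuous hφ.2
    have h := hΔ.2.2 φ hφ
    have r1 := integral_re i1
    have r2 := integral_re i2
    have m1 := integral_im i1
    have m2 := integral_im i2
    simp only [RCLike.re_to_complex, RCLike.im_to_complex, Complex.re_mul_ofReal,
      Complex.im_mul_ofReal] at r1 r2 m1 m2
    exact ⟨by rw [r1, r2, h], by rw [m1, m2, h]⟩
  let p : Eucl n → ℝ := e.target.indicator fun y => (ψ (e.symm y)).re
  let q : Eucl n → ℝ := e.target.indicator fun y => (ψ (e.symm y)).im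
  let F : Eucl n → ℝ := e.target.indicator fun y => sqrtDet g e y * (f (e.symm y)).re
  let G : Eucl n → ℝ := e.target.indicator fun y => sqrtDet g e y * (f (e.symm y)).im
  have hp : IsL2loc e.target p := by
    simpa using isL2loc_chart he (hre hψm) (hsq hψ).1 (ρ := fun _ => 1) continuousOn_const
  have hq : IsL2loc e.target q := by
    simpa using isL2loc_chart he (him hψm) (hsq hψ).2 (ρ := fun _ => 1) continuousOn_const
  have hF : IsL2loc e.target F := isL2loc_chart he (hre hfm) (hsq hf).1 hw
  have hG : IsL2loc e.target G := isL2loc_chart he (him hfm) (hsq hf).2 hw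
  let η : Eucl n → ℝ := e.target.indicator (φ ∘ e.symm)
  have hη : ContDiff ℝ ∞ η ∧ HasCompactSupport η := isTestFunction_iff.1
    (isTestFunction_indicator_comp hφ hφU e.open_target (contMDiffOn_chart_symm he)
      e.continuousOn e.mapsTo fun y hy => e.right_inv hy)
  have hηU : tsupport η ⊆ e.target :=
    (tsupport_indicator_comp_subset hφ.2 hφU e.continuousOn fun y hy => e.right_inv hy).trans
      (image_subset_iff.2 fun x hx => e.map_source (hφU hx))
  have hkato := kato_local e.open_target (contDiffOn_lapCoeff he) (fun y hy => lapCoeff_pos he hy)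
    hp hq hF hG
    (fun η hη hηc hηU => weak_chart he (hre hψm).aestronglyMeasurable
      (hre hfm).aestronglyMeasurable (fun φ hφ => (hweak φ hφ).1) hη hηc hηU)
    (fun η hη hηc hηU => weak_chart he (him hψm).aestronglyMeasurable
      (him hfm).aestronglyMeasurable (fun φ hφ => (hweak φ hφ).2) hη hηc hηU)
    hη.1 hη.2 hηU fun y => indicator_nonneg (fun y _ => hφ0 _) y
  have hnorm : ∀ z : ℂ, √(z.re ^ 2 + z.im ^ 2) = ‖z‖ := fun z => by
    rw [Complex.norm_def, Complex.normSq_apply, sq, sq]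
  have hL := continuous_laplaceBeltrami (g := g) hφ.1
  have hsm : Measurable fun x => (sgn (ψ x) * f x).re := hre ((measurable_sgn.comp hψm).mul hfm)
  rw [integral_mul_chart he hsm.aestronglyMeasurable hφ.1.continuous hφU,
    integral_mul_chart he hψm.norm.aestronglyMeasurable hL
      (tsupport_laplaceBeltrami_subset.trans hφU)]
  rw [← setIntegral_eq_integral_of_forall_compl_eq_zero (s := e.target) fun y hy => by
      rw [image_eq_zero_of_notMem_tsupport fun h => hy (hηU h), mul_zero],
    ← setIntegral_eq_integral_of_forall_compl_eq_zero (s := e.target)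
      (f := fun y => √(p y ^ 2 + q y ^ 2) * divForm (lapCoeff g e) η y) fun y hy => by
        simp only [p, q, indicator_of_notMem hy]
        simp] at hkato
  refine le_trans (le_of_eq ?_) (hkato.trans (le_of_eq ?_))
  · refine setIntegral_congr_fun e.open_target.measurableSet fun y hy => ?_
    simp only [p, q, F, G, η, indicator_of_mem hy, hnorm, re_sgn_mul,
      Function.comp_apply]
    ring
  · refine setIntegral_congr_fun e.open_target.measurableSet fun y hy => ?_
    have hev : η =ᶠ[𝓝 y] fun y => φ (e.symm y) := by
      filter_upwards [e.open_target.mem_nhds hy] with z hz using indicator_of_mem hz _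
    simp only [p, q, indicator_of_mem hy, hnorm]
    rw [divForm_congr (EventuallyEq.refl _ _) hev, ← laplaceBeltrami_chart_symm hφ.1 he hy]
    ring

variable [SigmaCompactSpace M]

lemma kato_of_measurable {ψ f : M → ℂ} (hψm : Measurable ψ)
    (hfm : Measurable f) (hψ : MemLp ψ 2 (riemannianMeasure g))
    (hf : MemLp f 2 (riemannianMeasure g)) (hΔ : IsDistribLaplacian g ψ f) :
    DistribLaplacianGE g (fun x => ‖ψ x‖) fun x => (sgn (ψ x) * f x).re := by
  have h1 : LocallyIntegrable (fun x => ‖ψ x‖) (riemannianMeasure g) :=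
    hΔ.1.mono hψm.norm.aestronglyMeasurable (Eventually.of_forall fun x => by simp)
  have h2 : LocallyIntegrable (fun x => (sgn (ψ x) * f x).re) (riemannianMeasure g) := by
    refine hΔ.2.1.mono (Complex.measurable_re.comp
      ((measurable_sgn.comp hψm).mul hfm)).aestronglyMeasurable (Eventually.of_forall fun x => ?_)
    refine (Complex.abs_re_le_norm _).trans ?_
    rw [norm_mul]
    exact mul_le_of_le_one_left (norm_nonneg _) (norm_sgn_le _)
  refine ⟨h1, h2, fun φ hφ hφ0 => ?_⟩
  -- The pieces stay nonnegative, so the inequality holds for each in its own chart, and both sides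
  -- are additive in `φ`.
  obtain ⟨s, φ', hφ', hφ'0, hsub, hsum⟩ := exists_sum_testFunction hφ hφ0
  have e1 : ∀ x, (sgn (ψ x) * f x).re * φ x = ∑ c ∈ s, (sgn (ψ x) * f x).re * φ' c x := fun x => by
    rw [hsum, Finset.mul_sum]
  have e2 : ∀ x, ‖ψ x‖ * laplaceBeltrami g φ x = ∑ c ∈ s, ‖ψ x‖ * laplaceBeltrami g (φ' c) x :=
    fun x => by rw [hsum, laplaceBeltrami_sum fun c _ => (hφ' c).1, Finset.mul_sum]
  have i1 : ∀ c, Integrable (fun x => (sgn (ψ x) * f x).re * φ' c x) (riemannianMeasure g) :=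
    fun c => h2.integrable_smul_right_of_hasCompactSupport (hφ' c).1.continuous (hφ' c).2
  have i2 : ∀ c, Integrable (fun x => ‖ψ x‖ * laplaceBeltrami g (φ' c) x) (riemannianMeasure g) :=
    fun c => h1.integrable_smul_right_of_hasCompactSupport (continuous_laplaceBeltrami (hφ' c).1)
      (HasCompactSupport.laplaceBeltrami (hφ' c).2)
  simp only [e1, e2]
  rw [integral_finsetSum _ fun c _ => i1 c, integral_finsetSum _ fun c _ => i2 c]
  exact Finset.sum_le_sum fun c _ =>
    kato_chart (chart_mem_atlas _ c) hψm hfm hψ hf hΔ (hφ' c) (hsub c) (hφ'0 c)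

end ChartReduction

end KatoManifold

end

theorem mainTheorem6 {n : ℕ} {M : Type*} [TopologicalSpace M] [T2Space M] [SigmaCompactSpace M]
    [ChartedSpace (EuclideanSpace ℝ (Fin n)) M] [IsManifold (𝓡 n) ∞ M]
    [MeasurableSpace M] [BorelSpace M]
    (g : KatoManifold.SmoothMetric n M) (ψ Δψ : M → ℂ)
    (hψ : MemLp ψ 2 (KatoManifold.riemannianMeasure g))
    (hΔψ : MemLp Δψ 2 (KatoManifold.riemannianMeasure g))
    (hΔ : KatoManifold.IsDistribLaplacian g ψ Δψ) :
    KatoManifold.DistribLaplacianGE g (fun x => ‖ψ x‖)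
      (fun x => (KatoManifold.sgn (ψ x) * Δψ x).re) := by
  -- Pulling back to charts uses genuinely measurable functions, so `ψ` and `Δψ` are replaced by
  -- measurable representatives; all quantities involved depend only on almost everywhere classes.
  have hψm := hψ.1.stronglyMeasurable_mk.measurable
  have hfm := hΔψ.1.stronglyMeasurable_mk.measurable
  have e1 := hψ.1.ae_eq_mk
  have e2 := hΔψ.1.ae_eq_mk
  obtain ⟨k1, k2, k3⟩ := KatoManifold.kato_of_measurable hψm hfm (hψ.ae_eq e1) (hΔψ.ae_eq e2)
    ⟨hΔ.1.congr e1, hΔ.2.1.congr e2, fun φ hφ => by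
      rw [← KatoManifold.integral_mul_congr e1, ← KatoManifold.integral_mul_congr e2]
      exact hΔ.2.2 φ hφ⟩
  have d1 : (fun x => ‖hψ.1.mk ψ x‖) =ᵐ[KatoManifold.riemannianMeasure g] fun x => ‖ψ x‖ := by
    filter_upwards [e1] with x hx
    rw [hx]
  have d2 : (fun x => (KatoManifold.sgn (hψ.1.mk ψ x) * hΔψ.1.mk Δψ x).re)
      =ᵐ[KatoManifold.riemannianMeasure g]
      fun x => (KatoManifold.sgn (ψ x) * Δψ x).re := by
    filter_upwards [e1, e2] with x hx hx'
    rw [hx, hx']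
  refine ⟨k1.congr d1, k2.congr d2, fun φ hφ hφ0 => ?_⟩
  have h := k3 φ hφ hφ0
  rwa [KatoManifold.integral_mul_congr d1, KatoManifold.integral_mul_congr d2] at h
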